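/- **Theorem.** $\#\mathrm{FO}^{\mathrm{rel}} = \#\mathrm{FO} = \#\mathrm{P}$, as classes of functions $f\colon\{0,1\}^*\to\mathbb{N}$, where the three classes are defined as follows. *Structures and encodings.* A vocabulary $\sigma$ consists of finitely many relation symbols of positive arity and finitely many constant symbols. A $\sigma$-structure $\mathcal{A}$ has universe $\{0,\dots,n-1\}$ for some $n\ge 1$. Its encoding $\mathrm{enc}_\sigma(\mathcal{A})\in\{0,1\}^*$ is the concatenation of the truth tables of its relations (tuples in lexicographic order) followed by the binary representations of its constants (with $\lceil\log_2 n\rceil$ bits each, most significant bit first); if $\sigma$ has no relation symbol, then, as usual, the encoding starts with the truth table $0^n$ of an always false unary relation. Built-in symbols have a fixed meaning and are not encoded: $\le$ is the order of the natural numbers, $\min$ is $0$, and $\mathrm{BIT}(i,j)$ holds iff the $i$-th bit of the binary representation of $j$ is $1$ (bit $0$ being the least significant). *The class $\#\mathrm{FO}^{\mathrm{rel}}$.* $f\in\#\mathrm{FO}^{\mathrm{rel}}$ iff there are a vocabulary $\sigma$ and a first-order formula (with equality) $\varphi(R_1,\dots,R_k,x_1,\dots,x_\ell)$ over $\sigma$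 and built-in $\le$, with free relation variables $R_1,\dots,R_k$ of arbitrary arities and free individual variables $x_1,\dots,x_\ell$, such that - $f(\mathrm{enc}_\sigma(\mathcal{A}))=\bigl|\{(S_1,\dots,S_k,c_1,\dots,c_\ell)\mid \mathcal{A}\models\varphi(S_1,\dots,S_k,c_1,\dots,c_\ell)\}\bigr|$ for every $\sigma$-structure $\mathcal{A}$, and - $f(w)=0$ for every nonempty word $w$ that is not the encoding of a $\sigma$-structure. *The class $\#\mathrm{FO}$.* $f\in\#\mathrm{FO}$ iff there are a vocabulary $\sigma$ and a first-order formula (with equality) $\varphi(F_1,\dots,F_k,x_1,\dots,x_\ell)$ over $\sigma$ and built-in $\le$, $\mathrm{BIT}$, $\min$, with free function variables $F_1,\dots,F_k$ of arbitrary arities and free individual variables $x_1,\dots,x_\ell$, such that - $f(\mathrm{enc}_\sigma(\mathcal{A}))=\bigl|\{(f_1,\dots,f_k,c_1,\dots,c_\ell)\mid \mathcal{A}\models\varphi(f_1,\dots,f_k,c_1,\dots,c_\ell)\}\bigr|$ for every $\sigma$-structure $\mathcal{A}$ with at least two elements, and - $f(w)=0$ for every nonempty word $w$ that is not the encoding of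 a $\sigma$-structure. *The class $\#\mathrm{P}$.* $f\in\#\mathrm{P}$ iff there is a nondeterministic polynomial-time (multitape) Turing machine $M$ such that, for every $x\in\{0,1\}^*$, $f(x)$ is the number of accepting computation paths of $M$ on input $x$; polynomial time means that for some polynomial $p$ no computation of $M$ on any input $x$ makes more than $p(|x|)$ steps. -/

import Mathlib

/-! ### Vocabularies, finite structures and their binary encodings -/

namespace CountFO

open FirstOrder

/-- A finite vocabulary: finitely many relation symbols of positive arity and finitely many
constant symbols, both listed in a fixed order. Built-in symbols are not listed here; they are
added by the languages `RelLang` and `FunLang` below. -/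
structure Vocabulary where
  numRel : ℕ
  arity : Fin numRel → ℕ
  arity_pos : ∀ i, 0 < arity i
  numConst : ℕ

/-- A finite structure over `σ`, with nonempty universe `{0, …, n - 1}`. -/
structure Struc (σ : Vocabulary) where
  n : ℕ
  n_pos : 0 < n
  rel : ∀ i : Fin σ.numRel, Set (Fin (σ.arity i) → Fin n)
  const : Fin σ.numConst → Fin n

open Classical in
/-- The truth table of an `a`-ary relation on `{0, …, n - 1}`, row by row: the tuples are listed
in lexicographic order, the first coordinate being the most significant one. -/
noncomputable def encRel {n a : ℕ} (R : Set (Fin a → Fin n)) : List Bool :=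
  List.ofFn fun p : Fin (n ^ a) =>
    decide ((fun i => finFunctionFinEquiv.symm p (Fin.rev i)) ∈ R)

/-- The binary representation of `c ∈ {0, …, n - 1}`, with `⌈log₂ n⌉` bits, most significant
bit first. -/
def encConst {n : ℕ} (c : Fin n) : List Bool :=
  List.ofFn fun i : Fin (Nat.clog 2 n) => (c : ℕ).testBit (Fin.rev i)

/-- The binary encoding of a structure: the concatenation of the encodings of its relations and
then of its constants. As usual, for a vocabulary without relation symbols one pretends that there
is a single unary relation symbol that is always false, so that an encoding is never shorter than
the size of the universe. -/
noncomputable def enc {σ : Vocabulary} (A : Struc σ) : List Bool :=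
  (if σ.numRel = 0 then List.replicate A.n false
    else (List.finRange σ.numRel).flatMap fun i => encRel (A.rel i)) ++
  (List.finRange σ.numConst).flatMap fun i => encConst (A.const i)

/-! ### Counting assignments to free relation variables; built-in order only -/

/-- Function symbols of `RelLang σ r`: the constant symbols of `σ`. -/
inductive RelLangFun (σ : Vocabulary) : ℕ → Type
  | const (i : Fin σ.numConst) : RelLangFun σ 0

/-- Relation symbols of `RelLang σ r`: those of `σ`, the built-in order, and the relation
variables, the `j`-th one having arity `r j`. -/
inductive RelLangRel (σ : Vocabulary) {k : ℕ} (r : Fin k → ℕ) : ℕ → Type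
  | input (i : Fin σ.numRel) : RelLangRel σ r (σ.arity i)
  | le : RelLangRel σ r 2
  | var (j : Fin k) : RelLangRel σ r (r j)

/-- The first-order language over `σ` and built-in `≤`, with free relation variables of
arities `r 0, …, r (k - 1)`. -/
abbrev RelLang (σ : Vocabulary) {k : ℕ} (r : Fin k → ℕ) : Language :=
  ⟨RelLangFun σ, RelLangRel σ r⟩

/-- The interpretation of `RelLang σ r` given by a structure and an assignment to the relation
variables. -/
@[reducible] def relInterp {σ : Vocabulary} {k : ℕ} {r : Fin k → ℕ} (A : Struc σ)
    (S : ∀ j, Set (Fin (r j) → Fin A.n)) : (RelLang σ r).Structure (Fin A.n) where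
  funMap := fun {_} s _ => match s with
    | RelLangFun.const i => A.const i
  RelMap := fun {_} s => match s with
    | RelLangRel.input i => fun v => v ∈ A.rel i
    | RelLangRel.le => fun v => v 0 ≤ v 1
    | RelLangRel.var j => fun v => v ∈ S j

/-- The number of assignments `(S₁, …, Sₖ, c₁, …, cₗ)` that satisfy `φ` in `A`. -/
noncomputable def relCount {σ : Vocabulary} {k l : ℕ} {r : Fin k → ℕ}
    (φ : (RelLang σ r).Formula (Fin l)) (A : Struc σ) : ℕ :=
  Set.ncard {p : (∀ j, Set (Fin (r j) → Fin A.n)) × (Fin l → Fin A.n) |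
    @Language.Formula.Realize (RelLang σ r) (Fin A.n) (relInterp A p.1) (Fin l) φ p.2}

/-! ### Counting assignments to free function variables; built-in order, BIT and min -/

/-- Function symbols of `FunLang σ a`: the constant symbols of `σ`, the built-in constant `min`,
and the function variables, the `j`-th one having arity `a j`. -/
inductive FunLangFun (σ : Vocabulary) {k : ℕ} (a : Fin k → ℕ) : ℕ → Type
  | const (i : Fin σ.numConst) : FunLangFun σ a 0
  | min : FunLangFun σ a 0
  | var (j : Fin k) : FunLangFun σ a (a j)

/-- Relation symbols of `FunLang σ a`: those of `σ` and the built-in `≤` and `BIT`. -/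
inductive FunLangRel (σ : Vocabulary) : ℕ → Type
  | input (i : Fin σ.numRel) : FunLangRel σ (σ.arity i)
  | le : FunLangRel σ 2
  | bit : FunLangRel σ 2

/-- The first-order language over `σ` and built-in `≤`, `BIT`, `min`, with free function
variables of arities `a 0, …, a (k - 1)`. -/
abbrev FunLang (σ : Vocabulary) {k : ℕ} (a : Fin k → ℕ) : Language :=
  ⟨FunLangFun σ a, FunLangRel σ⟩

/-- The interpretation of `FunLang σ a` given by a structure and an assignment to the function
variables; `BIT(i, j)` says that the `i`-th bit of `j` is one (bit `0` being the least
significant). -/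
@[reducible] def funInterp {σ : Vocabulary} {k : ℕ} {a : Fin k → ℕ} (A : Struc σ)
    (F : ∀ j, (Fin (a j) → Fin A.n) → Fin A.n) : (FunLang σ a).Structure (Fin A.n) where
  funMap := fun {_} s => match s with
    | FunLangFun.const i => fun _ => A.const i
    | FunLangFun.min => fun _ => ⟨0, A.n_pos⟩
    | FunLangFun.var j => fun v => F j v
  RelMap := fun {_} s => match s with
    | FunLangRel.input i => fun v => v ∈ A.rel i
    | FunLangRel.le => fun v => v 0 ≤ v 1
    | FunLangRel.bit => fun v => (v 1 : ℕ).testBit (v 0 : ℕ) = true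

/-- The number of assignments `(f₁, …, fₖ, c₁, …, cₗ)` that satisfy `φ` in `A`. -/
noncomputable def funCount {σ : Vocabulary} {k l : ℕ} {a : Fin k → ℕ}
    (φ : (FunLang σ a).Formula (Fin l)) (A : Struc σ) : ℕ :=
  Set.ncard {p : (∀ j, (Fin (a j) → Fin A.n) → Fin A.n) × (Fin l → Fin A.n) |
    @Language.Formula.Realize (FunLang σ a) (Fin A.n) (funInterp A p.1) (Fin l) φ p.2}

/-! ### The two logical counting classes -/

/-- `f` vanishes on all nonempty words that encode no `σ`-structure. (The empty word encodes no
structure over any vocabulary, as universes are nonempty; the value there is not restricted.) -/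
def VanishesOffEncodings (σ : Vocabulary) (f : List Bool → ℕ) : Prop :=
  ∀ w : List Bool, w ≠ [] → (∀ A : Struc σ, enc A ≠ w) → f w = 0

/-- `#FO^rel`: counting assignments to free relation variables and free individual variables. -/
def SharpFORel : Set (List Bool → ℕ) :=
  {f | ∃ (σ : Vocabulary) (k l : ℕ) (r : Fin k → ℕ) (φ : (RelLang σ r).Formula (Fin l)),
    (∀ A : Struc σ, f (enc A) = relCount φ A) ∧ VanishesOffEncodings σ f}

/-- `#FO`: counting assignments to free function variables and free individual variables.
Structures with just one element are left out: there a tuple of function and individual variables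
has exactly one assignment. -/
def SharpFO : Set (List Bool → ℕ) :=
  {f | ∃ (σ : Vocabulary) (k l : ℕ) (a : Fin k → ℕ) (φ : (FunLang σ a).Formula (Fin l)),
    (∀ A : Struc σ, 2 ≤ A.n → f (enc A) = funCount φ A) ∧ VanishesOffEncodings σ f}

/-! ### Nondeterministic Turing machines and `#P` -/

/-- Head movements. -/
inductive Move
  | left
  | stay
  | right

/-- The displacement of a head under a movement. -/
def Move.shift : Move → ℤ
  | .left => -1
  | .stay => 0
  | .right => 1

/-- A nondeterministic Turing machine with finite state set `Q`, finite tape alphabet `Γ`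
(containing the two input bits and a separate blank) and `k + 1` two-way infinite tapes.
`δ q s` is the set of possible actions (new state, symbols written, head movements) in state `q`
when the heads read `s`. -/
structure NTM where
  Q : Type
  Γ : Type
  finQ : Finite Q
  finΓ : Finite Γ
  k : ℕ
  start : Q
  accept : Set Q
  blank : Γ
  bit : Bool → Γ
  bit_injective : Function.Injective bit
  bit_ne_blank : ∀ b, bit b ≠ blank
  δ : Q → (Fin (k + 1) → Γ) → Set (Q × (Fin (k + 1) → Γ) × (Fin (k + 1) → Move))

namespace NTM

/-- A configuration: state, head positions and tape contents. -/
@[ext] structure Cfg (M : NTM) where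
  state : M.Q
  head : Fin (M.k + 1) → ℤ
  tape : Fin (M.k + 1) → ℤ → M.Γ

/-- The configuration after performing the action `t`. Since heads have absolute positions,
different actions always lead to different configurations. -/
def Cfg.after {M : NTM} (c : M.Cfg)
    (t : M.Q × (Fin (M.k + 1) → M.Γ) × (Fin (M.k + 1) → Move)) : M.Cfg where
  state := t.1
  head := fun i => c.head i + (t.2.2 i).shift
  tape := fun i => Function.update (c.tape i) (c.head i) (t.2.1 i)

/-- One computation step. -/
def Step (M : NTM) (c d : M.Cfg) : Prop :=
  ∃ t ∈ M.δ c.state (fun i => c.tape i (c.head i)), d = c.after t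

/-- The initial configuration on input `x`: the word `x` is written on tape `0` in the cells
`0, …, |x| - 1`, everything else is blank, and all heads are at cell `0`. -/
def init (M : NTM) (x : List Bool) : M.Cfg where
  state := M.start
  head := fun _ => 0
  tape := fun i z =>
    if i = 0 ∧ 0 ≤ z then ((x[z.toNat]?).map M.bit).getD M.blank else M.blank

/-- `c₀ → c₁ → … → cₘ` is a (possibly partial) computation of `M` on input `x`; it is given by the
list `[c₁, …, cₘ]`, whose length is the number of steps, and `c₀` is the initial configuration. -/
def IsComputation (M : NTM) (x : List Bool) (p : List M.Cfg) : Prop :=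
  List.IsChain M.Step (M.init x :: p)

/-- The last configuration of a computation. -/
def last (M : NTM) (x : List Bool) (p : List M.Cfg) : M.Cfg :=
  (M.init x :: p).getLast (List.cons_ne_nil _ _)

/-- An accepting computation path: a computation that has halted (no further step is possible) in
an accepting state. -/
def IsAcceptingPath (M : NTM) (x : List Bool) (p : List M.Cfg) : Prop :=
  M.IsComputation x p ∧ (∀ d, ¬ M.Step (M.last x p) d) ∧ (M.last x p).state ∈ M.accept

/-- `M` runs in polynomial time: on input `x` no computation makes more than `p(|x|)` steps. -/
def PolyTime (M : NTM) : Prop :=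
  ∃ p : Polynomial ℕ, ∀ (x : List Bool) (c : List M.Cfg),
    M.IsComputation x c → c.length ≤ p.eval x.length

end NTM

/-- `#P`: the functions that give the number of accepting computation paths of a nondeterministic
polynomial-time Turing machine. -/
def SharpP : Set (List Bool → ℕ) :=
  {f | ∃ M : NTM, M.PolyTime ∧
    ∀ x : List Bool, Set.encard {p : List M.Cfg | M.IsAcceptingPath x p} = (f x : ℕ∞)}

end CountFO

/-! The classes are compared in a cycle, `SharpFORel` ⊆ `SharpFO` ⊆ `SharpP` ⊆ `SharpFORel`. Since
values have to be preserved exactly, every inclusion rests on a bijection between witnesses.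

Relations to functions (`exists_funLang_formula`): a relation is coded by a function whose support
it is. An atom `R x` becomes `F x ≠ min`, and a further conjunct forces the values of `F` to be `0`
or `1`; over a universe with at least two elements this makes the coding one to one. Smaller
universes are not restricted in `SharpFO`.

Functions to machines (`sharpFO_subset_sharpP`): on input `w` a machine guesses a size `n ≤ |w|`,
guesses tables for the graphs of the functions, for the individual variables and for some auxiliary
relations, copies the relations and constants from the input, and evaluates a formula
deterministically. Accepting paths then correspond to the tables that satisfy the formula and are
compatible with `w` (`exists_NTM_count_tables`). The formula contains the condition `Shape`: graphs
are graphs, and the table for BIT is the true one, which the recursion of binary increment pins down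
by the order alone. So the auxiliary guesses do not multiply the count, and as encodings are
injective (`enc_injective`), what is counted are the assignments in the only structure encoded by
`w`. The evaluation is polynomial because every pair of a table and a tuple of variables has its own
tape with a copy of the table, whose head stands on the row given by the current values of the
variables. An atom costs one look; changing a variable by one displaces each head by a fixed
combination of powers of `n`, which nested loops over rulers of length `n` carry out
(`exists_runs_eval`).

Machines to relations (`sharpP_subset_sharpFORel`): a word is a structure with one unary relation on
its positions. Times and tape cells are written with `E + 2` digits in base `n`, and one relation
variable for each local label describes the tableau of a computation. The local conditions on
tableaux are first-order. Slices after halting are required to be empty, so each accepting path has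
exactly one tableau (`NTM.encard_isTableau`).

Universes with one element need separate care: base `1` is useless for tableaux, and `SharpFO` ties
no formula to these structures. Only finitely many values of `f` are involved, so they are
hard-wired: `K` auxiliary relation symbols are used, exactly one of them nonempty, with an index
below the value. On the empty word the machine for a function of `SharpFO` branches directly into
the right number of accepting states; the logical classes leave that value free.

Two devices keep the bookkeeping small. Machines are assembled from program fragments whose
specification `Frag.Runs` composes, and formulas are hardly ever written out: `UDef` expresses
definability by one formula throughout a family of structures and is closed under the logical
operations. -/

namespace CountFO

open FirstOrder
open scoped Classical

section

/-! ### Multitape machines as transition relations on stores -/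

/-- Head positions and contents of the tapes of a machine, the tapes being indexed by `ι`. -/
@[ext] structure Store (ι Γ : Type) where
  head : ι → ℤ
  tape : ι → ℤ → Γ

/-- Symbols written and head movements. -/
abbrev Act (ι Γ : Type) := (ι → Γ) × (ι → Move)

variable {ι Γ Q : Type}

/-- The symbols read by the heads. -/
def Store.scan (s : Store ι Γ) : ι → Γ := fun i => s.tape i (s.head i)

/-- The store after an action. -/
noncomputable def Store.after (s : Store ι Γ) (a : Act ι Γ) : Store ι Γ where
  head := fun i => s.head i + (a.2 i).shift
  tape := fun i => Function.update (s.tape i) (s.head i) (a.1 i)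

/-- A transition relation with states `Q`. -/
abbrev Trans (Q ι Γ : Type) := Q → (ι → Γ) → Set (Q × Act ι Γ)

/-- `Counts δ acc q s T m`: from state `q` and store `s`, no computation has more than `T` steps,
and exactly `m` computations halt in a state of `acc`. -/
inductive Counts (δ : Trans Q ι Γ) (acc : Set Q) : Q → Store ι Γ → ℕ → ℕ → Prop
  | halt (q : Q) (s : Store ι Γ) (T : ℕ) (h : δ q s.scan = ∅) :
      Counts δ acc q s T (if q ∈ acc then 1 else 0)
  | step (q : Q) (s : Store ι Γ) (T : ℕ) (A : Finset (Q × Act ι Γ)) (m : Q × Act ι Γ → ℕ)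
      (h : δ q s.scan = ↑A) (hA : A.Nonempty)
      (hm : ∀ a ∈ A, Counts δ acc a.1 (s.after a.2) T (m a)) :
      Counts δ acc q s (T + 1) (∑ a ∈ A, m a)

theorem Counts.mono {δ : Trans Q ι Γ} {acc : Set Q} {q : Q} {s : Store ι Γ} {T m : ℕ}
    (h : Counts δ acc q s T m) : ∀ {T' : ℕ}, T ≤ T' → Counts δ acc q s T' m := by
  induction h with
  | halt q s T h => exact fun _ => .halt q s _ h
  | step q s T A m h hA hm ih =>
    intro T' hT
    obtain ⟨T'', rfl⟩ : ∃ T'', T' = T'' + 1 := ⟨T' - 1, by omega⟩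
    exact .step q s T'' A m h hA fun a ha => ih a ha (by omega)

/-- The transition set at a store decides between halting and stepping and determines the finite set
of actions. Uniqueness lets `Frag.Runs.counts` treat the count as a function of the store. -/
theorem Counts.unique {δ : Trans Q ι Γ} {acc : Set Q} {q : Q} {s : Store ι Γ} {T m : ℕ}
    (h : Counts δ acc q s T m) : ∀ {T' m' : ℕ}, Counts δ acc q s T' m' → m = m' := by
  induction h with
  | halt q s T h =>
    intro T' m' h'
    cases h' with
    | halt _ _ _ h' => rfl
    | step _ _ _ A m h' hA hm =>
      rw [h] at h'
      exact absurd (Finset.coe_eq_empty.1 h'.symm) hA.ne_empty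
  | step q s T A m h hA hm ih =>
    intro T' m' h'
    cases h' with
    | halt _ _ _ h' =>
      rw [h'] at h
      exact absurd (Finset.coe_eq_empty.1 h.symm) hA.ne_empty
    | step _ _ _ A' m' h' hA' hm' =>
      obtain rfl : A = A' := Finset.coe_injective (h.symm.trans h')
      exact Finset.sum_congr rfl fun a ha => ih a ha (hm' a ha)

/-- A machine with binary alphabet and blank given by a transition relation. -/
@[reducible] def mkNTM [Finite Q] {k : ℕ} (e : ι ≃ Fin (k + 1)) (δ : Trans Q ι (Option Bool)) (start : Q)
    (acc : Set Q) : NTM where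
  Q := Q
  Γ := Option Bool
  finQ := inferInstance
  finΓ := inferInstance
  k := k
  start := start
  accept := acc
  blank := none
  bit := some
  bit_injective := Option.some_injective _
  bit_ne_blank := fun _ => by simp
  δ := fun q s => {t | (t.1, (fun i => t.2.1 (e i)), fun i => t.2.2 (e i)) ∈ δ q fun i => s (e i)}

section mkNTM

variable [Finite Q] {k : ℕ} (e : ι ≃ Fin (k + 1)) (δ : Trans Q ι (Option Bool)) (start : Q)
    (acc : Set Q)

/-- The configuration of `mkNTM` given by a state and a store. -/
def mkCfg (q : Q) (s : Store ι (Option Bool)) : (mkNTM e δ start acc).Cfg where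
  state := q
  head := fun i => s.head (e.symm i)
  tape := fun i => s.tape (e.symm i)

theorem mkNTM_step_iff (q : Q) (s : Store ι (Option Bool)) (d : (mkNTM e δ start acc).Cfg) :
    (mkNTM e δ start acc).Step (mkCfg e δ start acc q s) d ↔
      ∃ a ∈ δ q s.scan, d = mkCfg e δ start acc a.1 (s.after a.2) := by
  have hs : (fun j => (fun i => (mkCfg e δ start acc q s).tape i ((mkCfg e δ start acc q s).head i)) (e j))
      = s.scan := by
    funext i
    simp [mkCfg, Store.scan]
  constructor
  · rintro ⟨t, ht, rfl⟩
    refine ⟨(t.1, (fun i => t.2.1 (e i)), fun i => t.2.2 (e i)), ?_, ?_⟩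
    · rw [← hs]
      exact ht
    · ext1
      · rfl
      · funext i
        simp [mkCfg, NTM.Cfg.after, Store.after]
      · funext i
        simp [mkCfg, NTM.Cfg.after, Store.after]
  · rintro ⟨a, ha, rfl⟩
    refine ⟨(a.1, (fun i => a.2.1 (e.symm i)), fun i => a.2.2 (e.symm i)), ?_, ?_⟩
    · rw [← hs] at ha
      change (_, _, _) ∈ δ q _
      simpa using ha
    · ext1
      · rfl
      · funext i
        simp [mkCfg, NTM.Cfg.after, Store.after]
      · funext i
        simp [mkCfg, NTM.Cfg.after, Store.after]

/-- Paths are lists of configurations, whereas `Counts` sums over actions. The two agree because an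
action can be recovered from its result: the written symbol is found at the old head position, the
movement is the difference of the head positions. -/
theorem mkCfg_after_injective (s : Store ι (Option Bool)) {a b : Q × Act ι (Option Bool)}
    (h : mkCfg e δ start acc a.1 (s.after a.2) = mkCfg e δ start acc b.1 (s.after b.2)) :
    a = b := by
  have h1 : a.1 = b.1 := congrArg NTM.Cfg.state h
  have h2 := congrArg NTM.Cfg.head h
  have h3 := congrArg NTM.Cfg.tape h
  refine Prod.ext h1 (Prod.ext ?_ ?_)
  · funext i
    have := congrFun (congrFun h3 (e i)) (s.head i)
    simp only [mkCfg, Store.after, Equiv.symm_apply_apply, Function.update_self] at this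
    exact this
  · funext i
    have := congrFun h2 (e i)
    simp only [mkCfg, Store.after, Equiv.symm_apply_apply, add_right_inj] at this
    revert this
    rcases a.2.2 i <;> rcases b.2.2 i <;> simp [Move.shift]

/-- The halting accepting computations starting from `c`. -/
def NTM.pathsFrom (M : NTM) (c : M.Cfg) : Set (List M.Cfg) :=
  {p | List.IsChain M.Step (c :: p) ∧
    (∀ d, ¬ M.Step ((c :: p).getLast (List.cons_ne_nil _ _)) d) ∧
    ((c :: p).getLast (List.cons_ne_nil _ _)).state ∈ M.accept}

theorem NTM.nil_mem_pathsFrom (M : NTM) (c : M.Cfg) :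
    [] ∈ M.pathsFrom c ↔ (∀ d, ¬ M.Step c d) ∧ c.state ∈ M.accept := by
  simp [NTM.pathsFrom]

theorem NTM.cons_mem_pathsFrom (M : NTM) (c d : M.Cfg) (p : List M.Cfg) :
    d :: p ∈ M.pathsFrom c ↔ M.Step c d ∧ p ∈ M.pathsFrom d := by
  simp [NTM.pathsFrom, and_assoc]

theorem encard_biUnion_finset {α β : Type*} (A : Finset α) (f : α → Set β)
    (hd : ∀ a ∈ A, ∀ b ∈ A, a ≠ b → Disjoint (f a) (f b)) :
    (⋃ a ∈ A, f a).encard = ∑ a ∈ A, (f a).encard := by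
  induction A using Finset.induction_on with
  | empty => simp
  | insert a A ha ih =>
    rw [Finset.set_biUnion_insert, Set.encard_union_eq, Finset.sum_insert ha, ih]
    · exact fun x hx y hy => hd x (Finset.mem_insert_of_mem hx) y (Finset.mem_insert_of_mem hy)
    · simp only [Set.disjoint_iUnion_right]
      intro b hb
      exact hd a (Finset.mem_insert_self _ _) b (Finset.mem_insert_of_mem hb)
        (fun h => ha (h ▸ hb))

/-- A path from a store that has not halted consists of its first action and a path from the next
store; different actions contribute disjoint sets of paths, so the cardinalities add up as in
`Counts.step`. -/
theorem Counts.mkNTM {q : Q} {s : Store ι (Option Bool)} {T m : ℕ}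
    (h : Counts δ acc q s T m) :
    ((mkNTM e δ start acc).pathsFrom (mkCfg e δ start acc q s)).encard = m ∧
      ∀ p, List.IsChain (mkNTM e δ start acc).Step (mkCfg e δ start acc q s :: p) →
        p.length ≤ T := by
  induction h with
  | halt q s T h =>
    have hno : ∀ d, ¬ (CountFO.mkNTM e δ start acc).Step (mkCfg e δ start acc q s) d := by
      intro d
      rw [mkNTM_step_iff, h]
      simp
    constructor
    · by_cases hq : q ∈ acc
      · have : (CountFO.mkNTM e δ start acc).pathsFrom (mkCfg e δ start acc q s) = {[]} := by
          ext p
          cases p with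
          | nil => simp only [NTM.nil_mem_pathsFrom, Set.mem_singleton_iff, iff_true]; exact ⟨hno, hq⟩
          | cons d p => simp [NTM.cons_mem_pathsFrom, hno]
        rw [this]
        simp [hq]
      · have : (CountFO.mkNTM e δ start acc).pathsFrom (mkCfg e δ start acc q s) = ∅ := by
          ext p
          cases p with
          | nil =>
            simp only [NTM.nil_mem_pathsFrom, Set.mem_empty_iff_false, iff_false, not_and]
            exact fun _ => hq
          | cons d p => simp [NTM.cons_mem_pathsFrom, hno]
        rw [this]
        simp [hq]
    · intro p hp
      cases p with
      | nil => simp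
      | cons d p =>
        rw [List.isChain_cons_cons] at hp
        exact absurd hp.1 (hno d)
  | step q s T A m h hA hm ih =>
    constructor
    · have : (CountFO.mkNTM e δ start acc).pathsFrom (mkCfg e δ start acc q s) =
          ⋃ a ∈ A, (List.cons (mkCfg e δ start acc a.1 (s.after a.2))) ''
            (CountFO.mkNTM e δ start acc).pathsFrom (mkCfg e δ start acc a.1 (s.after a.2)) := by
        ext p
        cases p with
        | nil =>
          simp only [NTM.nil_mem_pathsFrom, Set.mem_iUnion, Set.mem_image]
          constructor
          · rintro ⟨hn, -⟩
            obtain ⟨a, ha⟩ := hA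
            refine absurd ?_ (hn (mkCfg e δ start acc a.1 (s.after a.2)))
            rw [mkNTM_step_iff, h]
            exact ⟨a, ha, rfl⟩
          · simp
        | cons d p =>
          simp only [NTM.cons_mem_pathsFrom, Set.mem_iUnion, Set.mem_image, mkNTM_step_iff, h,
            List.cons.injEq, Finset.mem_coe]
          constructor
          · rintro ⟨⟨a, ha, rfl⟩, hp⟩
            exact ⟨a, ha, p, hp, rfl, rfl⟩
          · rintro ⟨a, ha, p', hp, rfl, rfl⟩
            exact ⟨⟨a, ha, rfl⟩, hp⟩
      rw [this, encard_biUnion_finset]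
      · rw [Nat.cast_sum]
        refine Finset.sum_congr rfl fun a ha => ?_
        rw [(List.cons_injective).encard_image, (ih a ha).1]
      · intro a _ b _ hab
        rw [Set.disjoint_left]
        rintro _ ⟨p, -, rfl⟩ ⟨p', -, hp'⟩
        rw [List.cons.injEq] at hp'
        exact hab (mkCfg_after_injective e δ start acc s hp'.1.symm)
    · intro p hp
      cases p with
      | nil => simp
      | cons d p =>
        rw [List.isChain_cons_cons, mkNTM_step_iff, h] at hp
        obtain ⟨⟨a, ha, rfl⟩, hp⟩ := hp
        have := (ih a ha).2 p hp
        simpa using this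

end mkNTM

/-! ### Program fragments -/

/-- A program fragment: in each of its states it performs one of finitely many actions and moves
to another of its states or leaves the fragment (`none`). -/
structure Frag (ι Γ : Type) where
  St : Type
  fin : Finite St
  entry : St
  step : St → (ι → Γ) → Set (Option St × Act ι Γ)

/-- The fragment `f` occurs in the machine with transition relation `δ` through the map `e` of
states, with exit state `x`. -/
def Frag.In (f : Frag ι Γ) (δ : Trans Q ι Γ) (acc : Set Q) (e : f.St → Q) (x : Q) : Prop :=
  (∀ y s, δ (e y) s = (fun a : Option f.St × Act ι Γ => (a.1.elim x e, a.2)) '' f.step y s) ∧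
    ∀ y, e y ∉ acc

/-- Started with the store `s`, the fragment `f` makes at most `t` steps before leaving,
and the stores on leaving are those of `μ`, each through the given number of computations. -/
def Frag.Runs (f : Frag ι Γ) (s : Store ι Γ) (t : ℕ) (μ : Multiset (Store ι Γ)) : Prop :=
  ∀ (Q : Type) (δ : Trans Q ι Γ) (acc : Set Q) (e : f.St → Q) (x : Q), f.In δ acc e x →
    ∀ (T : ℕ) (m : Store ι Γ → ℕ), (∀ s' ∈ μ, Counts δ acc x s' T (m s')) →
      Counts δ acc (e f.entry) s (T + t) (μ.map m).sum

theorem Frag.Runs.mono {f : Frag ι Γ} {s : Store ι Γ} {t t' : ℕ} {μ : Multiset (Store ι Γ)}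
    (h : f.Runs s t μ) (ht : t ≤ t') : f.Runs s t' μ :=
  fun Q δ acc e x hf T m hm => (h Q δ acc e x hf T m hm).mono (by omega)

/-- Outcomes are usually indexed by some type `X` through a map `st` that need not be injective,
while `Frag.Runs` wants counts that depend on the store. By `Counts.unique` the count depends on the
store only, so it can be chosen there. -/
theorem Frag.Runs.counts {X : Type*} {f : Frag ι Γ} {s : Store ι Γ} {t : ℕ} {μ : Multiset X}
    {st : X → Store ι Γ} (h : f.Runs s t (μ.map st)) {δ : Trans Q ι Γ} {acc : Set Q}
    {e : f.St → Q} {x : Q} (hf : f.In δ acc e x) {T : ℕ} {m : X → ℕ}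
    (hm : ∀ y ∈ μ, Counts δ acc x (st y) T (m y)) :
    Counts δ acc (e f.entry) s (T + t) (μ.map m).sum := by
  have key : ∀ y ∈ μ, (if h : ∃ v, Counts δ acc x (st y) T v then h.choose else 0) = m y := by
    intro y hy
    have hy' : ∃ v, Counts δ acc x (st y) T v := ⟨_, hm y hy⟩
    rw [dif_pos hy']
    exact hy'.choose_spec.unique (hm y hy)
  have := h Q δ acc e x hf T
    (fun s' => if h : ∃ v, Counts δ acc x s' T v then h.choose else 0) (by
      intro s' hs'
      obtain ⟨y, hy, rfl⟩ := Multiset.mem_map.1 hs'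
      simp only [key y hy]
      exact hm y hy)
  rw [Multiset.map_map] at this
  have e1 := Multiset.map_congr (f := (fun s' => if h : ∃ v, Counts δ acc x s' T v then h.choose
    else 0) ∘ st) rfl key
  rwa [e1] at this

namespace Frag

/-- A single nondeterministic action. -/
@[reducible] def act (R : (ι → Γ) → Finset (Act ι Γ)) : Frag ι Γ where
  St := Unit
  fin := inferInstance
  entry := ()
  step := fun _ s => {a | a.1 = none ∧ a.2 ∈ R s}

/-- Sequential composition. -/
@[reducible] def seq (f g : Frag ι Γ) : Frag ι Γ where
  St := f.St ⊕ g.St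
  fin := have := f.fin; have := g.fin; inferInstance
  entry := Sum.inl f.entry
  step := fun y s => match y with
    | .inl y => (fun a => (some (a.1.elim (Sum.inr g.entry) Sum.inl), a.2)) '' f.step y s
    | .inr y => (fun a => (a.1.map Sum.inr, a.2)) '' g.step y s

/-- Branching. -/
@[reducible] def ite (P : (ι → Γ) → Prop) (f g : Frag ι Γ) : Frag ι Γ where
  St := Option (f.St ⊕ g.St)
  fin := have := f.fin; have := g.fin; inferInstance
  entry := none
  step := fun y s => match y with
    | none => {(some (some (if P s then .inl f.entry else .inr g.entry)), s, fun _ => .stay)}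
    | some (.inl y) => (fun a => (a.1.map fun z => some (.inl z), a.2)) '' f.step y s
    | some (.inr y) => (fun a => (a.1.map fun z => some (.inr z), a.2)) '' g.step y s

/-- Iteration. -/
@[reducible] def rpt (P : (ι → Γ) → Prop) (f : Frag ι Γ) : Frag ι Γ where
  St := Option f.St
  fin := have := f.fin; inferInstance
  entry := none
  step := fun y s => match y with
    | none => {((if P s then some (some f.entry) else none), s, fun _ => .stay)}
    | some y => (fun a => (some (a.1.elim none some), a.2)) '' f.step y s

theorem runs_act (R : (ι → Γ) → Finset (Act ι Γ)) (s : Store ι Γ) :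
    (act R).Runs s 1 ((R s.scan).val.map s.after) := by
  intro Q δ acc e x hf T m hm
  have hδ : δ (e ()) s.scan = (((R s.scan).image fun a => (x, a) : Finset (Q × Act ι Γ)) :
      Set (Q × Act ι Γ)) := by
    rw [hf.1]
    ext a
    simp only [act, Set.mem_image, Set.mem_ofPred_eq, Finset.coe_image, Finset.mem_coe]
    constructor
    · rintro ⟨b, ⟨hb, hb'⟩, rfl⟩
      exact ⟨b.2, hb', by simp [hb]⟩
    · rintro ⟨b, hb, rfl⟩
      exact ⟨(none, b), ⟨rfl, hb⟩, rfl⟩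
  have hsum : (((R s.scan).val.map s.after).map m).sum =
      ∑ a ∈ (R s.scan).image (fun a => (x, a)), m (s.after a.2) := by
    rw [Finset.sum_image (by simp), Multiset.map_map]
    rfl
  rw [hsum]
  by_cases hR : (R s.scan).Nonempty
  · refine .step _ _ _ _ (fun a => m (s.after a.2)) hδ (hR.image _) fun a ha => ?_
    obtain ⟨b, hb, rfl⟩ := Finset.mem_image.1 ha
    exact hm _ (Multiset.mem_map_of_mem _ hb)
  -- Without any action the machine halts inside the fragment, whose states are not accepting: it
  -- contributes zero, like the empty sum of outcomes.
  · rw [Finset.not_nonempty_iff_eq_empty] at hR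
    have := Counts.halt (acc := acc) (e ()) s (T + 1) (hδ.trans (by simp [hR]))
    simpa [hR, hf.2 ()] using this

/-- The states of `f` form a copy of `f` whose exit is the entry of `g`. As `Frag.Runs` speaks about
every machine that contains the fragment, the specification of `f` can be applied with the counts of
`g` at its exit. -/
theorem Runs.seq {X : Type*} {f g : Frag ι Γ} {s : Store ι Γ} {t t' : ℕ} {μ : Multiset X}
    {st : X → Store ι Γ} {ν : X → Multiset (Store ι Γ)} (hf : f.Runs s t (μ.map st))
    (hg : ∀ y ∈ μ, g.Runs (st y) t' (ν y)) : (f.seq g).Runs s (t + t') (μ.bind ν) := by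
  intro Q δ acc e x hin T m hm
  have h1 : f.In δ acc (fun y => e (Sum.inl y)) (e (Sum.inr g.entry)) := by
    refine ⟨fun y s => ?_, fun y => hin.2 _⟩
    rw [hin.1]
    simp only [Frag.seq, Set.image_image]
    congr! 2 with a
    rcases a.1 <;> rfl
  have h2 : g.In δ acc (fun y => e (Sum.inr y)) x := by
    refine ⟨fun y s => ?_, fun y => hin.2 _⟩
    rw [hin.1]
    simp only [Frag.seq, Set.image_image]
    congr! 2 with a
    rcases a.1 <;> rfl
  have := hf.counts h1 (T := T + t') (m := fun y => ((ν y).map m).sum) fun y hy =>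
    hg y hy Q δ acc _ _ h2 T m fun s' hs' => hm s' (Multiset.mem_bind.2 ⟨y, hy, hs'⟩)
  rw [Multiset.map_bind, Multiset.sum_bind]
  refine Counts.mono this (by omega)

theorem counts_single {δ : Trans Q ι Γ} {acc : Set Q} {q q' : Q} {s : Store ι Γ} {T m : ℕ}
    (hδ : δ q s.scan = {(q', s.scan, fun _ => .stay)}) (h : Counts δ acc q' s T m) :
    Counts δ acc q s (T + 1) m := by
  have hs : s.after (s.scan, fun _ => .stay) = s := by
    ext1
    · simp [Store.after, Move.shift]
    · funext i
      simp [Store.after, Store.scan]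
  have := Counts.step (δ := δ) (acc := acc) q s T {(q', s.scan, fun _ => .stay)} (fun _ => m)
    (by rw [hδ]; simp) (by simp) (by
      simp only [Finset.mem_singleton, forall_eq]
      rwa [hs])
  simpa using this

theorem Runs.ite_pos {P : (ι → Γ) → Prop} {f g : Frag ι Γ} {s : Store ι Γ} {t : ℕ}
    {μ : Multiset (Store ι Γ)} (hP : P s.scan) (hf : f.Runs s t μ) :
    (ite P f g).Runs s (t + 1) μ := by
  intro Q δ acc e x hin T m hm
  have h1 : f.In δ acc (fun y => e (some (Sum.inl y))) x := by
    refine ⟨fun y s => ?_, fun y => hin.2 _⟩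
    rw [hin.1]
    simp only [Frag.ite, Set.image_image]
    congr! 2 with a
    rcases a.1 <;> rfl
  refine counts_single ?_ (hf Q δ acc _ _ h1 T m hm)
  rw [hin.1]
  simp [Frag.ite, hP]

theorem Runs.ite_neg {P : (ι → Γ) → Prop} {f g : Frag ι Γ} {s : Store ι Γ} {t : ℕ}
    {μ : Multiset (Store ι Γ)} (hP : ¬ P s.scan) (hg : g.Runs s t μ) :
    (ite P f g).Runs s (t + 1) μ := by
  intro Q δ acc e x hin T m hm
  have h1 : g.In δ acc (fun y => e (some (Sum.inr y))) x := by
    refine ⟨fun y s => ?_, fun y => hin.2 _⟩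
    rw [hin.1]
    simp only [Frag.ite, Set.image_image]
    congr! 2 with a
    rcases a.1 <;> rfl
  refine counts_single ?_ (hg Q δ acc _ _ h1 T m hm)
  rw [hin.1]
  simp [Frag.ite, hP]

theorem runs_rpt_neg {P : (ι → Γ) → Prop} {f : Frag ι Γ} {s : Store ι Γ} (hP : ¬ P s.scan) :
    (Frag.rpt P f).Runs s 1 {s} := by
  intro Q δ acc e x hin T m hm
  have := hm s (by simp)
  simp only [Multiset.map_singleton, Multiset.sum_singleton]
  refine counts_single ?_ this
  rw [hin.1]
  simp [Frag.rpt, hP]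

/-- One round of the loop: the body is a copy of `f` whose exit is the test state of the same loop,
so the remaining rounds are again a run of the whole fragment. -/
theorem Runs.rpt_pos {P : (ι → Γ) → Prop} {f : Frag ι Γ} {X : Type*} {s : Store ι Γ} {t t' : ℕ}
    {μ : Multiset X} {st : X → Store ι Γ} {ν : X → Multiset (Store ι Γ)}
    (hP : P s.scan) (hf : f.Runs s t (μ.map st))
    (hg : ∀ y ∈ μ, (Frag.rpt P f).Runs (st y) t' (ν y)) :
    (Frag.rpt P f).Runs s (t + t' + 1) (μ.bind ν) := by
  intro Q δ acc e x hin T m hm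
  have h1 : f.In δ acc (fun y => e (some y)) (e none) := by
    refine ⟨fun y s => ?_, fun y => hin.2 _⟩
    rw [hin.1]
    simp only [Frag.rpt, Set.image_image]
    congr! 2 with a
    rcases a.1 <;> rfl
  have := hf.counts h1 (T := T + t') (m := fun y => ((ν y).map m).sum) fun y hy =>
    hg y hy Q δ acc _ _ hin T m fun s' hs' => hm s' (Multiset.mem_bind.2 ⟨y, hy, hs'⟩)
  rw [Multiset.map_bind, Multiset.sum_bind]
  refine (counts_single (T := T + t' + t) ?_ this).mono (by omega)
  rw [hin.1]
  simp [Frag.rpt, hP]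

/-- Deterministic variants. -/
theorem Runs.seq_single {f g : Frag ι Γ} {s s' : Store ι Γ} {t t' : ℕ}
    {ν : Multiset (Store ι Γ)} (hf : f.Runs s t {s'}) (hg : g.Runs s' t' ν) :
    (f.seq g).Runs s (t + t') ν := by
  have := Runs.seq (μ := {s'}) (st := id) (ν := fun _ => ν) (g := g) (t' := t') (by simpa using hf)
    (by simpa using hg)
  simpa using this

theorem Runs.rpt_single {P : (ι → Γ) → Prop} {f : Frag ι Γ} {s s' : Store ι Γ} {t t' : ℕ}
    {ν : Multiset (Store ι Γ)}
    (hP : P s.scan) (hf : f.Runs s t {s'}) (hg : (Frag.rpt P f).Runs s' t' ν) :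
    (Frag.rpt P f).Runs s (t + t' + 1) ν := by
  have := Runs.rpt_pos (μ := {s'}) (st := id) (ν := fun _ => ν) (t' := t') hP (by simpa using hf)
    (by simpa using hg)
  simpa using this

end Frag

end

section

variable {ι : Type}

/-! ### Rulers and loops -/

/-- The tape on which exactly the cells satisfying `S` are marked. -/
noncomputable def marks (S : ℤ → Prop) : ℤ → Option Bool := fun z => if S z then some true else none

/-- The tape with marks in the cells `0, …, n - 1`. -/
noncomputable def ruler (n : ℕ) : ℤ → Option Bool := marks fun z => 0 ≤ z ∧ z < n

theorem marks_eq_some {S : ℤ → Prop} {z : ℤ} : marks S z = some true ↔ S z := by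
  simp [marks]

theorem ruler_eq_some {n : ℕ} {z : ℤ} : ruler n z = some true ↔ 0 ≤ z ∧ z < n :=
  marks_eq_some

/-- Displace all heads. -/
def Store.shift {Γ : Type} (s : Store ι Γ) (v : ι → ℤ) : Store ι Γ := ⟨fun i => s.head i + v i, s.tape⟩

/-- Put the head of tape `ρ` on cell `z`. -/
noncomputable def Store.setHead {Γ : Type} (s : Store ι Γ) (ρ : ι) (z : ℤ) : Store ι Γ :=
  ⟨Function.update s.head ρ z, s.tape⟩

/-- Put the heads of the tapes in `l` on the cells given by `z`. -/
noncomputable def Store.setHeads {Γ : Type} (s : Store ι Γ) (l : List ι) (z : ι → ℤ) : Store ι Γ :=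
  ⟨fun i => if i ∈ l then z i else s.head i, s.tape⟩

/-- Move the head of `ρ` only. -/
noncomputable def onlyMove (ρ : ι) (d : Move) : ι → Move := fun i => if i = ρ then d else .stay

/-- Iteration of a branching transformation. -/
def iterK {X : Type*} (κ : X → Multiset X) : ℕ → X → Multiset X
  | 0, x => {x}
  | n + 1, x => (κ x).bind (iterK κ n)

theorem iterK_add {X : Type*} (κ : X → Multiset X) (m n : ℕ) (x : X) :
    iterK κ (m + n) x = (iterK κ m x).bind (iterK κ n) := by
  induction m generalizing x with
  | zero => simp [iterK]
  | succ m ih =>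
    rw [Nat.succ_add_eq_add_succ, Nat.add_succ, iterK, iterK, Multiset.bind_assoc]
    exact Multiset.bind_congr fun y _ => ih y

/-- This turns `k` nested loops of length `n` into a single iteration of length `n ^ k`. -/
theorem iterK_iterK {X : Type*} (κ : X → Multiset X) (m n : ℕ) (x : X) :
    iterK (iterK κ m) n x = iterK κ (m * n) x := by
  induction n generalizing x with
  | zero => simp [iterK]
  | succ n ih =>
    rw [show m * (n + 1) = m + m * n by ring, iterK_add κ m]
    change (iterK κ m x).bind _ = _
    exact Multiset.bind_congr fun y _ => ih y

theorem iterK_single_one {X : Type*} (κ : X → Multiset X) (x : X) : iterK κ 1 x = κ x := by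
  have h := Multiset.bind_singleton (κ x) fun y => y
  simpa [iterK] using h

theorem iterK_single {X : Type*} (g : X → X) (n : ℕ) (x : X) :
    iterK (fun y => {g y}) n x = {g^[n] x} := by
  induction n generalizing x with
  | zero => simp [iterK]
  | succ n ih => simp [iterK, ih]

namespace Frag

/-- Move the heads. -/
@[reducible] noncomputable def mv {Γ : Type} (m : ι → Move) : Frag ι Γ := act fun s => {(s, m)}

theorem runs_mv {Γ : Type} (m : ι → Move) (s : Store ι Γ) :
    (mv m).Runs s 1 {s.shift fun i => (m i).shift} := by
  have := runs_act (fun s : ι → Γ => ({(s, m)} : Finset (Act ι Γ))) s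
  have h : s.after (s.scan, m) = s.shift fun i => (m i).shift := by
    ext1
    · rfl
    · funext i
      simp [Store.after, Store.scan, Store.shift]
  simpa [h] using this

theorem runs_rpt_mv {Γ : Type} (P : (ι → Γ) → Prop) (m : ι → Move) (N : ℕ) (s : Store ι Γ)
    (h1 : ∀ i < N, P (s.shift fun j => i * (m j).shift).scan)
    (h2 : ¬ P (s.shift fun j => N * (m j).shift).scan) :
    (rpt P (mv m)).Runs s (2 * N + 1) {s.shift fun j => N * (m j).shift} := by
  induction N generalizing s with
  | zero =>
    have h : (s.shift fun j => ((0 : ℕ) : ℤ) * (m j).shift) = s := by simp [Store.shift]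
    rw [h] at h2 ⊢
    exact runs_rpt_neg h2
  | succ N ih =>
    have h : ∀ i : ℕ, (s.shift fun j => ((i + 1 : ℕ) : ℤ) * (m j).shift) =
        (s.shift fun j => (m j).shift).shift fun j => i * (m j).shift := by
      intro i
      ext1
      · funext j
        simp only [Store.shift]
        push_cast
        ring
      · rfl
    rw [h] at h2 ⊢
    have h0 := h1 0 (Nat.succ_pos _)
    simp only [Store.shift, Nat.cast_zero, zero_mul, add_zero] at h0
    refine ((runs_mv m s).rpt_single h0 (ih _ ?_ h2)).mono (by omega)
    intro i hi
    rw [← h]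
    exact h1 _ (by omega)

/-- Execute `f` for each mark of the ruler `ρ`, whose head has to be on cell `0`. -/
@[reducible] noncomputable def loop (ρ : ι) (f : Frag ι (Option Bool)) : Frag ι (Option Bool) :=
  (rpt (fun s => s ρ = some true) (f.seq (mv (onlyMove ρ .right)))).seq
    ((mv (onlyMove ρ .left)).seq
      ((rpt (fun s => s ρ = some true) (mv (onlyMove ρ .left))).seq (mv (onlyMove ρ .right))))

theorem shift_onlyMove_setHead {Γ : Type} (s : Store ι Γ) (ρ : ι) (z c : ℤ) (d : Move) :
    ((s.setHead ρ z).shift fun i => c * (onlyMove ρ d i).shift) = s.setHead ρ (z + c * d.shift) := by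
  ext1
  · funext i
    by_cases h : i = ρ
    · subst h; simp [Store.shift, Store.setHead, onlyMove]
    · simp [Store.shift, Store.setHead, onlyMove, h, Move.shift]
  · rfl

theorem shift_onlyMove_setHead' {Γ : Type} (s : Store ι Γ) (ρ : ι) (z : ℤ) (d : Move) :
    ((s.setHead ρ z).shift fun i => (onlyMove ρ d i).shift) = s.setHead ρ (z + d.shift) := by
  simpa using shift_onlyMove_setHead s ρ z 1 d

theorem scan_setHead {Γ : Type} (s : Store ι Γ) (ρ : ι) (z : ℤ) :
    (s.setHead ρ z).scan ρ = s.tape ρ z := by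
  simp [Store.scan, Store.setHead]

/-- The head of the ruler is itself the counter, so the body has to act in the same way wherever
this head stands; hence `setHead` in `hf`. Afterwards the head steps from `n` to `n - 1`, runs left
until the blank cell `-1`, and one step to the right brings it back to `0`. -/
theorem runs_loop {X : Type*} (n : ℕ) (ρ : ι) (st : X → Store ι (Option Bool))
    (κ : X → Multiset X) (t : ℕ) (f : Frag ι (Option Bool))
    (hr : ∀ x, (st x).head ρ = 0 ∧ (st x).tape ρ = ruler n)
    (hf : ∀ x (z : ℤ), f.Runs ((st x).setHead ρ z) t ((κ x).map fun y => (st y).setHead ρ z))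
    (x : X) :
    (loop ρ f).Runs (st x) ((n + 1) * (t + 7)) ((iterK κ n x).map st) := by
  -- Induction on the number `i` of rounds still to be made; the ruler head is then on cell `n - i`.
  have h1 : ∀ i ≤ n, ∀ x, (rpt (fun s => s ρ = some true) (f.seq (mv (onlyMove ρ .right)))).Runs
      ((st x).setHead ρ (n - i)) (i * (t + 2) + 1)
      ((iterK κ i x).map fun y => (st y).setHead ρ n) := by
    intro i
    induction i with
    | zero =>
      intro _ x
      simp only [Nat.cast_zero, sub_zero, zero_mul, zero_add, iterK, Multiset.map_singleton]
      refine runs_rpt_neg ?_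
      rw [scan_setHead, (hr x).2]
      simp [ruler, marks]
    | succ i ih =>
      intro hi x
      rw [iterK, Multiset.map_bind]
      have h2 := (hf x (n - (i + 1 : ℕ))).seq (g := mv (onlyMove ρ .right)) (t' := 1)
        (ν := fun y => {(st y).setHead ρ (n - i)}) (fun y _ => by
          have := runs_mv (onlyMove ρ .right) ((st y).setHead ρ (n - (i + 1 : ℕ)))
          rw [shift_onlyMove_setHead'] at this
          convert this using 3
          simp only [Move.shift]
          push_cast
          ring)
      rw [Multiset.bind_singleton] at h2
      refine (Runs.rpt_pos ?_ h2 fun y _ => ih (by omega) y).mono ?_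
      · rw [scan_setHead, (hr x).2]
        rw [ruler_eq_some]
        omega
      · ring_nf; omega
  have h2 : ∀ y, ((mv (onlyMove ρ .left)).seq
      ((rpt (fun s => s ρ = some true) (mv (onlyMove ρ .left))).seq
        (mv (onlyMove ρ .right)))).Runs ((st y).setHead ρ n) (2 * n + 3) {st y} := by
    intro y
    have e1 := runs_mv (onlyMove ρ .left) ((st y).setHead ρ n)
    rw [shift_onlyMove_setHead'] at e1
    have e2 := runs_rpt_mv (fun s => s ρ = some true) (onlyMove ρ .left) n
      ((st y).setHead ρ (n + Move.left.shift)) (by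
        intro i hi
        rw [shift_onlyMove_setHead, scan_setHead, (hr y).2]
        simp only [ruler_eq_some, Move.shift]
        omega) (by
        rw [shift_onlyMove_setHead, scan_setHead, (hr y).2]
        simp [ruler, marks, Move.shift])
    rw [shift_onlyMove_setHead] at e2
    have e3 := runs_mv (onlyMove ρ .right)
      ((st y).setHead ρ (n + Move.left.shift + n * Move.left.shift))
    rw [shift_onlyMove_setHead'] at e3
    have e4 : (st y).setHead ρ (n + Move.left.shift + n * Move.left.shift + Move.right.shift) =
        st y := by
      ext1
      · simp only [Store.setHead, Move.shift]
        rw [Function.update_eq_self_iff, (hr y).1]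
        ring
      · rfl
    rw [e4] at e3
    exact (e1.seq_single (e2.seq_single e3)).mono (by omega)
  have h3 := h1 n le_rfl x
  have e5 : (st x).setHead ρ ((n : ℤ) - n) = st x := by
    ext1
    · simp [Store.setHead, (hr x).1]
    · rfl
  rw [e5] at h3
  have h4 := h3.seq fun y _ => h2 y
  rw [Multiset.bind_singleton] at h4
  exact h4.mono (by ring_nf; omega)

/-- Nested loops: execute `f` for each tuple of marks of the rulers in `l`. -/
@[reducible] noncomputable def rep : List ι → Frag ι (Option Bool) → Frag ι (Option Bool)
  | [], f => f
  | ρ :: l, f => loop ρ (rep l f)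

/-- A bound for the running time of `rep`. -/
def repTime (n t : ℕ) : ℕ → ℕ
  | 0 => t
  | k + 1 => (n + 1) * (repTime n t k + 7)

/-- The rulers must be distinct, because an inner loop starts with its own head on cell `0` while
the heads of the outer loops are in mid-run. The body is therefore specified for arbitrary positions
`z` of all ruler heads. -/
theorem runs_rep {X : Type*} (n : ℕ) (l : List ι) (hl : l.Nodup) (st : X → Store ι (Option Bool))
    (κ : X → Multiset X) (t : ℕ) (f : Frag ι (Option Bool))
    (hr : ∀ x, ∀ ρ ∈ l, (st x).head ρ = 0 ∧ (st x).tape ρ = ruler n)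
    (hf : ∀ x (z : ι → ℤ), f.Runs ((st x).setHeads l z) t
      ((κ x).map fun y => (st y).setHeads l z)) (x : X) :
    (rep l f).Runs (st x) (repTime n t l.length) ((iterK κ (n ^ l.length) x).map st) := by
  induction l generalizing st x with
  | nil =>
    have h : ∀ y, (st y).setHeads [] 0 = st y := fun y => by simp [Store.setHeads]
    have := hf x 0
    simp only [h] at this
    simpa [iterK_single_one, rep, repTime] using this
  | cons ρ l ih =>
    rw [List.nodup_cons] at hl
    rw [List.length_cons, pow_succ, ← iterK_iterK]
    refine runs_loop n ρ st _ _ _ (fun x => hr x ρ (by simp)) (fun y z0 => ?_) x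
    refine ih hl.2 (fun y => (st y).setHead ρ z0) ?_ ?_ y
    · intro y ρ' hρ'
      have hne : ρ' ≠ ρ := by rintro rfl; exact hl.1 hρ'
      have := hr y ρ' (by simp [hρ'])
      simpa [Store.setHead, hne] using this
    · intro y z
      have h : ∀ y, ((st y).setHead ρ z0).setHeads l z =
          (st y).setHeads (ρ :: l) (Function.update z ρ z0) := by
        intro y
        ext1
        · funext i
          simp only [Store.setHeads, Store.setHead, List.mem_cons, Function.update_apply]
          by_cases hi : i = ρ
          · subst hi; simp [hl.1]
          · simp [hi]
        · rfl
      simp only [h]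
      exact hf y _

theorem runs_rep_mv (n : ℕ) (l : List ι) (hl : l.Nodup) (s : Store ι (Option Bool))
    (m : ι → Move) (hm : ∀ ρ ∈ l, m ρ = .stay)
    (hr : ∀ ρ ∈ l, s.head ρ = 0 ∧ s.tape ρ = ruler n) :
    (rep l (mv m)).Runs s (repTime n 1 l.length)
      {s.shift fun i => (n : ℤ) ^ l.length * (m i).shift} := by
  have h := runs_rep n l hl (fun k : ℕ => s.shift fun i => k * (m i).shift)
    (fun k => {k + 1}) 1 (mv m) (by
      intro k ρ hρ
      simpa [Store.shift, hm ρ hρ, Move.shift] using hr ρ hρ) (by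
      intro k z
      have := runs_mv m ((s.shift fun i => k * (m i).shift).setHeads l z)
      rw [Multiset.map_singleton]
      convert this using 2
      ext1
      · funext i
        simp only [Store.shift, Store.setHeads]
        by_cases hi : i ∈ l
        · simp [hi, hm i hi, Move.shift]
        · simp only [hi, if_false]
          push_cast
          ring
      · rfl) 0
  rw [iterK_single] at h
  have h0 : (s.shift fun i => ((0 : ℕ) : ℤ) * (m i).shift) = s := by simp [Store.shift]
  rw [h0] at h
  simpa using h

end Frag

/-! ### Polynomially bounded functions -/

/-- `g` is bounded by a monotone polynomial. -/
def PolyBdd (g : ℕ → ℕ) : Prop := ∃ p : Polynomial ℕ, ∀ n, g n ≤ p.eval n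

theorem polynomial_eval_mono (p : Polynomial ℕ) : Monotone fun n => p.eval n := by
  intro m n hmn
  simp only [Polynomial.eval_eq_sum]
  exact Finset.sum_le_sum fun i _ => Nat.mul_le_mul_left _ (Nat.pow_le_pow_left hmn i)

namespace PolyBdd

theorem const (c : ℕ) : PolyBdd fun _ => c := ⟨Polynomial.C c, by simp⟩

theorem id : PolyBdd fun n => n := ⟨Polynomial.X, by simp⟩

theorem add {g h : ℕ → ℕ} (hg : PolyBdd g) (hh : PolyBdd h) : PolyBdd fun n => g n + h n := by
  obtain ⟨p, hp⟩ := hg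
  obtain ⟨q, hq⟩ := hh
  exact ⟨p + q, fun n => by simpa using Nat.add_le_add (hp n) (hq n)⟩

theorem mul {g h : ℕ → ℕ} (hg : PolyBdd g) (hh : PolyBdd h) : PolyBdd fun n => g n * h n := by
  obtain ⟨p, hp⟩ := hg
  obtain ⟨q, hq⟩ := hh
  exact ⟨p * q, fun n => by simpa using Nat.mul_le_mul (hp n) (hq n)⟩

theorem repTime {g : ℕ → ℕ} (hg : PolyBdd g) (k : ℕ) :
    PolyBdd fun n => Frag.repTime n (g n) k := by
  induction k with
  | zero => exact hg
  | succ k ih => exact (id.add (const 1)).mul (ih.add (const 7))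

end PolyBdd

end

/-! ### Relational languages with built-in order -/

/-- Relation symbols: the order and symbols indexed by `J` with arities `r`. -/
inductive JRel {J : Type} (r : J → ℕ) : ℕ → Type
  | le : JRel r 2
  | var (j : J) : JRel r (r j)

/-- The relational language with built-in order and symbols indexed by `J`. -/
abbrev JLang {J : Type} (r : J → ℕ) : Language := ⟨fun _ => Empty, JRel r⟩

/-- Relations on `{0, …, n - 1}` interpreting the symbols. -/
abbrev Tables {J : Type} (r : J → ℕ) (n : ℕ) := ∀ j, Set (Fin (r j) → Fin n)

/-- The interpretation of `JLang r` given by tables. -/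
@[reducible] def jInterp {J : Type} {r : J → ℕ} {n : ℕ} (G : Tables r n) :
    (JLang r).Structure (Fin n) where
  funMap := fun {_} s => s.elim
  RelMap := fun {_} s => match s with
    | JRel.le => fun v => v 0 ≤ v 1
    | JRel.var j => fun v => v ∈ G j

/-- Satisfaction of a formula in the structure given by tables. -/
def JRealize {J : Type} {r : J → ℕ} {n : ℕ} (G : Tables r n) {α : Type} {m : ℕ}
    (φ : (JLang r).BoundedFormula α m) (v : α → Fin n) (xs : Fin m → Fin n) : Prop :=
  @Language.BoundedFormula.Realize (JLang r) (Fin n) (jInterp G) α m φ v xs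

/-- The largest number of variables in scope in a subformula. -/
def depth {L : Language} {α : Type} : ∀ {m : ℕ}, L.BoundedFormula α m → ℕ
  | m, .falsum => m
  | m, .equal _ _ => m
  | m, .rel _ _ => m
  | _, .imp f g => max (depth f) (depth g)
  | _, .all f => depth f

theorem le_depth {L : Language} {α : Type} {m : ℕ} (φ : L.BoundedFormula α m) : m ≤ depth φ := by
  induction φ with
  | falsum => exact le_rfl
  | equal _ _ => exact le_rfl
  | rel _ _ => exact le_rfl
  | imp f g hf _ => exact le_trans hf (le_max_left _ _)
  | all f hf => exact le_trans (Nat.le_succ _) hf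

/-! ### Evaluating formulas -/

/-- The opposite movement. -/
def Move.neg : Move → Move
  | .left => .right
  | .stay => .stay
  | .right => .left

theorem Move.shift_neg (m : Move) : m.neg.shift = -m.shift := by
  cases m <;> rfl

namespace Frag

/-- Move tape `i` by `∑ e < k, n ^ e * (M e i)`. -/
@[reducible] noncomputable def strides {ι : Type} (rl : ℕ → List ι) (M : ℕ → ι → Move) :
    ℕ → Frag ι (Option Bool)
  | 0 => mv fun _ => .stay
  | k + 1 => (strides rl M k).seq (rep (rl k) (mv (M k)))

/-- A bound for the running time of `strides`. -/
def stridesTime (n : ℕ) : ℕ → ℕ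
  | 0 => 1
  | k + 1 => stridesTime n k + repTime n 1 k

/-- A unit movement inside `e` nested loops is executed `n ^ e` times, so stage `e` displaces the
heads by `n ^ e` times the movement `M e`. The rulers used for the loops must not take part in any
movement. -/
theorem runs_strides {ι : Type} (rl : ℕ → List ι) (M : ℕ → ι → Move) (n k : ℕ)
    (s : Store ι (Option Bool))
    (h1 : ∀ e < k, (rl e).length = e ∧ (rl e).Nodup)
    (h2 : ∀ e < k, ∀ ρ ∈ rl e, ∀ e', M e' ρ = .stay)
    (h3 : ∀ e < k, ∀ ρ ∈ rl e, s.head ρ = 0 ∧ s.tape ρ = ruler n) :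
    (strides rl M k).Runs s (stridesTime n k)
      {s.shift fun i => ∑ e ∈ Finset.range k, (n : ℤ) ^ e * (M e i).shift} := by
  induction k with
  | zero =>
    have h := runs_mv (fun _ => Move.stay) s
    simp only [Move.shift] at h
    simp only [Finset.range_zero, Finset.sum_empty]
    exact h
  | succ k ih =>
    have ih := ih (fun e he => h1 e (by omega)) (fun e he => h2 e (by omega))
      (fun e he => h3 e (by omega))
    refine ih.seq_single ?_
    have h := runs_rep_mv n (rl k) (h1 k (by omega)).2
      (s.shift fun i => ∑ e ∈ Finset.range k, (n : ℤ) ^ e * (M e i).shift) (M k)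
      (fun ρ hρ => h2 k (by omega) ρ hρ k) (by
        intro ρ hρ
        have := h2 k (by omega) ρ hρ
        simpa [Store.shift, this, Move.shift] using h3 k (by omega) ρ hρ)
    rw [(h1 k (by omega)).1] at h
    convert h using 2
    ext1
    · funext i
      simp only [Store.shift, Finset.sum_range_succ]
      ring
    · rfl

end Frag

theorem PolyBdd.stridesTime (k : ℕ) : PolyBdd fun n => Frag.stridesTime n k := by
  induction k with
  | zero => exact const 1
  | succ k ih => exact ih.add ((const 1).repTime k)

/-- The tapes of the machine counting the models of a formula: the input, a flag, rulers, a ruler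
for each variable, a copy of each table for each tuple of variables, and tapes for comparing
variables. -/
inductive Tape {J : Type} (r : J → ℕ) (d N : ℕ)
  | inp
  | flag
  | rul (e : Fin d)
  | var (m : Fin N)
  | tab (j : J) (v : Fin (r j) → Fin N)
  | le (a b : Fin N)

section Tape

variable {J : Type} {r : J → ℕ} {d N : ℕ}

instance [Finite J] : Finite (Tape r d N) := by
  let g : Tape r d N → Bool ⊕ Fin d ⊕ Fin N ⊕ (Σ j, Fin (r j) → Fin N) ⊕ (Fin N × Fin N) :=
    fun t => match t with
    | .inp => .inl true
    | .flag => .inl false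
    | .rul e => .inr (.inl e)
    | .var m => .inr (.inr (.inl m))
    | .tab j v => .inr (.inr (.inr (.inl ⟨j, v⟩)))
    | .le a b => .inr (.inr (.inr (.inr (a, b))))
  refine Finite.of_injective g ?_
  intro a b h
  cases a <;> cases b <;> simp_all [g]

/-- The `e`-th coefficient of variable `m` in the position of the head of a tape, as a movement. -/
noncomputable def coef : Tape r d N → Fin N → ℕ → Move
  | .inp, _, _ => .stay
  | .flag, _, _ => .stay
  | .rul _, _, _ => .stay
  | .var m', m, e => if e = 0 ∧ m' = m then .right else .stay
  | .tab j v, m, e => if ∃ h : e < r j, v (Fin.rev ⟨e, h⟩) = m then .right else .stay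
  | .le a b, m, e =>
    if e = 0 then
      if a = m then (if b = m then .stay else .right) else (if b = m then .left else .stay)
    else .stay

/-- The position of the head of a tape for given values of the variables. -/
noncomputable def headPos (n : ℕ) (x : Fin N → ℤ) (i : Tape r d N) : ℤ :=
  ∑ m, x m * ∑ e ∈ Finset.range d, (n : ℤ) ^ e * (coef i m e).shift

/-- Head positions are linear in the values of the variables. So a change of one variable displaces
each head by an amount that does not depend on the other variables, and `strides` can perform it
without looking at them. -/
theorem headPos_update (n : ℕ) (x : Fin N → ℤ) (m : Fin N) (c : ℤ) (i : Tape r d N) :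
    headPos n (Function.update x m c) i =
      headPos n x i + (c - x m) * ∑ e ∈ Finset.range d, (n : ℤ) ^ e * (coef i m e).shift := by
  simp only [headPos]
  rw [Finset.sum_eq_sum_sdiff_singleton_add (Finset.mem_univ m),
    Finset.sum_eq_sum_sdiff_singleton_add (Finset.mem_univ m) (fun m => x m * _ : Fin N → ℤ)]
  have : ∀ m' ∈ Finset.univ \ {m}, Function.update x m c m' = x m' := by
    intro m' hm'
    exact Function.update_of_ne (by simpa using hm') _ _
  have h2 := Finset.sum_congr rfl (g := fun m' => x m' *
    ∑ e ∈ Finset.range d, (n : ℤ) ^ e * (coef i m' e).shift) fun m' hm' =>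
      congrArg (· * _) (this m' hm')
  rw [h2, Function.update_self]
  ring

theorem headPos_var (n : ℕ) (hd : 0 < d) (x : Fin N → ℤ) (m : Fin N) :
    headPos n x (.var m : Tape r d N) = x m := by
  rw [headPos, Finset.sum_eq_single m]
  · rw [Finset.sum_eq_single 0]
    · simp [coef, Move.shift]
    · intro e _ he
      simp [coef, he, Move.shift]
    · simp [hd.ne']
  · intro m' _ hm'
    rw [Finset.sum_eq_zero, mul_zero]
    intro e _
    simp [coef, hm'.symm, Move.shift]
  · simp

/-- For `a = b` the two contributions cancel, which explains the nested cases in `coef`. Comparing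
two variables amounts to looking at the sign of this position. -/
theorem headPos_le (n : ℕ) (hd : 0 < d) (x : Fin N → ℤ) (a b : Fin N) :
    headPos n x (.le a b : Tape r d N) = x a - x b := by
  have h : ∀ m, ∑ e ∈ Finset.range d, (n : ℤ) ^ e * (coef (.le a b : Tape r d N) m e).shift =
      (if a = m then 1 else 0) - (if b = m then 1 else 0) := by
    intro m
    rw [Finset.sum_eq_single 0]
    · simp only [coef, pow_zero, one_mul, if_true]
      split_ifs <;> simp [Move.shift]
    · intro e _ he
      simp [coef, he, Move.shift]
    · simp [hd.ne']
  simp only [headPos, h, mul_sub, Finset.sum_sub_distrib]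
  simp

/-- In truth tables the last coordinate varies fastest and has weight `n ^ 0`; hence the reversal. A
variable that occurs several times in `v` contributes one power of `n` for each occurrence. The
bound `r j ≤ d` is needed because `headPos` sums over exponents below `d`. -/
theorem headPos_tab (n : ℕ) (hr : ∀ j, r j ≤ d) (x : Fin N → ℤ) (j : J) (v : Fin (r j) → Fin N) :
    headPos n x (.tab j v : Tape r d N) = ∑ e : Fin (r j), x (v (Fin.rev e)) * (n : ℤ) ^ (e : ℕ) := by
  have h1 : ∀ m, ∑ e ∈ Finset.range d, (n : ℤ) ^ e * (coef (.tab j v : Tape r d N) m e).shift =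
      ∑ e : Fin (r j), if v (Fin.rev e) = m then (n : ℤ) ^ (e : ℕ) else 0 := by
    intro m
    rw [← Finset.sum_subset (Finset.range_subset_range.2 (hr j)), Finset.sum_range]
    · refine Finset.sum_congr rfl fun e _ => ?_
      by_cases h : v (Fin.rev e) = m <;> simp [coef, h, Move.shift]
    · intro e _ he
      have : ¬ e < r j := by simpa using he
      simp [coef, this, Move.shift]
  simp only [headPos, h1, Finset.mul_sum]
  rw [Finset.sum_comm]
  refine Finset.sum_congr rfl fun e _ => ?_
  simp

/-- The input tape. -/
def inputTape (w : List Bool) : ℤ → Option Bool := fun z => if 0 ≤ z then w[z.toNat]? else none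

/-- The position of a tuple in a table. -/
def tupleIdx {a n : ℕ} (u : Fin a → Fin n) : ℕ := finFunctionFinEquiv fun i => u (Fin.rev i)

theorem tupleIdx_injective {a n : ℕ} : Function.Injective (tupleIdx (a := a) (n := n)) := by
  intro u v h
  have h := finFunctionFinEquiv.injective (Fin.val_injective h)
  funext i
  simpa using congrFun h (Fin.rev i)

/-- The tape on which the truth table of `S` is marked. -/
noncomputable def tableTape {a n : ℕ} (S : Set (Fin a → Fin n)) : ℤ → Option Bool :=
  marks fun z => ∃ u ∈ S, z = tupleIdx u

/-- The store during the evaluation of a formula, the input head being on cell `p`, the tables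
being given by `G`, and the variables having the values `x`. -/
noncomputable def evalStore (d : ℕ) {N : ℕ} (w : List Bool) (n p : ℕ) (G : Tables r n)
    (x : Fin N → ℤ) (b : Bool) : Store (Tape r d N) (Option Bool) where
  head := fun i => (if i = .inp then (p : ℤ) else 0) + headPos n x i
  tape := fun i => match i with
    | .inp => inputTape w
    | .flag => marks fun z => z = 0 ∧ b
    | .rul _ => ruler n
    | .var _ => ruler n
    | .tab j _ => tableTape (G j)
    | .le _ _ => marks fun z => -(n : ℤ) < z ∧ z ≤ 0

/-- The first `e` rulers. -/
def rulers (r : J → ℕ) (d N e : ℕ) : List (Tape r d N) := ((List.finRange d).take e).map .rul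

theorem rulers_length {e : ℕ} (he : e ≤ d) : (rulers r d N e).length = e := by
  simp [rulers, he]

theorem rulers_nodup (e : ℕ) : (rulers r d N e).Nodup := by
  refine List.Nodup.map ?_ ((List.nodup_finRange d).sublist (List.take_sublist _ _))
  intro a b h
  simpa using h

theorem exists_of_mem_rulers {e : ℕ} {ρ : Tape r d N} (h : ρ ∈ rulers r d N e) :
    ∃ e', ρ = .rul e' := by
  simp only [rulers, List.mem_map] at h
  obtain ⟨a, -, rfl⟩ := h
  exact ⟨a, rfl⟩

theorem headPos_rul (n : ℕ) (x : Fin N → ℤ) (e : Fin d) :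
    headPos n x (.rul e : Tape r d N) = 0 := by
  simp [headPos, coef, Move.shift]

theorem headPos_inp (n : ℕ) (x : Fin N → ℤ) : headPos n x (.inp : Tape r d N) = 0 := by
  simp [headPos, coef, Move.shift]

theorem headPos_flag (n : ℕ) (x : Fin N → ℤ) : headPos n x (.flag : Tape r d N) = 0 := by
  simp [headPos, coef, Move.shift]

namespace Frag

/-- Increase (or decrease) the value of the variable `m` by one. -/
@[reducible] noncomputable def incr (r : J → ℕ) (d : ℕ) {N : ℕ} (m : Fin N) (up : Bool) :
    Frag (Tape r d N) (Option Bool) :=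
  strides (rulers r d N) (fun e i => if up then coef i m e else (coef i m e).neg) d

theorem runs_incr (m : Fin N) (up : Bool) (w : List Bool) (n p : ℕ) (G : Tables r n)
    (x : Fin N → ℤ) (b : Bool) :
    (incr r d m up).Runs (evalStore d w n p G x b) (stridesTime n d)
      {evalStore d w n p G (Function.update x m (x m + if up then 1 else -1)) b} := by
  have h := runs_strides (rulers r d N) (fun e i => if up then coef i m e else (coef i m e).neg)
    n d (evalStore d w n p G x b) (fun e he => ⟨rulers_length he.le, rulers_nodup e⟩) (by
      intro e _ ρ hρ e'
      obtain ⟨e'', rfl⟩ := exists_of_mem_rulers hρ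
      simp [coef, Move.neg]) (by
      intro e _ ρ hρ
      obtain ⟨e'', rfl⟩ := exists_of_mem_rulers hρ
      simp [evalStore, headPos_rul])
  convert h using 2
  ext1
  · funext i
    simp only [evalStore, Store.shift, headPos_update]
    cases up <;> simp [Move.shift_neg, add_assoc]
  · rfl

/-- Write `b` on the flag. -/
@[reducible] noncomputable def setFlag (r : J → ℕ) (d N : ℕ) (b : Bool) :
    Frag (Tape r d N) (Option Bool) :=
  act fun s => {(Function.update s .flag (if b then some true else none), fun _ => .stay)}

theorem runs_setFlag (b : Bool) (w : List Bool) (n p : ℕ) (G : Tables r n)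
    (x : Fin N → ℤ) (b' : Bool) :
    (setFlag r d N b).Runs (evalStore d w n p G x b') 1 {evalStore d w n p G x b} := by
  have h := runs_act (fun s : Tape r d N → Option Bool => ({(Function.update s .flag
    (if b then some true else none), fun _ => .stay)} : Finset (Act _ _)))
    (evalStore d w n p G x b')
  convert h using 1
  rw [Finset.singleton_val, Multiset.map_singleton]
  congr 1
  ext1
  · simp [Store.after, evalStore, Move.shift]
  · funext i
    by_cases hi : i = .flag
    · subst hi
      funext z
      simp only [evalStore, Store.after, headPos_flag, Function.update_apply]
      by_cases hz : z = 0 <;> simp [hz, marks]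
    · simp only [Store.after, Function.update_of_ne hi, Store.scan, Function.update_eq_self]
      cases i <;> simp_all [evalStore]

/-- Write on the flag whether the symbols read satisfy `P`. -/
@[reducible] noncomputable def test (P : (Tape r d N → Option Bool) → Prop) :
    Frag (Tape r d N) (Option Bool) :=
  ite P (setFlag r d N true) (setFlag r d N false)

theorem runs_test (P : (Tape r d N → Option Bool) → Prop) (w : List Bool) (n p : ℕ)
    (G : Tables r n) (x : Fin N → ℤ) (b : Bool) :
    (test P).Runs (evalStore d w n p G x b) 2
      {evalStore d w n p G x (decide (P (evalStore d w n p G x b).scan))} := by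
  by_cases h : P (evalStore d w n p G x b).scan
  · simp only [h, decide_true]
    exact Runs.ite_pos h (runs_setFlag true w n p G x b)
  · simp only [h, decide_false]
    exact Runs.ite_neg h (runs_setFlag false w n p G x b)

end Frag

theorem scan_flag (w : List Bool) (n p : ℕ) (G : Tables r n) (x : Fin N → ℤ) (b : Bool) :
    (evalStore d w n p G x b).scan .flag = some true ↔ b = true := by
  simp [Store.scan, evalStore, headPos_flag, marks_eq_some]

theorem scan_var (hd : 0 < d) (w : List Bool) (n p : ℕ) (G : Tables r n) (x : Fin N → ℤ) (b : Bool)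
    (m : Fin N) : (evalStore d w n p G x b).scan (.var m) = some true ↔ 0 ≤ x m ∧ x m < n := by
  simp [Store.scan, evalStore, headPos_var n hd, ruler_eq_some]

/-- Only the cells from `-n + 1` to `0` are marked, but for values in range the difference is larger
than `-n`, so a mark is seen exactly when the difference is not positive. -/
theorem scan_le (hd : 0 < d) (w : List Bool) (n p : ℕ) (G : Tables r n) (x : Fin N → ℤ) (b : Bool)
    (i j : Fin N) (hi : 0 ≤ x i) (hj : x j < n) :
    (evalStore d w n p G x b).scan (.le i j) = some true ↔ x i ≤ x j := by
  simp only [Store.scan, evalStore, headPos_le n hd, marks_eq_some]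
  simp only [reduceCtorEq, if_false]
  omega

theorem scan_tab (hr : ∀ j, r j ≤ d) (w : List Bool) (n p : ℕ) (G : Tables r n) (x : Fin N → ℤ)
    (b : Bool) (j : J) (v : Fin (r j) → Fin N) (u : Fin (r j) → Fin n)
    (hu : ∀ i, x (v i) = (u i : ℕ)) :
    (evalStore d w n p G x b).scan (.tab j v) = some true ↔ u ∈ G j := by
  have h : headPos n x (.tab j v : Tape r d N) = tupleIdx u := by
    rw [headPos_tab n hr, tupleIdx, finFunctionFinEquiv_apply]
    push_cast
    exact Finset.sum_congr rfl fun e _ => by rw [hu]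
  simp only [Store.scan, evalStore, reduceCtorEq, if_false, zero_add, h, tableTape, marks_eq_some]
  constructor
  · rintro ⟨u', hu', h⟩
    rwa [tupleIdx_injective (Nat.cast_injective h)]
  · intro hu
    exact ⟨u, hu, rfl⟩

/-- Extension of an assignment by zeros. -/
noncomputable def extendZero (N : ℕ) {m n : ℕ} (xs : Fin m → Fin n) : Fin N → ℤ :=
  fun i => if h : (i : ℕ) < m then ((xs ⟨i, h⟩ : ℕ) : ℤ) else 0

theorem extendZero_castLE {m n : ℕ} (h : m ≤ N) (xs : Fin m → Fin n) (i : Fin m) :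
    extendZero N xs (Fin.castLE h i) = (xs i : ℕ) := by
  simp [extendZero]

theorem extendZero_snoc {m n : ℕ} (hm : m < N) (xs : Fin m → Fin n) (a : Fin n) :
    extendZero N (Fin.snoc xs a : Fin (m + 1) → Fin n) =
      Function.update (extendZero N xs) ⟨m, hm⟩ ((a : ℕ) : ℤ) := by
  funext i
  by_cases hi : i = ⟨m, hm⟩
  · subst hi
    simp [extendZero, Fin.snoc]
  · rw [Function.update_of_ne hi]
    have hi' : (i : ℕ) ≠ m := fun h => hi (Fin.ext h)
    by_cases h : (i : ℕ) < m
    · have h' : (i : ℕ) < m + 1 := by omega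
      simp [extendZero, Fin.snoc, h, h']
    · have h' : ¬ (i : ℕ) < m + 1 := by omega
      simp [extendZero, h, h']

/-- Evaluate a universally quantified formula. -/
@[reducible] noncomputable def Frag.all (m : Fin N) (f : Frag (Tape r d N) (Option Bool)) :
    Frag (Tape r d N) (Option Bool) :=
  (Frag.setFlag r d N true).seq
    ((Frag.rpt (fun s => s .flag = some true ∧ s (.var m) = some true)
      (f.seq (Frag.incr r d m true))).seq
      ((Frag.incr r d m false).seq
        ((Frag.rpt (fun s => s (.var m) = some true) (Frag.incr r d m false)).seq
          (Frag.incr r d m true))))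

/-- A bound for the running time of `Frag.all`. -/
def allTime (d n t : ℕ) : ℕ :=
  1 + (n * (t + Frag.stridesTime n d + 1) + 1) + (n * (Frag.stridesTime n d + 1) + 1)
        + 2 * Frag.stridesTime n d

/-- The variable runs upwards until an instance is false or the value `n` is reached, where its
ruler has no mark. The value `k` at that moment depends on the formula, but the way back ends on
cell `-1` in any case, so one last increase restores the value `0` and the store is the old one
except for the flag. -/
theorem runs_all (hd : 0 < d) (m : Fin N) (f : Frag (Tape r d N) (Option Bool)) (t : ℕ)
    (w : List Bool) (n p : ℕ) (G : Tables r n) (x : Fin N → ℤ) (hx : x m = 0) (φ : Fin n → Prop)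
    (hf : ∀ (a : Fin n) b, f.Runs (evalStore d w n p G (Function.update x m ((a : ℕ) : ℤ)) b) t
      {evalStore d w n p G (Function.update x m ((a : ℕ) : ℤ)) (decide (φ a))}) (b : Bool) :
    (Frag.all m f).Runs (evalStore d w n p G x b)
      (allTime d n t)
      {evalStore d w n p G x (decide (∀ a, φ a))} := by
  set τ := Frag.stridesTime n d with hτ
  have inc : ∀ (z : ℤ) (up b : Bool), (Frag.incr r d m up).Runs
      (evalStore d w n p G (Function.update x m z) b) τ
      {evalStore d w n p G (Function.update x m (z + if up then 1 else -1)) b} := by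
    intro z up b
    have := Frag.runs_incr (d := d) m up w n p G (Function.update x m z) b
    simpa using this
  -- Induction on the number `i` of values not yet tried, the current value being `n - i`; the flag
  -- `b` records whether all earlier instances were true.
  have h1 : ∀ i ≤ n, ∀ b : Bool, ∃ k : ℕ, k ≤ n ∧
      (Frag.rpt (fun s => s .flag = some true ∧ s (.var m) = some true)
        (f.seq (Frag.incr r d m true))).Runs
        (evalStore d w n p G (Function.update x m ((n - i : ℕ) : ℤ)) b) (i * (t + τ + 1) + 1)
        {evalStore d w n p G (Function.update x m (k : ℤ))
          (decide (b = true ∧ ∀ a : Fin n, n - i ≤ a → φ a))} := by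
    intro i
    induction i with
    | zero =>
      intro _ b
      refine ⟨n, le_rfl, ?_⟩
      have e : decide (b = true ∧ ∀ a : Fin n, n - 0 ≤ a → φ a) = b := by
        simp
      rw [e]
      refine (Frag.runs_rpt_neg ?_).mono (by omega)
      rw [scan_var hd]
      simp
    | succ i ih =>
      intro hi b
      by_cases hb : b = true
      · obtain ⟨k, hk, hrun⟩ := ih (by omega) (decide (φ ⟨n - (i + 1), by omega⟩))
        refine ⟨k, hk, ?_⟩
        have h2 := (hf ⟨n - (i + 1), by omega⟩ b).seq_single (inc _ true _)
        have e1 : (((⟨n - (i + 1), by omega⟩ : Fin n) : ℕ) : ℤ) + (if (true : Bool) then 1 else -1) =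
            ((n - i : ℕ) : ℤ) := by
          simp only [if_true]
          omega
        rw [e1] at h2
        have h3 := Frag.Runs.rpt_single (P := fun s => s .flag = some true ∧ s (.var m) = some true)
          (by
            rw [scan_flag, scan_var hd]
            refine ⟨hb, ?_⟩
            simp only [Function.update_self]
            omega) h2 hrun
        have h3 := h3.mono (t' := (i + 1) * (t + τ + 1) + 1) (by ring_nf; omega)
        convert h3 using 3
        refine decide_eq_decide.2 ?_
        simp only [decide_eq_true_eq, hb, true_and]
        constructor
        · intro h
          exact ⟨h _ (by simp), fun a ha => h a (by omega)⟩
        · rintro ⟨h, h'⟩ a ha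
          by_cases ha' : (a : ℕ) = n - (i + 1)
          · have ha' : a = ⟨n - (i + 1), by omega⟩ := Fin.ext ha'
            rwa [ha']
          · exact h' a (by omega)
      · refine ⟨n - (i + 1), by omega, ?_⟩
        have hb : b = false := by simpa using hb
        subst hb
        simp only [Bool.false_eq_true, false_and, decide_false]
        refine (Frag.runs_rpt_neg ?_).mono (by omega)
        rw [scan_flag]
        simp
  -- The way back starts at `k - 1`, after one unconditional decrease: for `k = n` the ruler shows
  -- no mark and the loop would stop at once.
  have h4 : ∀ k : ℕ, k ≤ n → ∀ b, (Frag.rpt (fun s => s (.var m) = some true)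
      (Frag.incr r d m false)).Runs
      (evalStore d w n p G (Function.update x m ((k : ℤ) + -1)) b) (k * (τ + 1) + 1)
      {evalStore d w n p G (Function.update x m (-1)) b} := by
    intro k
    induction k with
    | zero =>
      intro _ b
      simp only [Nat.cast_zero, zero_add]
      refine (Frag.runs_rpt_neg ?_).mono (by omega)
      rw [scan_var hd]
      simp
    | succ k ih =>
      intro hk b
      have e : ((k + 1 : ℕ) : ℤ) + -1 + (if (false : Bool) then 1 else -1) = (k : ℤ) + -1 := by
        simp
      have h5 := inc (((k + 1 : ℕ) : ℤ) + -1) false b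
      rw [e] at h5
      refine (Frag.Runs.rpt_single ?_ h5 (ih (by omega) b)).mono (by ring_nf; omega)
      rw [scan_var hd]
      simp only [Function.update_self]
      omega
  have e0 : Function.update x m 0 = x := by rw [← hx]; simp
  obtain ⟨k, hk, hrun⟩ := h1 n le_rfl true
  simp only [Nat.sub_self, Nat.cast_zero, e0, Nat.zero_le, true_and, forall_const] at hrun
  have h5 := inc k false (decide (∀ a, φ a))
  simp only [Bool.false_eq_true, if_false] at h5
  have h6 := inc (-1) true (decide (∀ a, φ a))
  simp only [if_true, neg_add_cancel, e0] at h6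
  refine ((Frag.runs_setFlag true w n p G x b).seq_single (hrun.seq_single (h5.seq_single
    ((h4 k hk _).seq_single h6)))).mono ?_
  have : k * (τ + 1) ≤ n * (τ + 1) := Nat.mul_le_mul_right _ hk
  rw [allTime, ← hτ]
  omega

/-- Induction on the formula, the flag receiving the truth value. An atom is decided by the symbols
under one head, or under two for equality, which is tested as `≤` in both directions. The fragment
returns to the store it started from apart from the flag, and its time bound depends on `n` alone.
-/
theorem exists_runs_eval (hd : 0 < d) (hr : ∀ j, r j ≤ d) {m : ℕ}
    (φ : (JLang r).BoundedFormula (Fin 0) m) (hφ : depth φ ≤ N) :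
    ∃ (f : Frag (Tape r d N) (Option Bool)) (t : ℕ → ℕ), PolyBdd t ∧
      ∀ (w : List Bool) (n p : ℕ) (G : Tables r n) (v : Fin 0 → Fin n) (xs : Fin m → Fin n)
        (b : Bool), f.Runs (evalStore d w n p G (extendZero N xs) b) (t n)
          {evalStore d w n p G (extendZero N xs) (decide (JRealize G φ v xs))} := by
  induction φ with
  | falsum =>
    refine ⟨Frag.setFlag r d N false, fun _ => 1, .const 1, fun w n p G v xs b => ?_⟩
    have h : decide (JRealize G (.falsum : (JLang r).BoundedFormula (Fin 0) _) v xs) = false :=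
      decide_eq_false fun h => h
    rw [h]
    exact Frag.runs_setFlag false w n p G _ b
  | @equal m t₁ t₂ =>
    have hm : m ≤ N := hφ
    have key : ∀ t : (JLang r).Term (Fin 0 ⊕ Fin m), ∃ i : Fin m, t = .var (Sum.inr i) := by
      intro t
      cases t with
      | var i => rcases i with i | i; exact i.elim0; exact ⟨i, rfl⟩
      | func f _ => exact f.elim
    obtain ⟨i, rfl⟩ := key t₁
    obtain ⟨j, rfl⟩ := key t₂
    refine ⟨Frag.test fun s => s (.le (Fin.castLE hm i) (Fin.castLE hm j)) = some true ∧
      s (.le (Fin.castLE hm j) (Fin.castLE hm i)) = some true, fun _ => 2, .const 2,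
      fun w n p G v xs b => ?_⟩
    convert Frag.runs_test _ w n p G (extendZero N xs) b using 3
    refine decide_eq_decide.2 ?_
    rw [scan_le hd, scan_le hd]
    · simp only [JRealize, Language.BoundedFormula.Realize, Language.Term.realize, Sum.elim_inr,
        extendZero_castLE]
      rw [Fin.ext_iff]
      omega
    all_goals simp [extendZero_castLE]
  | @rel m l R ts =>
    have hm : m ≤ N := hφ
    have key : ∀ t : (JLang r).Term (Fin 0 ⊕ Fin m), ∃ i : Fin m, t = .var (Sum.inr i) := by
      intro t
      cases t with
      | var i => rcases i with i | i; exact i.elim0; exact ⟨i, rfl⟩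
      | func f _ => exact f.elim
    choose v hv using fun i => key (ts i)
    obtain rfl : ts = fun i => .var (Sum.inr (v i)) := funext hv
    cases R with
    | le =>
      refine ⟨Frag.test fun s => s (.le (Fin.castLE hm (v 0)) (Fin.castLE hm (v 1))) = some true,
        fun _ => 2, .const 2, fun w n p G u xs b => ?_⟩
      convert Frag.runs_test _ w n p G (extendZero N xs) b using 3
      refine decide_eq_decide.2 ?_
      rw [scan_le hd]
      · rw [extendZero_castLE, extendZero_castLE]
        change xs (v 0) ≤ xs (v 1) ↔ _
        simp
      all_goals simp [extendZero_castLE]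
    | var j =>
      refine ⟨Frag.test fun s => s (.tab j fun i => Fin.castLE hm (v i)) = some true,
        fun _ => 2, .const 2, fun w n p G u xs b => ?_⟩
      convert Frag.runs_test _ w n p G (extendZero N xs) b using 3
      refine decide_eq_decide.2 ?_
      rw [scan_tab hr w n p G _ b j _ fun i => xs (v i)]
      · rfl
      · simp [extendZero_castLE]
  | imp φ ψ ihφ ihψ =>
    obtain ⟨f, t, ht, hf⟩ := ihφ (le_trans (le_max_left _ _) hφ)
    obtain ⟨g, t', ht', hg⟩ := ihψ (le_trans (le_max_right _ _) hφ)
    refine ⟨f.seq (Frag.ite (fun s => s .flag = some true) g (Frag.setFlag r d N true)),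
      fun n => t n + (t' n + 2), ht.add (ht'.add (.const 2)), fun w n p G v xs b => ?_⟩
    refine (hf w n p G v xs b).seq_single ?_
    by_cases h : JRealize G φ v xs
    · have e : JRealize G (φ.imp ψ) v xs ↔ JRealize G ψ v xs := by
        simp only [JRealize] at h
        simp [JRealize, h]
      rw [decide_eq_decide.2 e]
      refine (Frag.Runs.ite_pos ?_ (hg w n p G v xs _)).mono (by omega)
      simp [scan_flag, h]
    · have e : JRealize G (φ.imp ψ) v xs := by
        simp only [JRealize] at h
        simp [JRealize, h]
      simp only [e, decide_true]
      refine (Frag.Runs.ite_neg ?_ (Frag.runs_setFlag true w n p G _ _)).mono (by omega)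
      simp [scan_flag, h]
  | @all m φ ih =>
    have hφ : depth φ ≤ N := hφ
    obtain ⟨f, t, ht, hf⟩ := ih hφ
    have hm : m < N := lt_of_lt_of_le (Nat.lt_succ_self m) (le_trans (le_depth φ) hφ)
    refine ⟨Frag.all ⟨m, hm⟩ f, fun n => allTime d n (t n), ?_, fun w n p G v xs b => ?_⟩
    · have hs := PolyBdd.stridesTime d
      exact (((PolyBdd.const 1).add ((PolyBdd.id.mul ((ht.add hs).add (.const 1))).add
        (.const 1))).add ((PolyBdd.id.mul (hs.add (.const 1))).add (.const 1))).add
        ((PolyBdd.const 2).mul hs)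
    · have h := runs_all hd ⟨m, hm⟩ f (t n) w n p G (extendZero N xs) (by simp [extendZero])
        (fun a => JRealize G φ v (Fin.snoc xs a)) (by
          intro a b
          have := hf w n p G v (Fin.snoc xs a) b
          rwa [extendZero_snoc hm] at this) b
      convert h using 3
      exact decide_eq_decide.2 Iff.rfl

end Tape

/-! ### Filling tables cell by cell

The mode of a cell says whether its content is guessed (`none`), read from the input
(`some true`) or zero (`some false`). -/

/-- The possible contents of a cell with mode `m` if the next input symbol is `o`. -/
def cellChoice (m o : Option Bool) : Finset Bool :=
  match m with
  | none => Finset.univ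
  | some true => o.toFinset
  | some false => {false}

/-- The number of input symbols read for a cell with mode `m`. -/
def modeRead (m : Option Bool) : ℕ := if m = some true then 1 else 0

/-- The possible contents of cells with modes `ms` if the input is read from position `p` on. -/
def fillings (w : List Bool) : List (Option Bool) → ℕ → Multiset (List Bool)
  | [], _ => {[]}
  | m :: ms, p => (cellChoice m w[p]?).val.bind fun b =>
      (fillings w ms (p + modeRead m)).map (List.cons b)

/-- The part of the contents of cells with modes `ms` that comes from the input. -/
def readPart : List (Option Bool) → List Bool → List Bool
  | some true :: ms, b :: L => b :: readPart ms L
  | _ :: ms, _ :: L => readPart ms L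
  | _, _ => []

theorem prefix_append_drop {A B w : List Bool} {p : ℕ} :
    A ++ B <+: w.drop p ↔ A <+: w.drop p ∧ B <+: w.drop (p + A.length) := by
  constructor
  · rintro ⟨C, hC⟩
    refine ⟨⟨B ++ C, by rw [← hC, List.append_assoc]⟩, ⟨C, ?_⟩⟩
    rw [← List.drop_drop, ← hC, List.append_assoc, List.drop_left]
  · rintro ⟨⟨C, hC⟩, h⟩
    rw [← List.drop_drop, ← hC, List.drop_left] at h
    rw [← hC]
    exact (List.prefix_append_right_inj A).2 h

theorem cons_prefix_drop {b : Bool} {B w : List Bool} {p : ℕ} :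
    b :: B <+: w.drop p ↔ w[p]? = some b ∧ B <+: w.drop (p + 1) := by
  have h := prefix_append_drop (A := [b]) (B := B) (w := w) (p := p)
  rw [List.singleton_append] at h
  rw [h]
  refine and_congr ?_ Iff.rfl
  rw [show w[p]? = (w.drop p)[0]? by simp]
  cases w.drop p <;> simp [eq_comm]

/-- The input head advances exactly at the cells that are read, so their contents spell a contiguous
segment of the input, while guessed cells are unconstrained. This describes the outcomes without
reference to the order of events. -/
theorem mem_fillings {w : List Bool} {ms : List (Option Bool)} {p : ℕ} {L : List Bool} :
    L ∈ fillings w ms p ↔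
      List.Forall₂ (fun m b => m = some false → b = false) ms L ∧
        readPart ms L <+: w.drop p := by
  induction ms generalizing p L with
  | nil =>
    simp only [fillings, Multiset.mem_singleton, List.forall₂_nil_left_iff]
    constructor
    · rintro rfl
      exact ⟨rfl, by simp [readPart]⟩
    · exact fun h => h.1
  | cons m ms ih =>
    simp only [fillings, Multiset.mem_bind, Multiset.mem_map, Finset.mem_val, ih]
    constructor
    · rintro ⟨b, hb, L, ⟨h1, h2⟩, rfl⟩
      rcases m with _ | _ | _
      · exact ⟨.cons (by simp) h1, by simpa [readPart, modeRead] using h2⟩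
      · exact ⟨.cons (by simpa [cellChoice] using hb) h1, by simpa [readPart, modeRead] using h2⟩
      · refine ⟨.cons (by simp) h1, ?_⟩
        rw [readPart, cons_prefix_drop]
        exact ⟨by simpa [cellChoice] using hb, by simpa [modeRead] using h2⟩
    · rintro ⟨h1, h2⟩
      cases L with
      | nil => simp at h1
      | cons b L =>
        rw [List.forall₂_cons] at h1
        refine ⟨b, ?_, L, ⟨h1.2, ?_⟩, rfl⟩
        · rcases m with _ | _ | _
          · simp [cellChoice]
          · simpa [cellChoice] using h1.1
          · rw [readPart, cons_prefix_drop] at h2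
            simpa [cellChoice] using h2.1
        · rcases m with _ | _ | _
          · simpa [readPart, modeRead] using h2
          · simpa [readPart, modeRead] using h2
          · rw [readPart, cons_prefix_drop] at h2
            simpa [modeRead] using h2.2

theorem nodup_bind_of {α β : Type*} {s : Multiset α} {t : α → Multiset β} (hs : s.Nodup)
    (ht : ∀ a ∈ s, (t a).Nodup) (hd : ∀ a ∈ s, ∀ b ∈ s, ∀ x, x ∈ t a → x ∈ t b → a = b) :
    (s.bind t).Nodup := by
  rw [Multiset.nodup_bind]
  refine ⟨ht, ?_⟩
  induction s using Quotient.inductionOn with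
  | _ l =>
    refine ⟨l, rfl, List.Nodup.pairwise_of_forall_ne hs fun a ha b hb hne => ?_⟩
    exact Multiset.disjoint_left.2 fun hx hx' => hne (hd a ha b hb _ hx hx')

/-- Different choices leave different contents. Hence cardinalities of multisets of outcomes, which
count computations, also count contents. -/
theorem nodup_fillings (w : List Bool) (ms : List (Option Bool)) (p : ℕ) :
    (fillings w ms p).Nodup := by
  induction ms generalizing p with
  | nil => simp [fillings]
  | cons m ms ih =>
    refine nodup_bind_of (Finset.nodup _) (fun b _ => (ih _).map List.cons_injective) ?_
    intro b _ b' _ L hL hL'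
    obtain ⟨L1, -, rfl⟩ := Multiset.mem_map.1 hL
    obtain ⟨L2, -, h⟩ := Multiset.mem_map.1 hL'
    exact (List.cons.inj h).1.symm

theorem readPart_guess (N : ℕ) (L : List Bool) : readPart (List.replicate N none) L = [] := by
  induction N generalizing L with
  | zero => simp [readPart]
  | succ N ih => cases L <;> simp [readPart, List.replicate_succ, ih]

theorem readPart_read (N : ℕ) (L : List Bool) (h : L.length = N) :
    readPart (List.replicate N (some true)) L = L := by
  induction N generalizing L with
  | zero => simpa [readPart, eq_comm] using h
  | succ N ih =>
    cases L with
    | nil => simp at h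
    | cons b L => simp [readPart, List.replicate_succ, ih L (by simpa using h)]

theorem readPart_length (ms : List (Option Bool)) (L : List Bool) (h : ms.length = L.length) :
    (readPart ms L).length = (ms.map modeRead).sum := by
  induction ms generalizing L with
  | nil => simp [readPart]
  | cons m ms ih =>
    cases L with
    | nil => simp at h
    | cons b L =>
      have := ih L (by simpa using h)
      rcases m with _ | _ | _ <;> simp [readPart, modeRead, this]; omega

/-- The tape symbol for a bit. -/
def bitSym (b : Bool) : Option Bool := if b then some true else none

/-- The tape after writing the bits of a list, starting at cell `h` and moving by `c`. -/
noncomputable def writeCells (c : ℤ) : (ℤ → Option Bool) → ℤ → List Bool → ℤ → Option Bool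
  | Z, _, [] => Z
  | Z, h, b :: L => writeCells c (Function.update Z h (bitSym b)) (h + c) L

/-- As `c ≠ 0`, the head never returns to a cell that it has written. -/
theorem writeCells_apply (c : ℤ) (hc : c ≠ 0) (Z : ℤ → Option Bool) (h : ℤ) (L : List Bool) :
    (∀ i (hi : i < L.length), writeCells c Z h L (h + i * c) = bitSym L[i]) ∧
      ∀ z, (∀ i < L.length, z ≠ h + i * c) → writeCells c Z h L z = Z z := by
  induction L generalizing Z h with
  | nil => simp [writeCells]
  | cons b L ih =>
    obtain ⟨ih1, ih2⟩ := ih (Function.update Z h (bitSym b)) (h + c)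
    constructor
    · intro i hi
      cases i with
      | zero =>
        rw [writeCells, ih2]
        · simp
        · intro i _ he
          have : ((i : ℤ) + 1) * c = 0 := by push_cast at he; linarith
          rcases mul_eq_zero.1 this with h | h
          · omega
          · exact hc h
      | succ i =>
        have := ih1 i (by simpa using hi)
        rw [writeCells, List.getElem_cons_succ, ← this]
        congr 1
        push_cast
        ring
    · intro z hz
      rw [writeCells, ih2 z, Function.update_of_ne]
      · have := hz 0 (by simp)
        simpa using this
      · intro i hi
        have := hz (i + 1) (by simpa using hi)
        intro h'
        apply this
        rw [h']
        push_cast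
        ring

/-- The tape on which a list of bits is written from cell `0` on. -/
noncomputable def listTape (L : List Bool) : ℤ → Option Bool :=
  marks fun z => 0 ≤ z ∧ L[z.toNat]? = some true

theorem writeCells_right (L : List Bool) :
    writeCells 1 (fun _ => none) 0 L = listTape L := by
  obtain ⟨h1, h2⟩ := writeCells_apply 1 (by simp) (fun _ => none) 0 L
  funext z
  by_cases hz : 0 ≤ z ∧ z.toNat < L.length
  · have := h1 z.toNat hz.2
    have e : (0 : ℤ) + (z.toNat : ℤ) * 1 = z := by omega
    rw [e] at this
    rw [this]
    simp [listTape, marks, bitSym, hz.1, hz.2]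
  · rw [h2 z]
    · rw [listTape, marks, if_neg]
      rintro ⟨h, h'⟩
      exact hz ⟨h, (List.getElem?_eq_some_iff.1 h').1⟩
    · rintro i hi rfl
      apply hz
      constructor <;> simp [hi]

theorem writeCells_left (L : List Bool) :
    writeCells (-1) (fun _ => none) (L.length - 1) L = listTape L.reverse := by
  obtain ⟨h1, h2⟩ := writeCells_apply (-1) (by simp) (fun _ => none) (L.length - 1) L
  funext z
  by_cases hz : 0 ≤ z ∧ z.toNat < L.length
  · have := h1 (L.length - 1 - z.toNat) (by omega)
    have e : ((L.length : ℤ) - 1) + ((L.length - 1 - z.toNat : ℕ) : ℤ) * (-1) = z := by omega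
    rw [e] at this
    rw [this]
    simp [listTape, marks, bitSym, hz.1, hz.2]
  · rw [h2 z]
    · rw [listTape, marks, if_neg]
      rintro ⟨h, h'⟩
      have := (List.getElem?_eq_some_iff.1 h').1
      exact hz ⟨h, by simpa using this⟩
    · rintro i hi rfl
      apply hz
      omega

/-! ### Truth tables -/

theorem encRel_length {n a : ℕ} (S : Set (Fin a → Fin n)) : (encRel S).length = n ^ a := by
  simp [encRel]

theorem encRel_getElem? {n a : ℕ} (S : Set (Fin a → Fin n)) (u : Fin a → Fin n) :
    (encRel S)[tupleIdx u]? = some (decide (u ∈ S)) := by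
  have h : tupleIdx u < n ^ a := Fin.is_lt _
  rw [encRel, List.getElem?_ofFn, dif_pos h]
  congr 2
  simp only [tupleIdx, Fin.eta, Equiv.symm_apply_apply, Fin.rev_rev]

theorem listTape_encRel {n a : ℕ} (S : Set (Fin a → Fin n)) :
    listTape (encRel S) = tableTape S := by
  rw [listTape, tableTape]
  congr 1
  funext z
  apply propext
  constructor
  · rintro ⟨hz, h⟩
    have hlt : z.toNat < n ^ a := by
      rw [← encRel_length S]
      exact (List.getElem?_eq_some_iff.1 h).1
    set u : Fin a → Fin n := fun i => finFunctionFinEquiv.symm ⟨z.toNat, hlt⟩ (Fin.rev i) with hu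
    have hi : tupleIdx u = z.toNat := by
      simp [tupleIdx, hu]
    rw [← hi, encRel_getElem?] at h
    refine ⟨u, by simpa using h, ?_⟩
    rw [hi]
    omega
  · rintro ⟨u, hu, rfl⟩
    refine ⟨by positivity, ?_⟩
    rw [Int.toNat_natCast, encRel_getElem?]
    simp [hu]

theorem encRel_injective {n a : ℕ} :
    Function.Injective (encRel : Set (Fin a → Fin n) → List Bool) := by
  intro S S' h
  ext u
  have h1 := encRel_getElem? S u
  rw [h, encRel_getElem? S' u] at h1
  simpa using h1.symm

theorem exists_encRel_eq {n a : ℕ} (L : List Bool) (hL : L.length = n ^ a) :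
    ∃ S : Set (Fin a → Fin n), encRel S = L := by
  refine ⟨{u | L[tupleIdx u]? = some true}, ?_⟩
  apply List.ext_getElem?
  intro i
  by_cases hi : i < n ^ a
  · have hu : tupleIdx (fun j : Fin a => finFunctionFinEquiv.symm ⟨i, hi⟩ (Fin.rev j)) = i := by
      simp [tupleIdx]
    have := encRel_getElem? {u | L[tupleIdx u]? = some true}
      (fun j : Fin a => finFunctionFinEquiv.symm ⟨i, hi⟩ (Fin.rev j))
    rw [hu] at this
    rw [this, Set.mem_ofPred_eq, hu]
    have hi' : i < L.length := by omega
    rw [List.getElem?_eq_getElem hi']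
    rcases L[i] <;> simp
  · rw [List.getElem?_eq_none, List.getElem?_eq_none]
    · omega
    · rw [encRel_length]; omega

/-! ### Writing one truth table on its tapes -/

section Tape

variable {J : Type} {r : J → ℕ} {d N : ℕ}

/-- The tape is a copy of the table of `j`. -/
def Tape.IsCopy (j : J) : Tape r d N → Prop
  | .tab j' _ => j' = j
  | _ => False

/-- The modes of `k` cells from cell `h` on. -/
def modesFrom (modeAt : ℤ → Option Bool) (c : ℤ) : ℕ → ℤ → List (Option Bool)
  | 0, _ => []
  | k + 1, h => modeAt h :: modesFrom modeAt c k (h + c)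

theorem modesFrom_eq_ofFn (modeAt : ℤ → Option Bool) (c : ℤ) (k : ℕ) (h : ℤ) :
    modesFrom modeAt c k h = List.ofFn fun i : Fin k => modeAt (h + (i : ℕ) * c) := by
  induction k generalizing h with
  | zero => simp [modesFrom]
  | succ k ih =>
    rw [modesFrom, ih, List.ofFn_succ]
    congr 1
    · simp
    · congr 1
      funext i
      congr 1
      push_cast [Fin.val_succ]
      ring

/-- The store with input position `p`, with heads of the tapes in `T` on cell `h` and the content
`Z` on the tapes in `C`. -/
noncomputable def fillStore (base : Store (Tape r d N) (Option Bool)) (C T : Tape r d N → Prop)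
    (y : ℕ × ℤ × (ℤ → Option Bool)) : Store (Tape r d N) (Option Bool) where
  head := fun i => if i = .inp then (y.1 : ℤ) else if T i then y.2.1 else base.head i
  tape := fun i => if C i then y.2.2 else base.tape i

namespace Frag

/-- Write a bit on the tapes in `C`, in the way determined by `mode`, and move the heads of the
tapes in `T`. -/
@[reducible] noncomputable def fillCell (C T : Tape r d N → Prop)
    (mode : (Tape r d N → Option Bool) → Option Bool) (dir : Move) :
    Frag (Tape r d N) (Option Bool) :=
  act fun s => (cellChoice (mode s) (s .inp)).image fun b =>
    ((fun i => if C i then bitSym b else s i),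
      fun i => if i = .inp then (if mode s = some true then .right else .stay)
        else if T i then dir else .stay)

/-- The effect of `fillCell`. -/
noncomputable def fillStep (w : List Bool) (modeAt : ℤ → Option Bool) (c : ℤ)
    (y : ℕ × ℤ × (ℤ → Option Bool)) : Multiset (ℕ × ℤ × (ℤ → Option Bool)) :=
  (cellChoice (modeAt y.2.1) w[y.1]?).val.map fun b =>
    (y.1 + modeRead (modeAt y.2.1), y.2.1 + c, Function.update y.2.2 y.2.1 (bitSym b))

theorem iterK_fillStep (w : List Bool) (modeAt : ℤ → Option Bool) (c : ℤ) (k : ℕ)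
    (p : ℕ) (h : ℤ) (Z : ℤ → Option Bool) :
    iterK (fillStep w modeAt c) k (p, h, Z) =
      (fillings w (modesFrom modeAt c k h) p).map fun L =>
        (p + ((modesFrom modeAt c k h).map modeRead).sum, h + k * c, writeCells c Z h L) := by
  induction k generalizing p h Z with
  | zero => simp [iterK, modesFrom, fillings, writeCells]
  | succ k ih =>
    rw [iterK, modesFrom, fillings, fillStep, Multiset.bind_map, Multiset.map_bind]
    refine Multiset.bind_congr fun b _ => ?_
    rw [ih, Multiset.map_map]
    refine Multiset.map_congr rfl fun L _ => ?_
    simp only [Function.comp, List.map_cons, List.sum_cons, writeCells, Prod.mk.injEq, and_true]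
    refine ⟨by omega, ?_⟩
    push_cast
    ring

/-- By `hC` the bit is written on some tape, so different bits are different actions and a guess
really makes two branches. The mode may depend only on the common position of the moving heads
(`hmode`), not on the heads of the rulers that drive the loop around this cell. -/
theorem runs_fillCell (base : Store (Tape r d N) (Option Bool)) (C T : Tape r d N → Prop)
    (mode : (Tape r d N → Option Bool) → Option Bool) (dir : Move) (w : List Bool)
    (modeAt : ℤ → Option Bool) (l : List (Tape r d N))
    (hCT : ∀ i, C i → T i) (hinp : ¬ T .inp) (hC : ∃ i, C i)
    (hl : ∀ i ∈ l, ¬ T i ∧ i ≠ .inp) (hw : base.tape .inp = inputTape w)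
    (hmode : ∀ y z, mode ((fillStore base C T y).setHeads l z).scan = modeAt y.2.1)
    (y : ℕ × ℤ × (ℤ → Option Bool)) (z : Tape r d N → ℤ) :
    (fillCell C T mode dir).Runs ((fillStore base C T y).setHeads l z) 1
      ((fillStep w modeAt dir.shift y).map fun y' => (fillStore base C T y').setHeads l z) := by
  obtain ⟨i₀, hi₀⟩ := hC
  have hinp' : Tape.inp ∉ l := fun h => (hl _ h).2 rfl
  have hCinp : ¬ C .inp := fun h => hinp (hCT _ h)
  have hscan : ((fillStore base C T y).setHeads l z).scan .inp = w[y.1]? := by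
    simp [Store.scan, Store.setHeads, hinp', fillStore, hCinp, hw, inputTape]
  have h := runs_act (fun s : Tape r d N → Option Bool =>
    (cellChoice (mode s) (s .inp)).image fun b =>
    (((fun i => if C i then bitSym b else s i),
      fun i => if i = .inp then (if mode s = some true then Move.right else .stay)
        else if T i then dir else .stay) : Act (Tape r d N) (Option Bool)))
    ((fillStore base C T y).setHeads l z)
  rw [Finset.image_val_of_injOn, Multiset.map_map] at h
  · convert h using 1
    rw [fillStep, Multiset.map_map, hmode, hscan]
    refine Multiset.map_congr rfl fun b _ => ?_
    simp only [Function.comp]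
    ext1
    · funext i
      simp only [fillStore, Store.setHeads, Store.after]
      by_cases h1 : i = .inp
      · subst h1
        simp only [hinp', if_false, if_true, modeRead]
        split_ifs <;> simp [Move.shift]
      · simp only [h1, if_false]
        by_cases h2 : i ∈ l
        · simp [h2, (hl i h2).1, Move.shift]
        · simp only [h2, if_false]
          by_cases h3 : T i <;> simp [h3, Move.shift]
    · funext i
      simp only [fillStore, Store.setHeads, Store.after, Store.scan]
      by_cases h1 : C i
      · have h2 := hCT i h1
        have h3 : i ≠ .inp := by rintro rfl; exact hinp h2
        have h4 : i ∉ l := fun h => (hl i h).1 h2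
        simp [h1, h2, h3, h4]
      · simp [h1]
  · intro b _ b' _ hbb
    have := congrFun (congrArg Prod.fst hbb) i₀
    simp only [hi₀, if_true, bitSym] at this
    revert this
    cases b <;> cases b' <;> simp

theorem runs_rep_fillCell (n k : ℕ) (base : Store (Tape r d N) (Option Bool))
    (C T : Tape r d N → Prop)
    (mode : (Tape r d N → Option Bool) → Option Bool) (dir : Move) (w : List Bool)
    (modeAt : ℤ → Option Bool) (hk : k ≤ d)
    (hCT : ∀ i, C i → T i) (hinp : ¬ T .inp) (hC : ∃ i, C i)
    (hT : ∀ e, ¬ T (.rul e)) (hw : base.tape .inp = inputTape w)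
    (hrul : ∀ e, base.head (.rul e) = 0 ∧ base.tape (.rul e) = ruler n)
    (hmode : ∀ y z, mode ((fillStore base C T y).setHeads (rulers r d N k) z).scan = modeAt y.2.1)
    (p : ℕ) (h : ℤ) (Z : ℤ → Option Bool) :
    (rep (rulers r d N k) (fillCell C T mode dir)).Runs (fillStore base C T (p, h, Z))
      (repTime n 1 k)
      ((fillings w (modesFrom modeAt dir.shift (n ^ k) h) p).map fun L =>
        fillStore base C T (p + ((modesFrom modeAt dir.shift (n ^ k) h).map modeRead).sum,
          h + (n ^ k : ℕ) * dir.shift, writeCells dir.shift Z h L)) := by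
  have h1 := runs_rep n (rulers r d N k) (rulers_nodup k) (fillStore base C T)
    (fillStep w modeAt dir.shift) 1 (fillCell C T mode dir) (by
      intro y ρ hρ
      obtain ⟨e, rfl⟩ := exists_of_mem_rulers hρ
      have : ¬ C (.rul e) := fun h => hT e (hCT _ h)
      simpa [fillStore, hT, this] using hrul e)
    (runs_fillCell base C T mode dir w modeAt _ hCT hinp hC (by
      intro ρ hρ
      obtain ⟨e, rfl⟩ := exists_of_mem_rulers hρ
      exact ⟨hT e, by simp⟩) hw hmode) (p, h, Z)
  rw [rulers_length hk, iterK_fillStep, Multiset.map_map] at h1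
  exact h1

/-- Move the heads of the tapes in `T` by `n ^ k` cells. -/
theorem runs_rep_mv_fillStore (n k : ℕ) (base : Store (Tape r d N) (Option Bool))
    (C T : Tape r d N → Prop) (dir : Move) (hk : k ≤ d) (hinp : ¬ T .inp)
    (hT : ∀ e, ¬ T (.rul e)) (hCT : ∀ i, C i → T i)
    (hrul : ∀ e, base.head (.rul e) = 0 ∧ base.tape (.rul e) = ruler n)
    (p : ℕ) (h : ℤ) (Z : ℤ → Option Bool) :
    (rep (rulers r d N k) (mv fun i => if T i then dir else .stay)).Runs
      (fillStore base C T (p, h, Z)) (repTime n 1 k)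
      {fillStore base C T (p, h + (n ^ k : ℕ) * dir.shift, Z)} := by
  have h1 := runs_rep_mv n (rulers r d N k) (rulers_nodup k) (fillStore base C T (p, h, Z))
    (fun i => if T i then dir else .stay) (by
      intro ρ hρ
      obtain ⟨e, rfl⟩ := exists_of_mem_rulers hρ
      simp [hT]) (by
      intro ρ hρ
      obtain ⟨e, rfl⟩ := exists_of_mem_rulers hρ
      have : ¬ C (.rul e) := fun h => hT e (hCT _ h)
      simpa [fillStore, hT, this] using hrul e)
  rw [rulers_length hk] at h1
  convert h1 using 2
  ext1
  · funext i
    simp only [fillStore, Store.shift]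
    by_cases h1 : i = .inp
    · subst h1; simp [hinp, Move.shift]
    · by_cases h2 : T i <;> simp [h1, h2, Move.shift]
  · rfl

theorem runs_mv_fillStore (base : Store (Tape r d N) (Option Bool))
    (C T : Tape r d N → Prop) (dir : Move) (hinp : ¬ T .inp)
    (p : ℕ) (h : ℤ) (Z : ℤ → Option Bool) :
    (mv fun i => if T i then dir else .stay).Runs
      (fillStore base C T (p, h, Z)) 1 {fillStore base C T (p, h + dir.shift, Z)} := by
  convert runs_mv _ _ using 2
  ext1
  · funext i
    simp only [fillStore, Store.shift]
    by_cases h1 : i = .inp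
    · subst h1; simp [hinp, Move.shift]
    · by_cases h2 : T i <;> simp [h1, h2, Move.shift]
  · rfl

/-- Fill the tapes in `C` from left to right. -/
@[reducible] noncomputable def fillRight (k : ℕ) (C T : Tape r d N → Prop)
    (mode : (Tape r d N → Option Bool) → Option Bool) : Frag (Tape r d N) (Option Bool) :=
  (rep (rulers r d N k) (fillCell C T mode .right)).seq
    (rep (rulers r d N k) (mv fun i => if T i then .left else .stay))

/-- Fill the tapes in `C` from right to left. -/
@[reducible] noncomputable def fillLeft (k : ℕ) (C T : Tape r d N → Prop)
    (mode : (Tape r d N → Option Bool) → Option Bool) : Frag (Tape r d N) (Option Bool) :=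
  (rep (rulers r d N k) (mv fun i => if T i then .right else .stay)).seq
    ((mv fun i => if T i then .left else .stay).seq
      ((rep (rulers r d N k) (fillCell C T mode .left)).seq
        (mv fun i => if T i then .right else .stay)))

theorem runs_fillRight (n k : ℕ) (base : Store (Tape r d N) (Option Bool))
    (C T : Tape r d N → Prop)
    (mode : (Tape r d N → Option Bool) → Option Bool) (w : List Bool)
    (modeAt : ℤ → Option Bool) (hk : k ≤ d)
    (hCT : ∀ i, C i → T i) (hinp : ¬ T .inp) (hC : ∃ i, C i)
    (hT : ∀ e, ¬ T (.rul e)) (hw : base.tape .inp = inputTape w)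
    (hrul : ∀ e, base.head (.rul e) = 0 ∧ base.tape (.rul e) = ruler n)
    (hmode : ∀ y z, mode ((fillStore base C T y).setHeads (rulers r d N k) z).scan = modeAt y.2.1)
    (p : ℕ) :
    (fillRight k C T mode).Runs (fillStore base C T (p, 0, fun _ => none)) (2 * repTime n 1 k)
      ((fillings w (List.ofFn fun i : Fin (n ^ k) => modeAt (i : ℕ)) p).map fun L =>
        fillStore base C T (p + ((List.ofFn fun i : Fin (n ^ k) => modeAt (i : ℕ)).map
          modeRead).sum, 0, listTape L)) := by
  have h1 := runs_rep_fillCell n k base C T mode .right w modeAt hk hCT hinp hC hT hw hrul hmode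
    p 0 (fun _ => none)
  have h2 := h1.seq (t' := repTime n 1 k) fun L _ =>
    runs_rep_mv_fillStore n k base C T .left hk hinp hT hCT hrul _ _ _
  rw [Multiset.bind_singleton, modesFrom_eq_ofFn] at h2
  simp only [Move.shift, writeCells_right, zero_add, mul_one, mul_neg, add_neg_cancel] at h2
  exact h2.mono (by omega)

/-- The heads go to cell `n ^ k` and one step back, onto the last row. After `n ^ k` steps to the
left they are on cell `-1`, and a final step to the right puts them on `0`. -/
theorem runs_fillLeft (n k : ℕ) (base : Store (Tape r d N) (Option Bool))
    (C T : Tape r d N → Prop)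
    (mode : (Tape r d N → Option Bool) → Option Bool) (w : List Bool)
    (modeAt : ℤ → Option Bool) (hk : k ≤ d)
    (hCT : ∀ i, C i → T i) (hinp : ¬ T .inp) (hC : ∃ i, C i)
    (hT : ∀ e, ¬ T (.rul e)) (hw : base.tape .inp = inputTape w)
    (hrul : ∀ e, base.head (.rul e) = 0 ∧ base.tape (.rul e) = ruler n)
    (hmode : ∀ y z, mode ((fillStore base C T y).setHeads (rulers r d N k) z).scan = modeAt y.2.1)
    (p : ℕ) :
    (fillLeft k C T mode).Runs (fillStore base C T (p, 0, fun _ => none))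
      (2 * repTime n 1 k + 2)
      ((fillings w (List.ofFn fun i : Fin (n ^ k) => modeAt (i : ℕ)).reverse p).map fun L =>
        fillStore base C T (p + ((List.ofFn fun i : Fin (n ^ k) => modeAt (i : ℕ)).reverse.map
          modeRead).sum, 0, listTape L.reverse)) := by
  have e1 := runs_rep_mv_fillStore n k base C T .right hk hinp hT hCT hrul p 0 (fun _ => none)
  have e2 := runs_mv_fillStore base C T .left hinp p (0 + (n ^ k : ℕ) * Move.right.shift)
    (fun _ => none)
  have e3 := runs_rep_fillCell n k base C T mode .left w modeAt hk hCT hinp hC hT hw hrul hmode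
    p (0 + (n ^ k : ℕ) * Move.right.shift + Move.left.shift) (fun _ => none)
  have e4 := e3.seq (t' := 1) fun L _ => runs_mv_fillStore base C T .right hinp _ _ _
  rw [Multiset.bind_singleton, modesFrom_eq_ofFn] at e4
  have hm : (List.ofFn fun i : Fin (n ^ k) =>
      modeAt (0 + (n ^ k : ℕ) * Move.right.shift + Move.left.shift + (i : ℕ) * Move.left.shift)) =
      (List.ofFn fun i : Fin (n ^ k) => modeAt (i : ℕ)).reverse := by
    refine List.ext_getElem (by simp) fun i h1 h2 => ?_
    simp only [List.getElem_reverse, List.getElem_ofFn, List.length_ofFn]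
    congr 1
    rw [List.length_ofFn] at h1
    simp only [Move.shift]
    omega
  rw [hm] at e4
  have e5 := (e1.seq_single (e2.seq_single e4)).mono (t' := 2 * repTime n 1 k + 2) (by omega)
  convert e5 using 1
  refine Multiset.map_congr rfl fun L hL => ?_
  have hlen := (mem_fillings.1 hL).1.length_eq
  rw [List.length_reverse, List.length_ofFn] at hlen
  have e6 : (0 : ℤ) + (n ^ k : ℕ) * Move.right.shift + Move.left.shift = (L.length : ℤ) - 1 := by
    rw [← hlen]
    simp only [Move.shift]
    push_cast
    ring
  rw [e6]
  congr 3
  · rw [← hlen]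
    simp only [Move.shift]
    push_cast
    ring
  · exact (writeCells_left L).symm

end Frag
end Tape

/-- How a table is filled: by guessing, by reading its truth table from the input, or by reading
from the input, from the last row to the first one, the rows that belong to another table. -/
inductive Kind (J : Type)
  | guess
  | read
  | masked (j : J)

/-! ### Filling a list of tables in a fixed order -/

section Tape

variable {J : Type} {r : J → ℕ} {d N : ℕ}

/-- The modes of the rows of table `j`, in the order of filling. -/
noncomputable def cellModes (kind : J → Kind J) {n : ℕ} (G : Tables r n) (j : J) :
    List (Option Bool) :=
  match kind j with
  | .guess => List.replicate (n ^ r j) none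
  | .read => List.replicate (n ^ r j) (some true)
  | .masked j' => (encRel (G j')).reverse.map some

/-- The rows of a table, in the order of filling. -/
noncomputable def cellList (k : Kind J) {n a : ℕ} (S : Set (Fin a → Fin n)) : List Bool :=
  match k with
  | .guess => encRel S
  | .read => encRel S
  | .masked _ => (encRel S).reverse

theorem cellList_length (k : Kind J) {n a : ℕ} (S : Set (Fin a → Fin n)) :
    (cellList k S).length = n ^ a := by
  cases k <;> simp [cellList, encRel_length]

theorem cellList_injective (k : Kind J) {n a : ℕ} :
    Function.Injective (cellList k : Set (Fin a → Fin n) → List Bool) := by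
  intro S S' h
  cases k
  · exact encRel_injective h
  · exact encRel_injective h
  · exact encRel_injective (List.reverse_injective h)

theorem exists_cellList_eq (k : Kind J) {n a : ℕ} (L : List Bool) (hL : L.length = n ^ a) :
    ∃ S : Set (Fin a → Fin n), cellList k S = L := by
  cases k
  · exact exists_encRel_eq L hL
  · exact exists_encRel_eq L hL
  · obtain ⟨S, hS⟩ := exists_encRel_eq L.reverse (by simpa using hL)
    exact ⟨S, by simp [cellList, hS]⟩

theorem cellModes_length (kind : J → Kind J) (hmask : ∀ j j', kind j = .masked j' → r j' = r j)
    {n : ℕ} (G : Tables r n) (j : J) : (cellModes kind G j).length = n ^ r j := by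
  unfold cellModes
  split
  · simp
  · simp
  · rename_i j' h
    simp [encRel_length, hmask j j' h]

/-- Lists of the right length are exactly the truth tables, so the outcomes can be indexed by
relations instead of lists of bits. -/
theorem fillings_eq_map (kind : J → Kind J) (hmask : ∀ j j', kind j = .masked j' → r j' = r j)
    {n : ℕ} (G : Tables r n) (j : J) (w : List Bool) (p : ℕ) :
    fillings w (cellModes kind G j) p =
      ((Finset.univ : Finset (Set (Fin (r j) → Fin n))).filter fun S =>
        cellList (kind j) S ∈ fillings w (cellModes kind G j) p).val.map (cellList (kind j)) := by
  refine ((nodup_fillings _ _ _).ext ((Finset.nodup _).map (cellList_injective _))).2 fun L => ?_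
  simp only [Multiset.mem_map, Finset.mem_val, Finset.mem_filter, Finset.mem_univ, true_and]
  constructor
  · intro hL
    obtain ⟨S, rfl⟩ := exists_cellList_eq (kind j) (a := r j) (n := n) L (by
      rw [← (mem_fillings.1 hL).1.length_eq, cellModes_length kind hmask])
    exact ⟨S, hL, rfl⟩
  · rintro ⟨S, hS, rfl⟩
    exact hS

/-- The effect of filling table `j`, on the input position and the tables. -/
noncomputable def fillTableStep (kind : J → Kind J) {n : ℕ} (w : List Bool) (j : J)
    (y : ℕ × Tables r n) : Multiset (ℕ × Tables r n) :=
  ((Finset.univ : Finset (Set (Fin (r j) → Fin n))).filter fun S =>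
    cellList (kind j) S ∈ fillings w (cellModes kind y.2 j) y.1).val.map fun S =>
      (y.1 + ((cellModes kind y.2 j).map modeRead).sum, Function.update y.2 j S)

namespace Frag

/-- Fill all copies of table `j`; the tape `tab j' fun _ => z` is used for reading the mask. -/
@[reducible] noncomputable def fillTable (d : ℕ) (kind : J → Kind J) (z : Fin N) (j : J) :
    Frag (Tape r d N) (Option Bool) :=
  match kind j with
  | .guess => fillRight (r j) (Tape.IsCopy j) (Tape.IsCopy j) fun _ => none
  | .read => fillRight (r j) (Tape.IsCopy j) (Tape.IsCopy j) fun _ => some true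
  | .masked j' => fillLeft (r j) (Tape.IsCopy j)
      (fun i => Tape.IsCopy j i ∨ i = .tab j' fun _ => z)
      fun s => some (decide (s (.tab j' fun _ => z) = some true))

theorem evalStore_zero_head (w : List Bool) (n p : ℕ) (G : Tables r n) (b : Bool)
    (i : Tape r d N) :
    (evalStore d w n p G 0 b).head i = if i = .inp then (p : ℤ) else 0 := by
  simp [evalStore, headPos]

theorem fillStore_evalStore (w : List Bool) (n p q : ℕ) (G : Tables r n) (j : J)
    (T : Tape r d N → Prop) (S : Set (Fin (r j) → Fin n)) :
    fillStore (evalStore d w n q G (0 : Fin N → ℤ) false) (Tape.IsCopy j) T (p, 0, tableTape S) =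
      evalStore d w n p (Function.update G j S) 0 false := by
  ext1
  · funext i
    rw [evalStore_zero_head]
    simp only [fillStore, evalStore_zero_head]
    split_ifs <;> rfl
  · funext i
    simp only [fillStore]
    cases i with
    | tab j' v =>
      by_cases h : j' = j
      · subst h
        simp [Tape.IsCopy, evalStore]
      · simp [Tape.IsCopy, evalStore, h]
    | _ => simp [Tape.IsCopy, evalStore]

theorem tableTape_empty {a n : ℕ} : tableTape (∅ : Set (Fin a → Fin n)) = fun _ => none := by
  funext z
  simp [tableTape, marks]

theorem ofFn_tableTape {a n : ℕ} (S : Set (Fin a → Fin n)) (k : ℕ) (h : n ^ a = k) :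
    (List.ofFn fun i : Fin k => some (decide (tableTape S ((i : ℕ) : ℤ) = some true))) =
      (encRel S).map some := by
  refine List.ext_getElem (by simp [encRel_length, h]) fun i h1 h2 => ?_
  rw [List.length_map] at h2
  simp [← listTape_encRel, listTape, marks_eq_some, List.getElem?_eq_getElem h2]

theorem runs_fillTable (kind : J → Kind J) (hmask : ∀ j j', kind j = .masked j' → r j' = r j)
    (hr : ∀ j, r j ≤ d) (z : Fin N) (j : J) (hj : kind j ≠ .masked j) (w : List Bool) (n p : ℕ)
    (G : Tables r n) (hG : G j = ∅) :
    (fillTable d kind z j).Runs (evalStore d w n p G 0 false) (2 * repTime n 1 (r j) + 2)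
      ((fillTableStep kind w j (p, G)).map fun y => evalStore d w n y.1 y.2 0 false) := by
  have hstart : ∀ T : Tape r d N → Prop, evalStore d w n p G 0 false =
      fillStore (evalStore d w n 0 G (0 : Fin N → ℤ) false) (Tape.IsCopy j) T
        (p, 0, fun _ => none) := by
    intro T
    rw [← tableTape_empty (a := r j) (n := n), fillStore_evalStore, ← hG, Function.update_eq_self]
  have hrul : ∀ e, (evalStore d w n 0 G (0 : Fin N → ℤ) false).head (.rul e) = 0 ∧
      (evalStore d w n 0 G (0 : Fin N → ℤ) false).tape (.rul e) = ruler n := by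
    intro e
    rw [evalStore_zero_head]
    exact ⟨by simp, rfl⟩
  have hC : ∃ i : Tape r d N, Tape.IsCopy j i := ⟨.tab j fun _ => z, rfl⟩
  have hright : ∀ m : Option Bool, cellModes kind G j = List.replicate (n ^ r j) m →
      (∀ S : Set (Fin (r j) → Fin n), cellList (kind j) S = encRel S) →
      (fillRight (r j) (Tape.IsCopy j) (Tape.IsCopy j) fun _ => m).Runs
        (evalStore d w n p G (0 : Fin N → ℤ) false) (2 * repTime n 1 (r j) + 2)
        ((fillTableStep kind w j (p, G)).map fun y => evalStore d w n y.1 y.2 0 false) := by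
    intro m hm hl
    have h := runs_fillRight n (r j) (evalStore d w n 0 G (0 : Fin N → ℤ) false) (Tape.IsCopy j)
      (Tape.IsCopy j) (fun _ => m) w (fun _ => m) (hr j) (fun _ h => h) (fun h => h) hC
      (fun _ h => h) rfl hrul (fun _ _ => rfl) p
    rw [← hstart] at h
    rw [List.ofFn_const, ← hm, fillings_eq_map kind hmask, Multiset.map_map] at h
    rw [fillTableStep, Multiset.map_map]
    refine (?_ : Frag.Runs _ _ _ _).mono (Nat.le_add_right _ 2)
    convert h using 1
    refine Multiset.map_congr rfl fun S _ => ?_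
    simp only [Function.comp]
    rw [hl, listTape_encRel, fillStore_evalStore]
  unfold fillTable
  split
  · rename_i hk
    exact hright _ (by simp [cellModes, hk]) (by simp [cellList, hk])
  · rename_i hk
    exact hright _ (by simp [cellModes, hk]) (by simp [cellList, hk])
  · rename_i j' hk
    -- The mask is read from a copy of another table, whose head travels with the heads of the table
    -- being filled. Were it the same table, the mask would be overwritten on the way.
    have hne : j' ≠ j := by rintro rfl; exact hj hk
    have h := runs_fillLeft n (r j) (evalStore d w n 0 G (0 : Fin N → ℤ) false) (Tape.IsCopy j)
      (fun i => Tape.IsCopy j i ∨ i = .tab j' fun _ => z)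
      (fun s => some (decide (s (.tab j' fun _ => z) = some true))) w
      (fun h => some (decide (tableTape (G j') h = some true))) (hr j) (fun _ h => Or.inl h)
      (by simp [Tape.IsCopy]) hC (by simp [Tape.IsCopy]) rfl hrul (by
        intro y z'
        have h1 : Tape.tab j' (fun _ => z) ∉ rulers r d N (r j) := by
          intro h
          obtain ⟨e, he⟩ := exists_of_mem_rulers h
          simp at he
        have h2 : ¬ Tape.IsCopy j (Tape.tab j' fun _ => z : Tape r d N) := hne
        simp only [Store.scan, Store.setHeads, h1, if_false, fillStore, h2, or_true, if_true,
          reduceCtorEq]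
        rfl) p
    rw [← hstart] at h
    have hm : cellModes kind G j = ((encRel (G j')).map some).reverse := by
      rw [← List.map_reverse]
      simp [cellModes, hk]
    rw [ofFn_tableTape _ _ (by rw [hmask j j' hk]), ← hm, fillings_eq_map kind hmask,
      Multiset.map_map] at h
    rw [fillTableStep, Multiset.map_map]
    convert h using 1
    refine Multiset.map_congr rfl fun S _ => ?_
    simp only [Function.comp]
    rw [show (cellList (kind j) S).reverse = encRel S by simp [cellList, hk], listTape_encRel,
      fillStore_evalStore]

/-- Fill the tables of a list. -/
@[reducible] noncomputable def fillTables (d : ℕ) (kind : J → Kind J) (z : Fin N) :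
    List J → Frag (Tape r d N) (Option Bool)
  | [] => mv fun _ => .stay
  | j :: l => (fillTable d kind z j).seq (fillTables d kind z l)

/-- A bound for the running time of `fillTables`. -/
def fillTablesTime (r : J → ℕ) (n : ℕ) : List J → ℕ
  | [] => 1
  | j :: l => 2 * repTime n 1 (r j) + 2 + fillTablesTime r n l

/-- The effect of filling the tables of a list. -/
noncomputable def fillTablesStep (kind : J → Kind J) {n : ℕ} (w : List Bool) :
    List J → ℕ × Tables r n → Multiset (ℕ × Tables r n)
  | [], y => {y}
  | j :: l, y => (fillTableStep kind w j y).bind (fillTablesStep kind w l)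

theorem runs_fillTables (kind : J → Kind J) (hmask : ∀ j j', kind j = .masked j' → r j' = r j)
    (hr : ∀ j, r j ≤ d) (z : Fin N) (hself : ∀ j, kind j ≠ .masked j) (w : List Bool) (n : ℕ)
    (l : List J) (hl : l.Nodup) (p : ℕ) (G : Tables r n) (hG : ∀ j ∈ l, G j = ∅) :
    (fillTables d kind z l).Runs (evalStore d w n p G 0 false) (fillTablesTime r n l)
      ((fillTablesStep kind w l (p, G)).map fun y => evalStore d w n y.1 y.2 0 false) := by
  induction l generalizing p G with
  | nil =>
    have h := runs_mv (fun _ => Move.stay) (evalStore d w n p G (0 : Fin N → ℤ) false)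
    have e : ((evalStore d w n p G (0 : Fin N → ℤ) false).shift fun _ => Move.stay.shift) =
        evalStore d w n p G 0 false := by
      simp [Store.shift, Move.shift]
    rw [e] at h
    exact h
  | cons j l ih =>
    rw [List.nodup_cons] at hl
    rw [fillTablesStep, Multiset.map_bind]
    refine (runs_fillTable kind hmask hr z j (hself j) w n p G (hG j (by simp))).seq
      fun y hy => ih hl.2 _ _ fun j' hj' => ?_
    replace hy : y ∈ fillTableStep kind w j (p, G) := hy
    simp only [fillTableStep, Multiset.mem_map] at hy
    obtain ⟨S, -, rfl⟩ := hy
    have hne : j' ≠ j := by rintro rfl; exact hl.1 hj'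
    simp only [Function.update_of_ne hne]
    exact hG j' (by simp [hj'])

end Frag

theorem PolyBdd.fillTablesTime (r : J → ℕ) (l : List J) :
    PolyBdd fun n => Frag.fillTablesTime r n l := by
  induction l with
  | nil => exact const 1
  | cons j l ih =>
    exact (((const 2).mul ((const 1).repTime (r j))).add (const 2)).add ih

/-- The part of the input that table `j` stands for. -/
noncomputable def tableInput (kind : J → Kind J) {n : ℕ} (G : Tables r n) (j : J) : List Bool :=
  readPart (cellModes kind G j) (cellList (kind j) (G j))

/-- The rows of table `j` outside the mask are zero. -/
def MaskOK (kind : J → Kind J) {n : ℕ} (G : Tables r n) (j : J) : Prop :=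
  List.Forall₂ (fun m b => m = some false → b = false) (cellModes kind G j)
    (cellList (kind j) (G j))

/-- Modes are computed from the tables present at the time of filling. By `hl'` and `hself` no mask
is filled later than, or together with, the table that it masks; so the modes agree with those for
the final tables, and the result can be stated for these alone. -/
theorem mem_fillTablesStep (kind : J → Kind J)
    (hmask : ∀ j j', kind j = .masked j' → r j' = r j) (hself : ∀ j, kind j ≠ .masked j)
    {n : ℕ} (w : List Bool) (l : List J) (hl : l.Nodup)
    (hl' : l.Pairwise fun j j' => kind j ≠ .masked j') (p p' : ℕ) (G G' : Tables r n) :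
    (p', G') ∈ Frag.fillTablesStep kind w l (p, G) ↔
      (∀ j, j ∉ l → G' j = G j) ∧ (∀ j ∈ l, MaskOK kind G' j) ∧
        l.flatMap (tableInput kind G') <+: w.drop p ∧
          p' = p + (l.flatMap (tableInput kind G')).length := by
  induction l generalizing p G with
  | nil =>
    simp only [Frag.fillTablesStep, Multiset.mem_singleton, Prod.mk.injEq, List.not_mem_nil,
      not_false_eq_true, forall_const, false_imp_iff, implies_true, List.flatMap_nil,
      List.nil_prefix, List.length_nil, true_and, add_zero]
    rw [and_comm, funext_iff]
  | cons j l ih =>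
    rw [List.nodup_cons] at hl
    rw [List.pairwise_cons] at hl'
    -- Filling `j` and the tables after it does not change the mask of `j`.
    have hmodes : ∀ G'' : Tables r n, (∀ j', j' ∉ l → j' ≠ j → G'' j' = G j') →
        cellModes kind G j = cellModes kind G'' j := by
      intro G'' h
      unfold cellModes
      split
      · rfl
      · rfl
      · rename_i j' hk
        rw [h j' (fun hj' => hl'.1 j' hj' hk) (by rintro rfl; exact hself _ hk)]
    have hlen : (tableInput kind G' j).length = ((cellModes kind G' j).map modeRead).sum := by
      rw [tableInput, readPart_length]
      rw [cellModes_length kind hmask, cellList_length]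
    simp only [Frag.fillTablesStep, Multiset.mem_bind, fillTableStep, Multiset.mem_map,
      Finset.mem_val, Finset.mem_filter, Finset.mem_univ, true_and, mem_fillings, List.flatMap_cons]
    rw [prefix_append_drop, List.length_append]
    constructor
    · rintro ⟨_, ⟨S, ⟨h1, h2⟩, rfl⟩, h3⟩
      obtain ⟨h4, h5, h6, h7⟩ := (ih hl.2 hl'.2 _ _).1 h3
      have hS : G' j = S := by
        have := h4 j hl.1
        simpa using this
      have hG' : ∀ j', j' ∉ l → j' ≠ j → G' j' = G j' := by
        intro j' hj' hne
        have := h4 j' hj'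
        rwa [Function.update_of_ne hne] at this
      have hm := hmodes G' hG'
      rw [hm, ← hS] at h1 h2
      rw [hm, ← hlen] at h6 h7
      refine ⟨?_, ?_, ⟨h2, h6⟩, by rw [h7, add_assoc]⟩
      · intro j' hj'
        rw [List.mem_cons, not_or] at hj'
        exact hG' j' hj'.2 hj'.1
      · intro j' hj'
        rcases List.mem_cons.1 hj' with rfl | hj'
        · exact h1
        · exact h5 j' hj'
    · rintro ⟨h1, h2, ⟨h3, h4⟩, h5⟩
      have hm := hmodes G' fun j' hj' hne => h1 j' (by simp [hj', hne])
      refine ⟨_, ⟨G' j, ⟨?_, ?_⟩, rfl⟩, (ih hl.2 hl'.2 _ _).2 ⟨?_, ?_, ?_, ?_⟩⟩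
      · rw [hm]
        exact h2 j (by simp)
      · rw [hm]
        exact h3
      · intro j' hj'
        by_cases hne : j' = j
        · subst hne; simp
        · rw [Function.update_of_ne hne]
          exact h1 j' (by simp [hj', hne])
      · exact fun j' hj' => h2 j' (by simp [hj'])
      · rw [hm, ← hlen]
        exact h4
      · rw [hm, ← hlen, h5, add_assoc]

/-- No table is written twice, so every choice can be recovered from the final tables. -/
theorem nodup_fillTablesStep (kind : J → Kind J)
    (hmask : ∀ j j', kind j = .masked j' → r j' = r j) (hself : ∀ j, kind j ≠ .masked j)
    {n : ℕ} (w : List Bool) (l : List J) (hl : l.Nodup)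
    (hl' : l.Pairwise fun j j' => kind j ≠ .masked j') (y : ℕ × Tables r n) :
    (Frag.fillTablesStep kind w l y).Nodup := by
  induction l generalizing y with
  | nil => simp [Frag.fillTablesStep]
  | cons j l ih =>
    rw [List.nodup_cons] at hl
    rw [List.pairwise_cons] at hl'
    refine nodup_bind_of ?_ (fun y' _ => ih hl.2 hl'.2 y') ?_
    · refine (Finset.nodup _).map fun S S' h => ?_
      simpa using congrFun (congrArg Prod.snd h) j
    · intro a ha b hb x hxa hxb
      simp only [fillTableStep, Multiset.mem_map] at ha hb
      obtain ⟨S, -, rfl⟩ := ha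
      obtain ⟨S', -, rfl⟩ := hb
      have h1 := ((mem_fillTablesStep kind hmask hself w l hl.2 hl'.2 _ _ _ _).1 hxa).1 j hl.1
      have h2 := ((mem_fillTablesStep kind hmask hself w l hl.2 hl'.2 _ _ _ _).1 hxb).1 j hl.1
      rw [h1] at h2
      simp only [Function.update_self] at h2
      rw [h2]

end Tape

/-! ### Guessing the size of the universe -/

section Tape

variable {J : Type} {r : J → ℕ} {d N : ℕ}

/-- The store at the beginning of a computation. -/
noncomputable def startStore (r : J → ℕ) (d N : ℕ) (w : List Bool) :
    Store (Tape r d N) (Option Bool) where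
  head := fun _ => 0
  tape := fun i => if i = .inp then inputTape w else fun _ => none

/-- The movements while guessing the size of the universe. -/
def sizeMove : Tape r d N → Move
  | .inp => .right
  | .rul _ => .right
  | .var _ => .right
  | .le _ _ => .left
  | _ => .stay

/-- The store while guessing the size of the universe. -/
noncomputable def sizeStore (r : J → ℕ) (d N : ℕ) (w : List Bool) (k : ℕ) (b : Bool) :
    Store (Tape r d N) (Option Bool) where
  head := fun i => k * (sizeMove i).shift
  tape := fun i => match i with
    | .inp => inputTape w
    | .flag => marks fun z => z = 0 ∧ b
    | .rul _ => ruler k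
    | .var _ => ruler k
    | .tab _ _ => fun _ => none
    | .le _ _ => marks fun z => -(k : ℤ) < z ∧ z ≤ 0

namespace Frag

/-- Write one more mark on all rulers, and guess whether to go on. -/
@[reducible] noncomputable def sizeBody (r : J → ℕ) (d N : ℕ) :
    Frag (Tape r d N) (Option Bool) :=
  act fun s => if s .inp = none then ∅ else
    (Finset.univ : Finset Bool).image fun b => ((fun i => match i with
      | .inp => s .inp
      | .flag => bitSym b
      | .tab j v => s (.tab j v)
      | _ => some true), sizeMove)

theorem sizeStore_scan_inp (w : List Bool) (k : ℕ) (b : Bool) :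
    (sizeStore r d N w k b).scan .inp = w[k]? := by
  simp [Store.scan, sizeStore, sizeMove, Move.shift, inputTape]

theorem runs_sizeBody_end (w : List Bool) (b : Bool) :
    (sizeBody r d N).Runs (sizeStore r d N w w.length b) 1 0 := by
  have h := runs_act (fun s : Tape r d N → Option Bool => if s .inp = none then ∅ else
    (Finset.univ : Finset Bool).image fun b => (((fun i => match i with
      | .inp => s .inp
      | .flag => bitSym b
      | .tab j v => s (.tab j v)
      | _ => some true), sizeMove) : Act (Tape r d N) (Option Bool)))
    (sizeStore r d N w w.length b)
  simp only [sizeStore_scan_inp, List.getElem?_length, if_true] at h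
  exact h

theorem runs_sizeBody (w : List Bool) (k : ℕ) (hk : k < w.length) (b : Bool) :
    (sizeBody r d N).Runs (sizeStore r d N w k b) 1
      ((Finset.univ : Finset Bool).val.map fun b => sizeStore r d N w (k + 1) b) := by
  have h := runs_act (fun s : Tape r d N → Option Bool => if s .inp = none then ∅ else
    (Finset.univ : Finset Bool).image fun b => (((fun i => match i with
      | .inp => s .inp
      | .flag => bitSym b
      | .tab j v => s (.tab j v)
      | _ => some true), sizeMove) : Act (Tape r d N) (Option Bool)))
    (sizeStore r d N w k b)
  have hne : ¬ w[k]? = none := by simp [hk]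
  simp only [sizeStore_scan_inp, hne, if_false] at h
  rw [Finset.image_val_of_injOn, Multiset.map_map] at h
  · convert h using 1
    refine Multiset.map_congr rfl fun b' _ => ?_
    simp only [Function.comp]
    ext1
    · funext i
      simp only [sizeStore, Store.after]
      push_cast
      ring
    · have hrul : ∀ i : Tape r d N, sizeMove i = .right →
          Function.update (ruler k) ((k : ℤ) * (sizeMove i).shift) (some true) = ruler (k + 1) := by
        intro i hi
        funext z
        simp only [hi, Move.shift, mul_one, Function.update_apply]
        by_cases hz : z = k
        · simp [hz, ruler, marks]
        · simp only [hz, if_false, ruler, marks]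
          push_cast
          split_ifs <;> first | rfl | (exfalso; omega)
      funext i
      simp only [sizeStore, Store.after]
      cases i with
      | inp =>
        have e : inputTape w ((k : ℤ) * (sizeMove (.inp : Tape r d N)).shift) = w[k]? := by
          simp [sizeMove, Move.shift, inputTape]
        rw [← e, Function.update_eq_self]
      | flag =>
        funext z
        simp only [sizeMove, Move.shift, mul_zero, Function.update_apply]
        by_cases hz : z = 0 <;> cases b' <;> simp [hz, marks, bitSym]
      | rul e => exact (hrul _ rfl).symm
      | var m => exact (hrul _ rfl).symm
      | tab j v =>
        simp only [Store.scan]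
        exact (Function.update_eq_self _ _).symm
      | le x y =>
        funext z
        simp only [sizeMove, Move.shift, mul_neg, mul_one, Function.update_apply]
        by_cases hz : z = -(k : ℤ)
        · simp [hz, marks]
        · simp only [hz, if_false, marks]
          push_cast
          split_ifs <;> first | rfl | (exfalso; omega)
  · intro b _ b' _ hbb
    have := congrFun (congrArg Prod.fst hbb) .flag
    revert this
    cases b <;> cases b' <;> simp [bitSym]

/-- Guess the size of the universe. -/
@[reducible] noncomputable def guessSize (r : J → ℕ) (d N : ℕ) :
    Frag (Tape r d N) (Option Bool) :=
  (setFlag r d N true).seq ((rpt (fun s => s .flag = some true) (sizeBody r d N)).seq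
    ((mv fun i => (sizeMove i).neg).seq ((rpt (fun s => s .inp ≠ none)
      (mv fun i => (sizeMove i).neg)).seq (mv sizeMove))))

theorem sizeStore_scan_flag (w : List Bool) (k : ℕ) (b : Bool) :
    (sizeStore r d N w k b).scan .flag = some true ↔ b = true := by
  simp [Store.scan, sizeStore, sizeMove, Move.shift, marks_eq_some]

/-- With `k` marks written and the flag set, at least one more mark must follow, so the possible
sizes start at `k + 1`. A branch that still wants to go on at the end of the input dies in
`sizeBody`, which keeps the size at most `|w|`. -/
theorem runs_rpt_sizeBody (w : List Bool) (c k : ℕ) (hc : k + c = w.length) :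
    (rpt (fun s => s .flag = some true) (sizeBody r d N)).Runs (sizeStore r d N w k true)
      (2 * c + 2)
      ((List.range' (k + 1) c : Multiset ℕ).map fun n => sizeStore r d N w n false) := by
  induction c generalizing k with
  | zero =>
    have h := runs_sizeBody_end (r := r) (d := d) (N := N) w true
    rw [← hc, Nat.add_zero] at h
    have h' := Runs.rpt_pos (X := Unit) (P := fun s => s .flag = some true) (μ := 0)
      (st := fun _ => sizeStore r d N w k true) (ν := fun _ => 0) (t' := 0)
      (by simp [sizeStore_scan_flag]) h (by simp)
    simpa using h'
  | succ c ih =>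
    have h' := Runs.rpt_pos (P := fun s => s .flag = some true)
      (by simp [sizeStore_scan_flag])
      (runs_sizeBody (r := r) (d := d) (N := N) w k (by omega) true) (t' := 2 * c + 2)
      (ν := fun b => if b then (List.range' (k + 2) c : Multiset ℕ).map fun n =>
        sizeStore r d N w n false else {sizeStore r d N w (k + 1) false}) (by
        intro b _
        cases b
        · refine (runs_rpt_neg ?_).mono (by omega)
          simp [sizeStore_scan_flag]
        · exact ih (k + 1) (by omega))
    refine (?_ : Frag.Runs _ _ _ _).mono (show 1 + (2 * c + 2) + 1 ≤ _ by omega)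
    convert h' using 1
    rw [List.range'_succ, ← Multiset.cons_coe, Multiset.map_cons, ← Multiset.singleton_add,
      add_comm]
    change _ = Multiset.bind (true ::ₘ false ::ₘ 0) _
    rw [Multiset.cons_bind, Multiset.cons_bind, Multiset.zero_bind, add_zero]
    rfl

/-- All moving heads have travelled in step with the input head, so undoing the movements until the
input head is back on cell `0` brings all of them back. The blank cell `-1` to the left of the input
signals when to stop. -/
theorem runs_guessSize (w : List Bool) :
    (guessSize r d N).Runs (startStore r d N w) (4 * w.length + 6)
      ((List.range' 1 w.length : Multiset ℕ).map fun n =>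
        evalStore d w n 0 (fun _ => ∅) 0 false) := by
  have h1 := runs_act (fun s : Tape r d N → Option Bool => ({(Function.update s .flag
    (if true then some true else none), fun _ => .stay)} : Finset (Act _ _)))
    (startStore r d N w)
  have e1 : (startStore r d N w).after (Function.update (startStore r d N w).scan .flag
      (if true then some true else none), fun _ => .stay) = sizeStore r d N w 0 true := by
    ext1
    · simp [Store.after, startStore, sizeStore, Move.shift]
    · have hm : ∀ S : ℤ → Prop, (∀ z, ¬ S z) → marks S = fun _ => none := by
        intro S hS
        funext z
        simp [marks, hS]
      funext i
      by_cases hi : i = .flag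
      · subst hi
        funext z
        simp only [Store.after, startStore, sizeStore, Function.update_apply]
        by_cases hz : z = 0 <;> simp [hz, marks]
      · simp only [Store.after, Function.update_of_ne hi, Store.scan, Function.update_eq_self]
        cases i with
        | inp => simp [startStore, sizeStore]
        | flag => exact absurd rfl hi
        | rul e =>
          refine Eq.trans (if_neg (by simp)) (hm _ ?_).symm
          intro z; push_cast; omega
        | var m =>
          refine Eq.trans (if_neg (by simp)) (hm _ ?_).symm
          intro z; push_cast; omega
        | tab j v => exact if_neg (by simp)
        | le a b =>
          refine Eq.trans (if_neg (by simp)) (hm _ ?_).symm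
          intro z; push_cast; omega
  rw [Finset.singleton_val, Multiset.map_singleton, e1] at h1
  have h2 := runs_rpt_sizeBody (r := r) (d := d) (N := N) w w.length 0 (by simp)
  have h3 : ∀ n ∈ (List.range' 1 w.length : Multiset ℕ),
      ((mv fun i => (sizeMove i).neg).seq ((rpt (fun s => s .inp ≠ none)
        (mv fun i => (sizeMove i).neg)).seq (mv sizeMove))).Runs (sizeStore r d N w n false)
        (2 * w.length + 3) {evalStore d w n 0 (fun _ => ∅) 0 false} := by
    intro n hn
    have hn : 1 ≤ n ∧ n < 1 + w.length := by simpa using hn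
    have g1 := runs_mv (fun i => (sizeMove i).neg) (sizeStore r d N w n false)
    have sc : ∀ i : ℕ, (((sizeStore r d N w n false).shift fun i => (sizeMove i).neg.shift).shift
        fun j => (i : ℤ) * (sizeMove j).neg.shift).scan .inp = inputTape w (n - 1 - i) := by
      intro i
      simp only [Store.scan, Store.shift, sizeStore, sizeMove, Move.neg, Move.shift]
      congr 1
      ring
    have g2 := runs_rpt_mv (fun s => s .inp ≠ none) (fun i : Tape r d N => (sizeMove i).neg) n
      ((sizeStore r d N w n false).shift fun i => (sizeMove i).neg.shift) (by
        intro i hi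
        rw [sc, inputTape, if_pos (by omega)]
        simp only [ne_eq, List.getElem?_eq_none_iff]
        omega) (by
        rw [sc, inputTape, if_neg (by omega)]
        simp)
    have g3 := runs_mv sizeMove (((sizeStore r d N w n false).shift fun i =>
      (sizeMove i).neg.shift).shift fun j => (n : ℤ) * (sizeMove j).neg.shift)
    have e2 : ((((sizeStore r d N w n false).shift fun i =>
        (sizeMove i).neg.shift).shift fun j => (n : ℤ) * (sizeMove j).neg.shift).shift
        fun i => (sizeMove i).shift) = evalStore d w n 0 (fun _ => ∅) 0 false := by
      ext1
      · funext i
        rw [evalStore_zero_head]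
        simp only [Store.shift, sizeStore, Move.shift_neg]
        rw [Nat.cast_zero, ite_self]
        ring
      · funext i
        simp only [Store.shift]
        cases i with
        | tab j v => exact tableTape_empty.symm
        | _ => rfl
    rw [e2] at g3
    exact (g1.seq_single (g2.seq_single g3)).mono (by omega)
  have h4 := h2.seq h3
  rw [Multiset.bind_singleton] at h4
  exact (h1.seq_single h4).mono (by omega)

end Frag

/-! ### The machine -/

/-- Leaving the fragment means accepting, so each outcome is one accepting path. The value at the
empty word is prescribed independently: seeing a blank at the start, the machine jumps to one of
`c₀` accepting states, and different states make different paths. -/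
theorem exists_NTM_of_runs [Finite J] (F : Frag (Tape r d N) (Option Bool)) (t : ℕ → ℕ)
    (ht : PolyBdd t) (μ : List Bool → Multiset (Store (Tape r d N) (Option Bool))) (c₀ : ℕ)
    (hF : ∀ w, w ≠ [] → F.Runs (startStore r d N w) (t w.length) (μ w)) :
    ∃ M : NTM, M.PolyTime ∧ {p | M.IsAcceptingPath [] p}.encard = c₀ ∧
      ∀ w, w ≠ [] → {p | M.IsAcceptingPath w p}.encard = Multiset.card (μ w) := by
  have := F.fin
  let δ : Trans (Bool ⊕ F.St ⊕ Fin c₀) (Tape r d N) (Option Bool) := fun q s => match q with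
    | .inl false => if s .inp = none then {a | ∃ i, a = (.inr (.inr i), s, fun _ => .stay)} else
        {(.inr (.inl F.entry), s, fun _ => .stay)}
    | .inl true => ∅
    | .inr (.inl y) => (fun a => (a.1.elim (.inl true) fun y => .inr (.inl y), a.2)) '' F.step y s
    | .inr (.inr _) => ∅
  let acc : Set (Bool ⊕ F.St ⊕ Fin c₀) := {q | q = .inl true ∨ ∃ i, q = .inr (.inr i)}
  -- The tapes are numbered so that the input tape becomes tape `0`.
  obtain ⟨k, e, he⟩ : ∃ (k : ℕ) (e : Tape r d N ≃ Fin (k + 1)), e .inp = 0 := by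
    obtain ⟨k, ⟨e⟩⟩ := Finite.exists_equiv_fin (Tape r d N)
    obtain ⟨k, rfl⟩ : ∃ k', k = k' + 1 := ⟨k - 1, by have := (e .inp).2; omega⟩
    exact ⟨k, e.trans (Equiv.swap (e .inp) 0), by simp⟩
  have hinit : ∀ w, (mkNTM e δ (.inl false) acc).init w =
      mkCfg e δ (.inl false) acc (.inl false) (startStore r d N w) := by
    intro w
    ext1
    · rfl
    · rfl
    · funext i z
      have h0 : e.symm i = .inp ↔ i = 0 := by
        rw [Equiv.symm_apply_eq, he]
      simp only [NTM.init, mkCfg, startStore, h0]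
      by_cases hi : i = 0
      · by_cases hz : 0 ≤ z
        · simp only [hi, hz, if_true, true_and, inputTape]
          cases w[z.toNat]? <;> rfl
        · simp [hi, hz, inputTape]
      · simp [hi]
  have hin : F.In δ acc (fun y => .inr (.inl y)) (.inl true) := ⟨fun _ _ => rfl, by simp [acc]⟩
  have hscan : ∀ w : List Bool, (startStore r d N w).scan .inp = w[0]? := by
    intro w
    simp [Store.scan, startStore, inputTape]
  have hc₀ : Counts δ acc (.inl false) (startStore r d N []) 1 c₀ := by
    have hδ : δ (.inl false) (startStore r d N []).scan =
        ((Finset.univ : Finset (Fin c₀)).image fun i => ((.inr (.inr i) : Bool ⊕ F.St ⊕ Fin c₀),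
          ((startStore r d N []).scan, fun _ => Move.stay)) : Finset (_ × Act _ _)) := by
      ext a
      simp [δ, hscan, eq_comm]
    rcases Nat.eq_zero_or_pos c₀ with h0 | h0
    · subst h0
      have := Counts.halt (acc := acc) (.inl false) (startStore r d N []) 1 (hδ.trans (by simp))
      simpa [acc] using this
    · have := Counts.step (δ := δ) (acc := acc) (.inl false) (startStore r d N []) 0 _
        (fun _ => 1) hδ ⟨_, Finset.mem_image_of_mem _ (Finset.mem_univ (⟨0, h0⟩ : Fin c₀))⟩ (by
          intro a ha
          obtain ⟨i, -, rfl⟩ := Finset.mem_image.1 ha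
          have h := Counts.halt (δ := δ) (acc := acc) (.inr (.inr i))
            ((startStore r d N []).after ((startStore r d N []).scan, fun _ => Move.stay)) 0 rfl
          have hacc : (.inr (.inr i) : Bool ⊕ F.St ⊕ Fin c₀) ∈ acc := Or.inr ⟨i, rfl⟩
          rwa [if_pos hacc] at h)
      rw [Finset.sum_const, Finset.card_image_of_injective _ (by
        intro i i' h
        simpa using h)] at this
      simpa using this
  have hw : ∀ w, w ≠ [] → Counts δ acc (.inl false) (startStore r d N w) (t w.length + 1)
      (Multiset.card (μ w)) := by
    intro w hw
    have h1 := hF w hw _ δ acc _ _ hin 0 (fun _ => 1) (by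
      intro s' _
      have h := Counts.halt (δ := δ) (acc := acc) (.inl true) s' 0 rfl
      have hacc : (.inl true : Bool ⊕ F.St ⊕ Fin c₀) ∈ acc := Or.inl rfl
      rwa [if_pos hacc] at h)
    rw [zero_add, Multiset.map_const', Multiset.sum_replicate, smul_eq_mul, mul_one] at h1
    refine Frag.counts_single ?_ h1
    have : w[0]? ≠ none := by simpa using hw
    simp [δ, hscan, this]
  refine ⟨mkNTM e δ (.inl false) acc, ?_, ?_, ?_⟩
  · obtain ⟨p, hp⟩ := ht
    refine ⟨p + 1, fun w c hc => ?_⟩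
    rw [NTM.IsComputation, hinit] at hc
    rw [Polynomial.eval_add, Polynomial.eval_one]
    by_cases hw' : w = []
    · subst hw'
      have := (hc₀.mkNTM e δ (.inl false) acc).2 c hc
      omega
    · exact ((hw w hw').mkNTM e δ (.inl false) acc).2 c hc |>.trans (Nat.succ_le_succ (hp _))
  · have := (hc₀.mkNTM e δ (.inl false) acc).1
    rwa [← hinit] at this
  · intro w hw'
    have := ((hw w hw').mkNTM e δ (.inl false) acc).1
    rwa [← hinit] at this

/-- The number of tables that satisfy a formula, and that are compatible with the input, is
the number of accepting paths of a polynomial-time machine. -/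
theorem exists_NTM_count_tables [Finite J] (kind : J → Kind J)
    (hmask : ∀ j j', kind j = .masked j' → r j' = r j) (hself : ∀ j, kind j ≠ .masked j)
    (l : List J) (hl : l.Nodup) (hmem : ∀ j, j ∈ l)
    (hl' : l.Pairwise fun j j' => kind j ≠ .masked j') (φ : (JLang r).Formula (Fin 0)) (c₀ : ℕ) :
    ∃ M : NTM, M.PolyTime ∧ {p | M.IsAcceptingPath [] p}.encard = c₀ ∧
      ∀ w, w ≠ [] → {p | M.IsAcceptingPath w p}.encard =
        {q : Σ n, Tables r n | 1 ≤ q.1 ∧ q.1 ≤ w.length ∧ w = l.flatMap (tableInput kind q.2) ∧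
          (∀ j, MaskOK kind q.2 j) ∧ JRealize q.2 φ default default}.encard := by
  obtain ⟨d, hd, hr⟩ : ∃ d, 0 < d ∧ ∀ j, r j ≤ d := by
    obtain ⟨d, hd⟩ := (Set.finite_range r).bddAbove
    exact ⟨d + 1, Nat.succ_pos d, fun j => (hd ⟨j, rfl⟩).trans (Nat.le_succ d)⟩
  obtain ⟨N, hN0, hN⟩ : ∃ N, 0 < N ∧ depth φ ≤ N := ⟨depth φ + 1, by omega, by omega⟩
  obtain ⟨f, t, ht, hf⟩ := exists_runs_eval (N := N) hd hr φ hN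
  let die : Frag (Tape r d N) (Option Bool) := Frag.act fun _ => ∅
  have hdie : ∀ s, die.Runs s 1 0 := fun s => Frag.runs_act (fun _ => ∅) s
  -- A blank under the input head means that the tables have used up the whole word; together with
  -- the true flag this is the condition for acceptance.
  let check : Frag (Tape r d N) (Option Bool) := Frag.ite (fun s => s .inp = none)
    (f.seq (Frag.ite (fun s => s .flag = some true) (Frag.mv fun _ => .stay) die)) die
  have hcheck : ∀ (w : List Bool) (n : ℕ) (y : ℕ × Tables r n), check.Runs
      (evalStore d w n y.1 y.2 (0 : Fin N → ℤ) false) (t n + 3)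
      (if w.length ≤ y.1 ∧ JRealize y.2 φ default default then
        {evalStore d w n y.1 y.2 0 true} else 0) := by
    intro w n y
    have hinp : (evalStore d w n y.1 y.2 (0 : Fin N → ℤ) false).scan .inp = none ↔
        w.length ≤ y.1 := by
      simp [Store.scan, evalStore, headPos_inp, inputTape]
    by_cases h1 : w.length ≤ y.1
    · have hz : extendZero N (default : Fin 0 → Fin n) = 0 := by
        funext i
        simp [extendZero]
      have h2 := hf w n y.1 y.2 default default false
      rw [hz] at h2
      have h3 : ∀ b, (Frag.ite (fun s => s .flag = some true) (Frag.mv fun _ => .stay) die).Runs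
          (evalStore d w n y.1 y.2 (0 : Fin N → ℤ) b) 2
          (if b then {evalStore d w n y.1 y.2 0 true} else 0) := by
        intro b
        cases b
        · refine Frag.Runs.ite_neg ?_ (hdie _)
          simp [scan_flag]
        · have h4 := Frag.runs_mv (fun _ => Move.stay)
            (evalStore d w n y.1 y.2 (0 : Fin N → ℤ) true)
          have e : ((evalStore d w n y.1 y.2 (0 : Fin N → ℤ) true).shift fun _ =>
              Move.stay.shift) = evalStore d w n y.1 y.2 0 true := by
            simp [Store.shift, Move.shift]
          rw [e] at h4
          refine Frag.Runs.ite_pos ?_ h4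
          simp [scan_flag]
      have h5 := (h2.seq_single (h3 _)).mono (t' := t n + 2) le_rfl
      simp only [h1, true_and]
      simp only [decide_eq_true_eq] at h5
      exact Frag.Runs.ite_pos (hinp.2 h1) h5
    · simp only [h1, false_and, if_false]
      exact (Frag.Runs.ite_neg (mt hinp.1 h1) (hdie _)).mono (by omega)
  let ν : List Bool → (n : ℕ) → Multiset (ℕ × Tables r n) := fun w n =>
    (Frag.fillTablesStep kind w l (0, fun _ => ∅)).filter fun y =>
      w.length ≤ y.1 ∧ JRealize y.2 φ default default
  have hfilter : ∀ {α β : Type} (s : Multiset α) (P : α → Prop) [DecidablePred P] (g : α → β),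
      (s.bind fun y => if P y then {g y} else 0) = (s.filter P).map g := by
    intro α β s P _ g
    induction s using Multiset.induction_on with
    | empty => simp
    | cons a s ih => by_cases h : P a <;> simp [h, ih]
  let F : Frag (Tape r d N) (Option Bool) := (Frag.guessSize r d N).seq
    ((Frag.fillTables d kind ⟨0, hN0⟩ l).seq check)
  obtain ⟨pt, hpt⟩ := (((PolyBdd.fillTablesTime r l).add (ht.add (.const 3))))
  have hF : ∀ w, w ≠ [] → F.Runs (startStore r d N w)
      (4 * w.length + 6 + pt.eval w.length)
      ((List.range' 1 w.length : Multiset ℕ).bind fun n => (ν w n).map fun y =>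
        evalStore d w n y.1 y.2 0 true) := by
    intro w _
    refine (Frag.runs_guessSize w).seq fun n hn => ?_
    have hn : 1 ≤ n ∧ n < 1 + w.length := by simpa using hn
    have h1 := (Frag.runs_fillTables (d := d) (N := N) kind hmask hr ⟨0, hN0⟩ hself w n l hl 0
      (fun _ => ∅) fun _ _ => rfl).seq fun y _ => hcheck w n y
    rw [hfilter] at h1
    exact h1.mono ((hpt n).trans (polynomial_eval_mono pt (by omega)))
  obtain ⟨M, hM, hM0, hM1⟩ := exists_NTM_of_runs F _
    ((((PolyBdd.const 4).mul .id).add (.const 6)).add ⟨pt, fun _ => le_rfl⟩) _ c₀ hF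
  refine ⟨M, hM, hM0, fun w hw => ?_⟩
  rw [hM1 w hw]
  have hnd : ∀ n, (Frag.fillTablesStep kind w l ((0, fun _ => ∅) : ℕ × Tables r n)).Nodup :=
    fun n => nodup_fillTablesStep kind hmask hself w l hl hl' _
  have hνmem : ∀ n (y : ℕ × Tables r n), y ∈ ν w n ↔ y.1 = w.length ∧
      (∀ j, MaskOK kind y.2 j) ∧ w = l.flatMap (tableInput kind y.2) ∧
        JRealize y.2 φ default default := by
    rintro n ⟨p, G⟩
    simp only [ν, Multiset.mem_filter]
    rw [mem_fillTablesStep kind hmask hself w l hl hl']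
    simp only [hmem, not_true_eq_false, false_imp_iff, implies_true, forall_const, true_and,
      List.drop_zero, zero_add]
    constructor
    · rintro ⟨⟨h1, h2, h3⟩, h4, h5⟩
      have h6 := h2.length_le
      have h7 := h2.eq_of_length_le (by omega)
      exact ⟨by omega, h1, h7.symm, h5⟩
    · rintro ⟨h1, h2, h3, h4⟩
      rw [← h3]
      exact ⟨⟨h2, List.prefix_rfl, h1⟩, h1.ge, h4⟩
  have hset : {q : Σ n, Tables r n | 1 ≤ q.1 ∧ q.1 ≤ w.length ∧
      w = l.flatMap (tableInput kind q.2) ∧ (∀ j, MaskOK kind q.2 j) ∧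
        JRealize q.2 φ default default} =
      ((List.range' 1 w.length : Multiset ℕ).bind fun n => (ν w n).map fun y =>
        (⟨n, y.2⟩ : Σ n, Tables r n)).toFinset := by
    ext ⟨n, G⟩
    simp only [Set.mem_ofPred_eq, Finset.mem_coe, Multiset.mem_toFinset, Multiset.mem_bind,
      Multiset.mem_map, Multiset.mem_coe, List.mem_range'_1, hνmem]
    constructor
    · rintro ⟨h1, h2, h3, h4, h5⟩
      exact ⟨n, ⟨h1, by omega⟩, (w.length, G), ⟨rfl, h4, h3, h5⟩, rfl⟩
    · rintro ⟨n', hn', ⟨p, G'⟩, ⟨h1, h2, h3, h4⟩, h⟩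
      cases h
      exact ⟨hn'.1, by omega, h3, h2, h4⟩
  have hnodup : ((List.range' 1 w.length : Multiset ℕ).bind fun n => (ν w n).map fun y =>
      (⟨n, y.2⟩ : Σ n, Tables r n)).Nodup := by
    refine nodup_bind_of (by simpa using List.nodup_range') (fun n _ => ?_) ?_
    -- Forgetting the input position loses nothing, because on surviving branches it equals `|w|`.
    · refine Multiset.Nodup.map_on ?_ ((hnd n).filter _)
      intro y hy y' hy' h
      refine Prod.ext ?_ ?_
      · rw [((hνmem n y).1 hy).1, ((hνmem n y').1 hy').1]
      · simpa using h
    · intro n _ n' _ x hx hx'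
      obtain ⟨y, -, rfl⟩ := Multiset.mem_map.1 hx
      obtain ⟨y', -, h⟩ := Multiset.mem_map.1 hx'
      exact (congrArg Sigma.fst h).symm
  rw [hset, Set.encard_coe_eq_coe_finsetCard, Multiset.toFinset_card_of_nodup hnodup]
  simp [Multiset.card_bind, Function.comp_def]

end Tape

/-! ### Uniform definability over a family of structures -/

/-- A family of structures. -/
structure Family (L : FirstOrder.Language.{0, 0}) where
  Inst : Type
  M : Inst → Type
  str : ∀ I, L.Structure (M I)

/-- A property of the members of a family and of tuples of elements is definable by one formula. -/
def UDef {L : FirstOrder.Language.{0, 0}} (K : Family L) {α : Type} (P : ∀ I, (α → K.M I) → Prop) : Prop :=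
  ∃ φ : L.Formula α, ∀ I v, @FirstOrder.Language.Formula.Realize L (K.M I) (K.str I) α φ v ↔ P I v

namespace UDef

variable {L : FirstOrder.Language.{0, 0}} {K : Family L} {α β : Type} {P Q : ∀ I, (α → K.M I) → Prop}

theorem congr (h : UDef K P) (hPQ : ∀ I v, P I v ↔ Q I v) : UDef K Q :=
  Exists.imp (fun _ h I v => (h I v).trans (hPQ I v)) h

protected theorem false : UDef K fun _ (_ : α → _) => False :=
  ⟨⊥, fun _ _ => Iff.rfl⟩

protected theorem imp (hP : UDef K P) (hQ : UDef K Q) : UDef K fun I v => P I v → Q I v := by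
  obtain ⟨φ, hφ⟩ := hP
  obtain ⟨ψ, hψ⟩ := hQ
  refine ⟨φ.imp ψ, fun I v => ?_⟩
  let := K.str I
  rw [Language.Formula.realize_imp, hφ, hψ]

protected theorem not (hP : UDef K P) : UDef K fun I v => ¬ P I v := hP.imp .false

protected theorem true : UDef K fun _ (_ : α → _) => True :=
  UDef.false.not.congr fun _ _ => not_false_iff

protected theorem const (p : Prop) : UDef K fun _ (_ : α → _) => p := by
  by_cases hp : p
  · exact UDef.true.congr fun _ _ => by simp [hp]
  · exact UDef.false.congr fun _ _ => by simp [hp]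

protected theorem and (hP : UDef K P) (hQ : UDef K Q) : UDef K fun I v => P I v ∧ Q I v :=
  (hP.imp hQ.not).not.congr fun _ _ => by tauto

protected theorem or (hP : UDef K P) (hQ : UDef K Q) : UDef K fun I v => P I v ∨ Q I v :=
  (hP.not.imp hQ).congr fun _ _ => by tauto

protected theorem iff (hP : UDef K P) (hQ : UDef K Q) : UDef K fun I v => P I v ↔ Q I v :=
  ((hP.imp hQ).and (hQ.imp hP)).congr fun _ _ => by tauto

/-- Renaming of variables. -/
theorem comp (hP : UDef K P) (g : α → β) : UDef K fun I v => P I fun a => v (g a) := by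
  obtain ⟨φ, hφ⟩ := hP
  refine ⟨φ.relabel g, fun I v => ?_⟩
  let := K.str I
  rw [Language.Formula.realize_relabel, hφ]
  rfl

/-- Conjunction over a finite type. -/
theorem forall_finite {ι : Type} [Finite ι] {P : ι → ∀ I, (α → K.M I) → Prop}
    (hP : ∀ i, UDef K (P i)) : UDef K fun I v => ∀ i, P i I v := by
  choose φ hφ using hP
  refine ⟨Language.BoundedFormula.iInf φ, fun I v => ?_⟩
  let := K.str I
  rw [Language.Formula.Realize, Language.BoundedFormula.realize_iInf]
  exact forall_congr' fun i => hφ i I v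

/-- Disjunction over a finite type. -/
theorem exists_finite {ι : Type} [Finite ι] {P : ι → ∀ I, (α → K.M I) → Prop}
    (hP : ∀ i, UDef K (P i)) : UDef K fun I v => ∃ i, P i I v :=
  (forall_finite fun i => (hP i).not).not.congr fun _ _ => by push Not; rfl

/-- Universal quantification over tuples. -/
theorem forall_tuple [Finite β] {P : ∀ I, (α → K.M I) → (β → K.M I) → Prop}
    (hP : UDef K fun I (v : α ⊕ β → K.M I) => P I (fun a => v (.inl a)) fun b => v (.inr b)) :
    UDef K fun I v => ∀ x, P I v x := by
  obtain ⟨φ, hφ⟩ := hP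
  refine ⟨φ.iAlls β, fun I v => ?_⟩
  let := K.str I
  rw [Language.Formula.realize_iAlls]
  exact forall_congr' fun x => hφ I _

/-- Existential quantification over tuples. -/
theorem exists_tuple [Finite β] {P : ∀ I, (α → K.M I) → (β → K.M I) → Prop}
    (hP : UDef K fun I (v : α ⊕ β → K.M I) => P I (fun a => v (.inl a)) fun b => v (.inr b)) :
    UDef K fun I v => ∃ x, P I v x :=
  (forall_tuple (P := fun I v x => ¬ P I v x) hP.not).not.congr fun _ _ => by push Not; rfl

/-- Universal quantification. -/
protected theorem all {P : ∀ I, (α → K.M I) → K.M I → Prop}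
    (hP : UDef K fun I (v : α ⊕ Unit → K.M I) => P I (fun a => v (.inl a)) (v (.inr ()))) :
    UDef K fun I v => ∀ x, P I v x :=
  (forall_tuple (P := fun I v (x : Unit → K.M I) => P I v (x ())) hP).congr fun _ _ =>
    ⟨fun h x => h fun _ => x, fun h _ => h _⟩

/-- Existential quantification. -/
protected theorem ex {P : ∀ I, (α → K.M I) → K.M I → Prop}
    (hP : UDef K fun I (v : α ⊕ Unit → K.M I) => P I (fun a => v (.inl a)) (v (.inr ()))) :
    UDef K fun I v => ∃ x, P I v x :=
  (UDef.all (P := fun I v x => ¬ P I v x) hP.not).not.congr fun _ _ => by push Not; rfl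

/-- Universal quantification of the last variable of a bounded formula. -/
theorem all_snoc {m : ℕ} {P : ∀ I, (α → K.M I) → (Fin (m + 1) → K.M I) → Prop}
    (hP : UDef K fun I (v : α ⊕ Fin (m + 1) → K.M I) => P I (fun a => v (.inl a))
      fun i => v (.inr i)) :
    UDef K fun I (v : α ⊕ Fin m → K.M I) =>
      ∀ x, P I (fun a => v (.inl a)) (Fin.snoc (α := fun _ => K.M I) (fun i => v (.inr i)) x) := by
  refine UDef.all ((hP.comp (Sum.elim (fun i => .inl (.inl i))
    (Fin.snoc (α := fun _ => (α ⊕ Fin m) ⊕ Unit) (fun i => .inl (.inr i)) (.inr ())))).congr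
      fun I v => ?_)
  simp only [Sum.elim_inl, Sum.elim_inr]
  refine iff_of_eq (congrArg _ (funext fun i => ?_))
  refine Fin.lastCases ?_ (fun i => ?_) i <;> simp

/-- Substitution of definable values for variables. -/
theorem subst [Finite β] {T : ∀ I, (α → K.M I) → β → K.M I}
    (hT : ∀ b, UDef K fun I (v : α ⊕ Unit → K.M I) => T I (fun a => v (.inl a)) b = v (.inr ()))
    {Q : ∀ I, (α → K.M I) → (β → K.M I) → Prop}
    (hQ : UDef K fun I (v : α ⊕ β → K.M I) => Q I (fun a => v (.inl a)) fun b => v (.inr b)) :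
    UDef K fun I v => Q I v (T I v) := by
  refine (exists_tuple (P := fun I v (x : β → K.M I) => (∀ b, T I v b = x b) ∧ Q I v x)
    (UDef.and (forall_finite fun b => ?_) hQ)).congr fun I v => ?_
  · exact (hT b).comp (Sum.elim Sum.inl fun _ => Sum.inr b)
  · constructor
    · rintro ⟨x, hx, h⟩
      rwa [← funext hx] at h
    · exact fun h => ⟨_, fun _ => rfl, h⟩

theorem term_eq (s t : L.Term α) : UDef K fun I v =>
    @FirstOrder.Language.Term.realize L (K.M I) (K.str I) α v s =
      @FirstOrder.Language.Term.realize L (K.M I) (K.str I) α v t := by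
  refine ⟨s.equal t, fun I v => ?_⟩
  let := K.str I
  rw [Language.Formula.realize_equal]

theorem rel_term {m : ℕ} (R : L.Relations m) (t : Fin m → L.Term α) : UDef K fun I v =>
    @FirstOrder.Language.Structure.RelMap L (K.M I) (K.str I) m R fun i =>
      @FirstOrder.Language.Term.realize L (K.M I) (K.str I) α v (t i) := by
  refine ⟨R.formula t, fun I v => ?_⟩
  let := K.str I
  rw [Language.Formula.realize_rel]

theorem eq (a b : α) : UDef K fun _ v => v a = v b := term_eq (.var a) (.var b)

theorem rel {m : ℕ} (R : L.Relations m) (x : Fin m → α) : UDef K fun I v =>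
    @FirstOrder.Language.Structure.RelMap L (K.M I) (K.str I) m R fun i => v (x i) :=
  rel_term R fun i => .var (x i)

end UDef

/-- The family of structures given by tables. -/
@[reducible] def tableFamily {J : Type} {r : J → ℕ} (Inst : Type) (n : Inst → ℕ)
    (G : ∀ I, Tables r (n I)) : Family (JLang r) :=
  ⟨Inst, fun I => Fin (n I), fun I => jInterp (G I)⟩

namespace UDef

variable {J : Type} {r : J → ℕ} {Inst : Type} {n : Inst → ℕ} {G : ∀ I, Tables r (n I)} {α : Type}

theorem table_le (a b : α) : UDef (tableFamily Inst n G) fun _ v => v a ≤ v b :=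
  UDef.rel (K := tableFamily Inst n G) (JRel.le : (JLang r).Relations 2) ![a, b]

theorem table_var (j : J) (x : Fin (r j) → α) :
    UDef (tableFamily Inst n G) fun I v => (fun i => v (x i)) ∈ G I j :=
  UDef.rel (K := tableFamily Inst n G) (JRel.var j : (JLang r).Relations (r j)) x

theorem table_mem (j : J) (x : Fin (r j) → α) {u : ∀ I, (α → Fin (n I)) → Fin (r j) → Fin (n I)}
    (hu : ∀ I v i, u I v i = v (x i)) : UDef (tableFamily Inst n G) fun I v => u I v ∈ G I j :=
  (table_var j x).congr fun I v => by
    rw [show u I v = fun i => v (x i) from funext (hu I v)]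

theorem table_lt (a b : α) : UDef (tableFamily Inst n G) fun _ v => v a < v b :=
  (table_le b a).not.congr fun _ _ => not_le

end UDef

/-! ### Relation variables as function variables -/

section RelToFun

variable {σ : Vocabulary} {k : ℕ} {r : Fin k → ℕ}

/-- The family of all interpretations of the language with function variables. -/
@[reducible] def funFamily (σ : Vocabulary) (a : Fin k → ℕ) : Family (FunLang σ a) :=
  ⟨Σ A : Struc σ, ∀ j, (Fin (a j) → Fin A.n) → Fin A.n, fun I => Fin I.1.n,
    fun I => funInterp I.1 I.2⟩

/-- The relations given by the supports of functions. -/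
def supports {A : Struc σ} (F : ∀ j, (Fin (r j) → Fin A.n) → Fin A.n) :
    ∀ j, Set (Fin (r j) → Fin A.n) :=
  fun j => {x | F j x ≠ ⟨0, A.n_pos⟩}

theorem exists_funLang_term {α : Type} (t : (RelLang σ r).Term α) :
    ∃ t' : (FunLang σ r).Term α, ∀ (I : (funFamily σ r).Inst) (v : α → Fin I.1.n),
      @FirstOrder.Language.Term.realize _ _ (funInterp I.1 I.2) α v t' =
        @FirstOrder.Language.Term.realize _ _ (relInterp I.1 (supports I.2)) α v t := by
  cases t with
  | var x => exact ⟨.var x, fun _ _ => rfl⟩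
  | func g ts =>
    cases g with
    | const i => exact ⟨.func (L := FunLang σ r) (FunLangFun.const i) ![], fun _ _ => rfl⟩

/-- The constant `min` of the language with function variables. -/
def minTerm (σ : Vocabulary) (a : Fin k → ℕ) (α : Type) : (FunLang σ a).Term α :=
  .func (L := FunLang σ a) (FunLangFun.min) ![]

/-- The atom for a relation variable turns into an inequality with `min`; all other symbols are also
available in the language with function variables. -/
theorem udef_supports {l m : ℕ} (φ : (RelLang σ r).BoundedFormula (Fin l) m) :
    UDef (funFamily σ r) fun I (v : Fin l ⊕ Fin m → _) =>
      @FirstOrder.Language.BoundedFormula.Realize _ _ (relInterp I.1 (supports I.2)) _ _ φ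
        (fun i => v (.inl i)) fun i => v (.inr i) := by
  have hv : ∀ {I : (funFamily σ r).Inst} {m : ℕ} (v : Fin l ⊕ Fin m → Fin I.1.n),
      Sum.elim (fun i => v (.inl i)) (fun i => v (.inr i)) = v :=
    fun v => funext fun x => by cases x <;> rfl
  induction φ with
  | falsum => exact UDef.false
  | equal t₁ t₂ =>
    obtain ⟨t₁', h₁⟩ := exists_funLang_term t₁
    obtain ⟨t₂', h₂⟩ := exists_funLang_term t₂
    refine (UDef.term_eq (K := funFamily σ r) t₁' t₂').congr fun I v => ?_
    simp only [FirstOrder.Language.BoundedFormula.Realize, hv, h₁, h₂]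
  | rel R ts =>
    choose ts' h using fun i => exists_funLang_term (ts i)
    cases R with
    | input i =>
      refine (UDef.rel_term (K := funFamily σ r) (FunLangRel.input i) ts').congr fun I v => ?_
      simp only [FirstOrder.Language.BoundedFormula.Realize, hv, h]
      rfl
    | le =>
      refine (UDef.rel_term (K := funFamily σ r) (FunLangRel.le) ts').congr fun I v => ?_
      simp only [FirstOrder.Language.BoundedFormula.Realize, hv, h]
      rfl
    | var j =>
      refine (UDef.term_eq (K := funFamily σ r) (.func (L := FunLang σ r) (FunLangFun.var j) ts')
        (minTerm σ r _)).not.congr fun I v => ?_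
      simp only [FirstOrder.Language.BoundedFormula.Realize, hv,
        FirstOrder.Language.Term.realize, h]
      rfl
  | imp φ ψ hφ hψ => exact hφ.imp hψ
  | all φ hφ => exact UDef.all_snoc (K := funFamily σ r) (P := fun I v xs =>
      @FirstOrder.Language.BoundedFormula.Realize _ _ (relInterp I.1 (supports I.2)) _ _ φ v xs) hφ

/-- The values of the functions are `0` and `1` only. -/
def Binary {A : Struc σ} (F : ∀ j, (Fin (r j) → Fin A.n) → Fin A.n) : Prop :=
  ∀ j x y, y ≠ ⟨0, A.n_pos⟩ → F j x ≤ y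

theorem udef_binary : UDef (funFamily σ r) fun I (_ : Fin 0 → Fin I.1.n) => Binary I.2 := by
  refine UDef.forall_finite fun j => UDef.forall_tuple (K := funFamily σ r)
    (P := fun I _ x => ∀ y, y ≠ ⟨0, I.1.n_pos⟩ → I.2 j x ≤ y) (UDef.all (K := funFamily σ r)
      (P := fun I (v : Fin 0 ⊕ Fin (r j) → _) y =>
        y ≠ ⟨0, I.1.n_pos⟩ → I.2 j (fun b => v (.inr b)) ≤ y)
        (UDef.imp (UDef.not ?_) ?_))
  · exact UDef.term_eq (K := funFamily σ r) (.var (Sum.inr ())) (minTerm σ r _)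
  · exact UDef.rel_term (K := funFamily σ r) (FunLangRel.le)
      ![.func (L := FunLang σ r) (FunLangFun.var j) (fun i => .var (Sum.inl (Sum.inr i))),
        .var (Sum.inr ())]

/-- Under `Binary` a nonzero value lies below every nonzero element and so is the least of them.
Thus a function is determined by its support, and the characteristic function, which needs a second
element, shows that every relation arises. -/
theorem exists_funLang_formula {l : ℕ} (φ : (RelLang σ r).Formula (Fin l)) :
    ∃ ψ : (FunLang σ r).Formula (Fin l), ∀ A : Struc σ, 2 ≤ A.n → funCount ψ A = relCount φ A := by
  obtain ⟨ψ, hψ⟩ := ((udef_supports φ).comp (Sum.elim id Fin.elim0)).and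
    (udef_binary.comp (Fin.elim0 : Fin 0 → Fin l))
  refine ⟨ψ, fun A hA => ?_⟩
  have hset : {p : (∀ j, Set (Fin (r j) → Fin A.n)) × (Fin l → Fin A.n) |
      @FirstOrder.Language.Formula.Realize (RelLang σ r) (Fin A.n) (relInterp A p.1) (Fin l) φ p.2}
      = (fun p : (∀ j, (Fin (r j) → Fin A.n) → Fin A.n) × (Fin l → Fin A.n) =>
          (supports p.1, p.2)) '' {p | @FirstOrder.Language.Formula.Realize (FunLang σ r) (Fin A.n)
            (funInterp A p.1) (Fin l) ψ p.2} := by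
    have hR : ∀ (S : ∀ j, Set (Fin (r j) → Fin A.n)) (c : Fin l → Fin A.n) xs,
        @FirstOrder.Language.BoundedFormula.Realize _ _ (relInterp A S) _ _ φ c xs ↔
        @FirstOrder.Language.Formula.Realize (RelLang σ r) (Fin A.n) (relInterp A S) (Fin l) φ c :=
      fun S c xs => iff_of_eq (congrArg _ (Subsingleton.elim _ _))
    ext ⟨S, c⟩
    simp only [Set.mem_ofPred_eq, Set.mem_image, Prod.exists, Prod.mk.injEq]
    constructor
    · intro h
      have hs : supports (A := A) (r := r) (fun j x => if x ∈ S j then ⟨1, hA⟩ else ⟨0, A.n_pos⟩)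
          = S := by
        funext j
        ext x
        simp only [supports, Set.mem_ofPred_eq]
        by_cases hx : x ∈ S j <;> simp [hx]
      refine ⟨_, c, (hψ ⟨A, _⟩ c).2 ⟨?_, ?_⟩, hs, rfl⟩
      · rw [hs]
        exact (hR S c _).2 h
      · intro j x y hy
        have hy : (y : ℕ) ≠ 0 := fun h => hy (Fin.ext h)
        by_cases hx : x ∈ S j <;> simp only [hx, if_true, if_false, Fin.le_def] <;> omega
    · rintro ⟨F, c, h, rfl, rfl⟩
      exact (hR _ _ _).1 ((hψ ⟨A, F⟩ c).1 h).1
  rw [funCount, relCount, hset, Set.InjOn.ncard_image]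
  rintro ⟨F, c⟩ h ⟨F', c'⟩ h' heq
  obtain ⟨hS, rfl⟩ : supports F = supports F' ∧ c = c' := by simpa using heq
  have hb := ((hψ ⟨A, F⟩ c).1 h).2
  have hb' := ((hψ ⟨A, F'⟩ c).1 h').2
  refine Prod.ext (funext fun j => funext fun x => ?_) rfl
  have h1 : F j x ≠ ⟨0, A.n_pos⟩ ↔ F' j x ≠ ⟨0, A.n_pos⟩ :=
    Set.ext_iff.1 (congrFun hS j) x
  by_cases hx : F j x = ⟨0, A.n_pos⟩
  · have hx' : F' j x = ⟨0, A.n_pos⟩ := by tauto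
    exact hx.trans hx'.symm
  -- Both values are nonzero, so `Binary` puts each of them below the other.
  · exact le_antisymm (hb j x _ (h1.1 hx)) (hb' j x _ hx)

theorem sharpFORel_subset_sharpFO : SharpFORel ⊆ SharpFO := by
  rintro f ⟨σ, k, l, r, φ, hf, hv⟩
  obtain ⟨ψ, hψ⟩ := exists_funLang_formula φ
  exact ⟨σ, k, l, r, ψ, fun A hA => (hf A).trans (hψ A hA).symm, hv⟩

end RelToFun

/-! ### Binary representations -/

/-- Adding one flips bit `i` exactly if a carry arrives there, that is, if all lower bits are one.
-/
theorem testBit_succ_iff (i j : ℕ) :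
    (j + 1).testBit i = true ↔ ¬ (j.testBit i = true ↔ ∀ i' < i, j.testBit i' = true) := by
  induction i generalizing j with
  | zero =>
    simp only [Nat.testBit_zero, decide_eq_true_eq, Nat.not_lt_zero, false_imp_iff, implies_true,
      iff_true]
    omega
  | succ i ih =>
    have hall : (∀ i' < i + 1, j.testBit i' = true) ↔
        j % 2 = 1 ∧ ∀ i' < i, (j / 2).testBit i' = true := by
      constructor
      · intro h
        refine ⟨by simpa using h 0 (Nat.succ_pos i), fun i' hi' => ?_⟩
        simpa [Nat.testBit_succ] using h (i' + 1) (by omega)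
      · rintro ⟨h0, h⟩ i' hi'
        cases i' with
        | zero => simpa using h0
        | succ i' => simpa [Nat.testBit_succ] using h i' (by omega)
    rw [hall, Nat.testBit_succ, Nat.testBit_succ]
    rcases Nat.mod_two_eq_zero_or_one j with h | h
    · rw [show (j + 1) / 2 = j / 2 by omega]
      simp [h]
    · rw [show (j + 1) / 2 = j / 2 + 1 by omega, ih]
      simp [h]

/-- The recursion that characterises the bit relation. -/
def BitRecursion {n : ℕ} (B : Set (Fin 2 → Fin n)) : Prop :=
  (∀ i z : Fin n, (∀ y, z ≤ y) → ![i, z] ∉ B) ∧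
    ∀ i x y : Fin n, x < y → (∀ z, z ≤ x ∨ y ≤ z) →
      (![i, y] ∈ B ↔ ¬ (![i, x] ∈ B ↔ ∀ i', i' < i → ![i', x] ∈ B))

/-- The bit relation. -/
def bitRel (n : ℕ) : Set (Fin 2 → Fin n) := {u | (u 1 : ℕ).testBit (u 0 : ℕ) = true}

theorem mem_bitRel {n : ℕ} (i j : Fin n) :
    ![i, j] ∈ bitRel n ↔ (j : ℕ).testBit (i : ℕ) = true := Iff.rfl

/-- Induction on the second argument of BIT. The recursion never leaves the universe, since bit `i`
of a successor depends only on bits at positions up to `i` of the predecessor. So a formula with the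
order alone pins down the guessed table. -/
theorem bitRecursion_iff {n : ℕ} (B : Set (Fin 2 → Fin n)) : BitRecursion B ↔ B = bitRel n := by
  constructor
  · rintro ⟨h0, h1⟩
    have key : ∀ (j : ℕ) (hj : j < n) (i : Fin n),
        ![i, ⟨j, hj⟩] ∈ B ↔ j.testBit (i : ℕ) = true := by
      intro j
      induction j with
      | zero => exact fun hj i => iff_of_false (h0 i _ fun y => Nat.zero_le _) (by simp)
      | succ j ih =>
        intro hj i
        have hj' : j < n := by omega
        rw [h1 i ⟨j, hj'⟩ ⟨j + 1, hj⟩ (Nat.lt_succ_self j) (fun z => by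
          simp only [Fin.le_def]; omega), testBit_succ_iff, ih hj']
        refine not_congr (iff_congr Iff.rfl ⟨fun h i' hi' => ?_, fun h i' hi' => ?_⟩)
        · exact (ih hj' ⟨i', hi'.trans i.2⟩).1 (h ⟨i', _⟩ hi')
        · exact (ih hj' i').2 (h i' hi')
    ext u
    have hu : u = ![u 0, u 1] := by
      funext i
      fin_cases i <;> rfl
    rw [hu, mem_bitRel]
    exact key _ (u 1).2 (u 0)
  · rintro rfl
    constructor
    · intro i z hz
      have : (z : ℕ) = 0 := Nat.le_zero.1 (hz ⟨0, by have := z.2; omega⟩)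
      simp [mem_bitRel, this]
    · intro i x y hxy hz
      have hy : (y : ℕ) = x + 1 := by
        have h1 : (x : ℕ) < y := hxy
        have h2 := hz ⟨x + 1, by have := y.2; omega⟩
        simp only [Fin.le_def] at h2
        omega
      simp only [mem_bitRel, hy]
      rw [testBit_succ_iff]
      refine not_congr (iff_congr Iff.rfl ⟨fun h i' hi' => h i' hi', fun h i' hi' => ?_⟩)
      exact h ⟨i', lt_trans hi' i.2⟩ hi'

/-- The positions of bits of elements of the universe. -/
def bitPos (n : ℕ) : Set (Fin 1 → Fin n) := {v | (v 0 : ℕ) < Nat.clog 2 n}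

/-- Position `i` counts if and only if `2 ^ i < n`, and then `2 ^ i` itself is an element with that
bit. This makes the number of bits of a constant definable from BIT. -/
theorem mem_bitPos_iff {n : ℕ} (i : Fin n) :
    ![i] ∈ bitPos n ↔ ∃ j : Fin n, (j : ℕ).testBit (i : ℕ) = true := by
  change (i : ℕ) < Nat.clog 2 n ↔ _
  rw [Nat.lt_clog_iff_pow_lt (by norm_num)]
  constructor
  · intro h
    exact ⟨⟨_, h⟩, Nat.testBit_two_pow_self⟩
  · rintro ⟨j, hj⟩
    exact (Nat.ge_two_pow_of_testBit hj).trans_lt j.2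

theorem clog_le_self (n : ℕ) : Nat.clog 2 n ≤ n :=
  Nat.clog_le_of_le_pow Nat.lt_two_pow_self.le

/-- The set of bits of an element of the universe. -/
def bitSet {n : ℕ} (c : Fin n) : Set (Fin 1 → Fin n) := {v | (c : ℕ).testBit (v 0 : ℕ) = true}

theorem bitSet_subset_bitPos {n : ℕ} (c : Fin n) : bitSet c ⊆ bitPos n := by
  intro v hv
  have e : v = ![v 0] := by
    funext i
    rw [Subsingleton.elim i 0]
    rfl
  rw [e]
  exact (mem_bitPos_iff _).2 ⟨c, hv⟩

theorem encRel_getElem_one {n : ℕ} (S : Set (Fin 1 → Fin n)) (i : ℕ) (hi : i < n) :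
    (encRel S)[i]? = some (decide ((fun _ => ⟨i, hi⟩) ∈ S)) := by
  have h := encRel_getElem? S fun _ => ⟨i, hi⟩
  have e : tupleIdx (fun _ : Fin 1 => (⟨i, hi⟩ : Fin n)) = i := by simp [tupleIdx]
  rwa [e] at h

theorem testBit_eq_of_encConst_eq {n : ℕ} {c c' : Fin n} (h : encConst c = encConst c') :
    c = c' := by
  have h1 := List.ofFn_injective h
  refine Fin.ext (Nat.eq_of_testBit_eq fun i => ?_)
  by_cases hi : i < Nat.clog 2 n
  · simpa using congrFun h1 (Fin.rev ⟨i, hi⟩)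
  · have hb : ∀ c : Fin n, (c : ℕ).testBit i = false := by
      intro c
      refine Nat.testBit_eq_false_of_lt (c.2.trans_le ((Nat.le_pow_clog Nat.one_lt_two n).trans ?_))
      exact Nat.pow_le_pow_right Nat.two_pos (by omega)
    rw [hb, hb]

theorem encRel_bitPos (n : ℕ) : encRel (bitPos n) =
    List.replicate (Nat.clog 2 n) true ++ List.replicate (n - Nat.clog 2 n) false := by
  have hc := clog_le_self n
  refine List.ext_getElem? fun i => ?_
  by_cases hi : i < n
  · rw [encRel_getElem_one _ i hi, List.getElem?_append, List.getElem?_replicate,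
      List.length_replicate, List.getElem?_replicate]
    by_cases h : i < Nat.clog 2 n
    · simp [h, bitPos]
    · simp only [h, if_false, bitPos, Set.mem_ofPred_eq, decide_false]
      rw [if_pos (by omega)]
  · rw [List.getElem?_eq_none (by rw [encRel_length, pow_one]; omega), List.getElem?_eq_none (by simp; omega)]

theorem readPart_skip (k : ℕ) (L : List Bool) (hL : L.length = k) (ms : List (Option Bool))
    (L' : List Bool) :
    readPart (List.replicate k (some false) ++ ms) (L ++ L') = readPart ms L' := by
  induction k generalizing L with
  | zero =>
    rw [List.length_eq_zero_iff.1 hL]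
    rfl
  | succ k ih =>
    cases L with
    | nil => simp at hL
    | cons b L =>
      rw [List.replicate_succ, List.cons_append, List.cons_append, readPart]
      · exact ih L (by simpa using hL)
      · simp

/-- The input shows only the `⌈log₂ n⌉` relevant bits of a constant, the most significant one first,
whereas the unary table of its bits has `n` rows. Filling from the last row to the first, with the
rows outside `bitPos` forced to zero, consumes exactly these bits in their order. -/
theorem readPart_bitSet {n : ℕ} (c : Fin n) :
    readPart ((encRel (bitPos n)).reverse.map some) (encRel (bitSet c)).reverse = encConst c := by
  have hc := clog_le_self n
  have hl : (encRel (bitSet c)).length = n := by rw [encRel_length, pow_one]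
  rw [encRel_bitPos, List.reverse_append, List.reverse_replicate, List.reverse_replicate,
    List.map_append, List.map_replicate, List.map_replicate]
  rw [← List.take_append_drop (Nat.clog 2 n) (encRel (bitSet c)), List.reverse_append,
    readPart_skip _ _ (by simp [hl]), readPart_read _ _ (by simp [hl, hc])]
  refine List.ext_getElem (by simp [encConst, hl, hc]) fun i h1 h2 => ?_
  have hi : i < Nat.clog 2 n := by simpa [encConst] using h2
  have hlt : Nat.clog 2 n - 1 - i < n := by omega
  have h3 := encRel_getElem_one (bitSet c) (Nat.clog 2 n - 1 - i) hlt
  rw [List.getElem?_eq_getElem (by omega)] at h3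
  simp only [List.getElem_reverse, List.getElem_take, List.length_take, hl, min_eq_left hc]
  rw [Option.some.inj h3, Bool.eq_iff_iff, decide_eq_true_iff]
  simp only [encConst, List.getElem_ofFn, Fin.val_rev]
  rw [show Nat.clog 2 n - (i + 1) = Nat.clog 2 n - 1 - i by omega]
  exact Iff.rfl

/-! ### Encodings are injective -/

theorem flatMap_injOn {ι β : Type*} (l : List ι) (f g : ι → List β)
    (hlen : ∀ i ∈ l, (f i).length = (g i).length) (h : l.flatMap f = l.flatMap g) :
    ∀ i ∈ l, f i = g i := by
  induction l with
  | nil => simp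
  | cons a l ih =>
    rw [List.flatMap_cons, List.flatMap_cons] at h
    obtain ⟨h1, h2⟩ := List.append_inj h (hlen a (by simp))
    intro i hi
    rcases List.mem_cons.1 hi with rfl | hi
    · exact h1
    · exact ih (fun i hi => hlen i (by simp [hi])) h2 i hi

theorem enc_length {σ : Vocabulary} (A : Struc σ) : (enc A).length =
    (if σ.numRel = 0 then A.n else ((List.finRange σ.numRel).map fun i => A.n ^ σ.arity i).sum) +
      σ.numConst * Nat.clog 2 A.n := by
  have h1 : ∀ (k : ℕ) (f : Fin k → List Bool), ((List.finRange k).flatMap f).length =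
      ((List.finRange k).map fun i => (f i).length).sum := fun k f => List.length_flatMap
  rw [enc, List.length_append, h1]
  congr 1
  · split_ifs
    · simp
    · rw [h1]
      simp only [encRel_length]
  · simp [encConst]

/-- Arities are positive, and without relation symbols the block of zeros has length `n`. Therefore
sizes up to `|w|` are the only ones that have to be guessed. -/
theorem le_enc_length {σ : Vocabulary} (A : Struc σ) : A.n ≤ (enc A).length := by
  rw [enc_length]
  refine le_trans ?_ (Nat.le_add_right _ _)
  split_ifs with h
  · exact le_rfl
  · have h0 : 0 < σ.numRel := Nat.pos_of_ne_zero h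
    refine le_trans (Nat.le_self_pow (σ.arity_pos ⟨0, h0⟩).ne' _) ?_
    exact List.single_le_sum (by simp) _ (List.mem_map.2 ⟨⟨0, h0⟩, List.mem_finRange _, rfl⟩)

theorem enc_length_lt {σ : Vocabulary} {A A' : Struc σ} (h : A.n < A'.n) :
    (enc A).length < (enc A').length := by
  rw [enc_length, enc_length]
  refine add_lt_add_of_lt_of_le ?_ (Nat.mul_le_mul le_rfl (Nat.clog_mono_right 2 h.le))
  split_ifs with h0
  · exact h
  · exact List.sum_lt_sum_of_ne_nil (by simpa using h0) _ _
      fun i _ => Nat.pow_lt_pow_left h (σ.arity_pos i).ne'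

/-- The length of the encoding grows strictly with the universe, so it determines `n`; then the
lengths of all blocks are known and the word can be cut into them. -/
theorem enc_injective (σ : Vocabulary) : Function.Injective (enc : Struc σ → List Bool) := by
  intro A A' h
  have hn : A.n = A'.n := by
    rcases lt_trichotomy A.n A'.n with hlt | heq | hlt
    · exact absurd (congrArg List.length h) (enc_length_lt hlt).ne
    · exact heq
    · exact absurd (congrArg List.length h) (enc_length_lt hlt).ne'
  obtain ⟨n, hn0, R, c⟩ := A
  obtain ⟨n', hn0', R', c'⟩ := A'
  dsimp only at hn
  subst hn
  rw [enc, enc] at h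
  dsimp only at h
  have hlen : (if σ.numRel = 0 then List.replicate n false
      else (List.finRange σ.numRel).flatMap fun i => encRel (R i)).length =
      (if σ.numRel = 0 then List.replicate n false
      else (List.finRange σ.numRel).flatMap fun i => encRel (R' i)).length := by
    split_ifs
    · rfl
    · simp only [List.length_flatMap, encRel_length]
  obtain ⟨h1, h2⟩ := List.append_inj h hlen
  congr 1
  · funext i
    have h0 : σ.numRel ≠ 0 := fun h0 => by
      have := i.2
      omega
    rw [if_neg h0, if_neg h0] at h1
    exact encRel_injective (flatMap_injOn _ _ _ (fun i _ => by simp [encRel_length]) h1 i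
      (List.mem_finRange i))
  · funext i
    exact testBit_eq_of_encConst_eq (flatMap_injOn _ _ _ (fun i _ => by simp [encConst]) h2 i
      (List.mem_finRange i))

section

/-! ### Tables for a structure with an assignment to function variables -/

/-- The tables for a structure, functions, elements, and `K` auxiliary unary relations. -/
inductive Sym (σ : Vocabulary) (k l K : ℕ) : Type
  | fn (j : Fin k)
  | ind (i : Fin l)
  | aux (i : Fin K)
  | bit
  | pos
  | pad (i : Fin (if σ.numRel = 0 then 1 else 0))
  | rel (i : Fin σ.numRel)
  | cst (i : Fin σ.numConst)

variable {σ : Vocabulary} {k l K : ℕ}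

namespace Sym

/-- The arities of the tables. -/
@[reducible] def arity (a : Fin k → ℕ) : Sym σ k l K → ℕ
  | fn j => a j + 1
  | ind _ => 1
  | aux _ => 1
  | bit => 2
  | pos => 1
  | pad _ => 1
  | rel i => σ.arity i
  | cst _ => 1

/-- How the tables are filled. -/
def kind : Sym σ k l K → Kind (Sym σ k l K)
  | pad _ => .read
  | rel _ => .read
  | cst _ => .masked pos
  | _ => .guess

/-- The order in which the tables are filled. -/
def order (σ : Vocabulary) (k l K : ℕ) : List (Sym σ k l K) :=
  ((List.finRange k).map fn ++ (List.finRange l).map ind ++ (List.finRange K).map aux ++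
    [bit, pos] ++ (List.finRange _).map pad ++ (List.finRange _).map rel) ++
    (List.finRange _).map cst

instance : Finite (Sym σ k l K) := by
  let g : (Fin k ⊕ Fin l ⊕ Fin K) ⊕ Bool ⊕ Fin (if σ.numRel = 0 then 1 else 0) ⊕ Fin σ.numRel ⊕
      Fin σ.numConst → Sym σ k l K :=
    Sum.elim (Sum.elim fn (Sum.elim ind aux)) (Sum.elim (fun b => if b then bit else pos)
      (Sum.elim pad (Sum.elim rel cst)))
  refine Finite.of_surjective g ?_
  rintro (j | i | i | _ | _ | i | i | i)
  · exact ⟨.inl (.inl j), rfl⟩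
  · exact ⟨.inl (.inr (.inl i)), rfl⟩
  · exact ⟨.inl (.inr (.inr i)), rfl⟩
  · exact ⟨.inr (.inl true), rfl⟩
  · exact ⟨.inr (.inl false), rfl⟩
  · exact ⟨.inr (.inr (.inl i)), rfl⟩
  · exact ⟨.inr (.inr (.inr (.inl i))), rfl⟩
  · exact ⟨.inr (.inr (.inr (.inr i))), rfl⟩

theorem mem_order (s : Sym σ k l K) : s ∈ order σ k l K := by
  cases s <;> simp [order]

theorem nodup_order : (order σ k l K).Nodup := by
  have h : ∀ {m : ℕ} (g : Fin m → Sym σ k l K), Function.Injective g →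
      ((List.finRange m).map g).Nodup := fun g hg => (List.nodup_finRange _).map hg
  simp only [order, List.nodup_append, List.mem_append, List.mem_map, List.mem_finRange, true_and]
  refine ⟨⟨⟨⟨⟨⟨h _ ?_, h _ ?_, ?_⟩, h _ ?_, ?_⟩, ?_, ?_⟩, h _ ?_, ?_⟩, h _ ?_, ?_⟩, h _ ?_, ?_⟩
  all_goals first | (intro x y hxy; simpa using hxy) | simp
  all_goals aesop

/-- The masked tables are those of the constants; they come last, after their mask `pos`. -/
theorem pairwise_order :
    (order σ k l K).Pairwise fun s s' => kind s ≠ .masked s' := by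
  rw [order, List.pairwise_append]
  refine ⟨List.pairwise_of_forall_mem_list ?_, List.pairwise_of_forall_mem_list ?_, ?_⟩
  · intro s hs s' _
    cases s <;> simp [kind]
    simp at hs
  · intro s hs s' hs'
    cases s' <;> cases s <;> simp [kind]
    simp at hs'
  · intro s hs s' _
    cases s <;> simp [kind]
    simp at hs

end Sym

/-- The tables for a structure, functions and elements. -/
@[reducible] def render {a : Fin k → ℕ} (A : Struc σ) (F : ∀ j, (Fin (a j) → Fin A.n) → Fin A.n)
    (c : Fin l → Fin A.n) (X : Fin K → Set (Fin 1 → Fin A.n)) :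
    Tables (Sym.arity a : Sym σ k l K → ℕ) A.n
  | .fn j => {u | F j (Fin.tail u) = u 0}
  | .ind i => {u | c i = u 0}
  | .aux i => X i
  | .bit => bitRel A.n
  | .pos => bitPos A.n
  | .pad _ => ∅
  | .rel i => A.rel i
  | .cst i => bitSet (A.const i)

/-- Guessed tables consume no input, and `pad` accounts for the block `0 ^ n` that replaces missing
relations. What is consumed is therefore the encoding itself, block by block. -/
theorem flatMap_tableInput_render {a : Fin k → ℕ} (A : Struc σ)
    (F : ∀ j, (Fin (a j) → Fin A.n) → Fin A.n)
    (c : Fin l → Fin A.n) (X : Fin K → Set (Fin 1 → Fin A.n)) :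
    (Sym.order σ k l K).flatMap (tableInput Sym.kind (render A F c X)) = enc A := by
  have hguess : ∀ s : Sym σ k l K, s.kind = .guess →
      tableInput Sym.kind (render A F c X) s = [] := by
    intro s hs
    simp only [tableInput, cellModes, hs]
    exact readPart_guess _ _
  have hread : ∀ s : Sym σ k l K, s.kind = .read →
      tableInput Sym.kind (render A F c X) s = encRel (render A F c X s) := by
    intro s hs
    simp only [tableInput, cellModes, hs]
    exact readPart_read _ _ (encRel_length _)
  have hcst : ∀ i, tableInput Sym.kind (render A F c X) (.cst i : Sym σ k l K) =
      encConst (A.const i) := fun i => readPart_bitSet _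
  simp only [Sym.order, List.flatMap_append, List.flatMap_map, List.flatMap_cons, List.flatMap_nil,
    hcst]
  rw [hguess .bit rfl, hguess .pos rfl]
  simp only [hguess (.fn _) rfl, hguess (.ind _) rfl, hguess (.aux _) rfl, hread (.pad _) rfl,
    hread (.rel _) rfl, List.append_nil, enc]
  congr 1
  have hnil : ∀ {m : ℕ}, (List.finRange m).flatMap (fun _ => ([] : List Bool)) = [] := by
    simp
  rw [hnil, hnil, hnil, List.nil_append]
  have he : ∀ i, encRel (render A F c X (.pad i : Sym σ k l K)) = List.replicate A.n false := by
    intro i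
    rw [List.eq_replicate_iff]
    exact ⟨by simp [encRel_length], by simp [encRel]⟩
  have hm : ∀ (m : ℕ) (L : List Bool), (List.finRange m).flatMap (fun _ => L) =
      (List.replicate m L).flatten := by
    intro m L
    rw [List.flatMap_def, List.map_const', List.length_finRange]
  simp only [he]
  rw [hm]
  by_cases h0 : σ.numRel = 0
  · have hz : ∀ (m : ℕ) (g : Fin m → List Bool), m = 0 → (List.finRange m).flatMap g = [] := by
      rintro m g rfl
      rfl
    rw [if_pos h0, if_pos h0, hz _ _ h0]
    simp
  · rw [if_neg h0, if_neg h0]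
    simp

/-! ### The shape of the tables -/

/-- The tables are those of some structure, some functions and some elements. -/
def Shape {a : Fin k → ℕ} {n : ℕ} (G : Tables (Sym.arity a : Sym σ k l K → ℕ) n) : Prop :=
  BitRecursion (G .bit) ∧
  (∀ i : Fin n, ![i] ∈ G .pos ↔ ∃ j, ![i, j] ∈ G .bit) ∧
  (∀ i u, u ∉ G (.pad i)) ∧
  (∀ i : Fin σ.numConst, ∃ c, ∀ j, ![j] ∈ G (.cst i) ↔ ![j, c] ∈ G .bit) ∧
  (∀ (j : Fin k) (x : Fin (a j) → Fin n), ∃ y, ∀ z, (Fin.cons z x : Fin (a j + 1) → Fin n) ∈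
    G (.fn j) ↔ y = z) ∧
  (∀ i : Fin l, ∃ y, ∀ z, ![z] ∈ G (.ind i) ↔ y = z)

theorem eq_vec_one {n : ℕ} (u : Fin 1 → Fin n) : u = ![u 0] := by
  funext i
  rw [Subsingleton.elim i 0]
  rfl

theorem shape_render {a : Fin k → ℕ} (A : Struc σ) (F : ∀ j, (Fin (a j) → Fin A.n) → Fin A.n)
    (c : Fin l → Fin A.n) (X : Fin K → Set (Fin 1 → Fin A.n)) : Shape (render A F c X) := by
  refine ⟨(bitRecursion_iff _).2 rfl, fun i => mem_bitPos_iff i, fun i u h => h,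
    fun i => ⟨A.const i, fun j => Iff.rfl⟩, fun j x => ⟨F j x, fun z => Iff.rfl⟩,
    fun i => ⟨c i, fun z => Iff.rfl⟩⟩

/-- Each clause of `Shape` yields one ingredient by choice. Once the bit table is known to be the
true one, the clauses on `pos` and on the constants identify these tables as well. -/
theorem Shape.exists_render {a : Fin k → ℕ} {n : ℕ} (hn : 0 < n)
    {G : Tables (Sym.arity a : Sym σ k l K → ℕ) n} (hG : Shape G) :
    ∃ (e : Fin σ.numConst → Fin n) (F : ∀ j, (Fin (a j) → Fin n) → Fin n) (c : Fin l → Fin n),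
      G = render ⟨n, hn, fun i => G (.rel i), e⟩ F c fun i => G (.aux i) := by
  obtain ⟨h1, h2, h3, h4, h5, h6⟩ := hG
  choose e he using h4
  choose F hF using h5
  choose c hc using h6
  rw [bitRecursion_iff] at h1
  simp only [h1] at h2 he
  refine ⟨e, F, c, ?_⟩
  funext s
  cases s with
  | fn j =>
    ext u
    have := hF j (Fin.tail u) (u 0)
    rwa [Fin.cons_self_tail] at this
  | ind i =>
    ext u
    rw [eq_vec_one u]
    exact hc i (u 0)
  | aux i => rfl
  | bit => exact h1
  | pos =>
    ext u
    rw [eq_vec_one u]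
    exact (h2 _).trans (mem_bitPos_iff _).symm
  | pad i => exact Set.eq_empty_of_forall_notMem (h3 i)
  | rel i => rfl
  | cst i =>
    ext u
    rw [eq_vec_one u]
    exact he i _

section

variable (a : Fin k → ℕ) {Inst : Type} {n : Inst → ℕ}
  (G : ∀ I, Tables (Sym.arity a : Sym σ k l K → ℕ) (n I))

theorem UDef.mem_bit {α : Type} (x y : α) :
    UDef (tableFamily Inst n G) fun I v => ![v x, v y] ∈ G I .bit :=
  table_mem (r := (Sym.arity a : Sym σ k l K → ℕ)) .bit ![x, y]
    (u := fun I v => ![v x, v y]) fun I v i => by fin_cases i <;> rfl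

theorem UDef.mem_unary {α : Type} (s : Sym σ k l K) {u : ∀ I, (α → Fin (n I)) →
    Fin (Sym.arity a s) → Fin (n I)} (x : α) (hu : ∀ I v i, u I v i = v x) :
    UDef (tableFamily Inst n G) fun I v => u I v ∈ G I s :=
  table_mem (r := (Sym.arity a : Sym σ k l K → ℕ)) s (fun _ => x) hu

theorem UDef.bitRecursion :
    UDef (tableFamily Inst n G) fun I (_ : Fin 0 → _) => BitRecursion (G I .bit) := by
  refine UDef.and (UDef.all (UDef.all (UDef.imp (UDef.all ?_) (UDef.not ?_)))) ?_
  · exact UDef.table_le _ _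
  · exact UDef.mem_bit a G _ _
  · refine UDef.all (UDef.all (UDef.all (UDef.imp ?_ (UDef.imp (UDef.all ?_) ?_))))
    · exact UDef.table_lt _ _
    · exact UDef.or (UDef.table_le _ _) (UDef.table_le _ _)
    · exact UDef.iff (UDef.mem_bit a G _ _) (UDef.not (UDef.iff (UDef.mem_bit a G _ _)
       (UDef.all (UDef.imp (UDef.table_lt _ _) (UDef.mem_bit a G _ _)))))

theorem UDef.shape : UDef (tableFamily Inst n G) fun I (_ : Fin 0 → _) => Shape (G I) := by
  have one : ∀ {n : ℕ} (y : Fin n) (i : Fin 1), ![y] i = y := fun y i => by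
    rw [Subsingleton.elim i 0]
    rfl
  refine (UDef.bitRecursion a G).and (UDef.and ?_ (UDef.and ?_ (UDef.and ?_ (UDef.and ?_ ?_))))
  · exact UDef.all (UDef.iff (UDef.mem_unary a G _ _ fun _ _ _ => one _ _)
      (UDef.ex (UDef.mem_bit a G _ _)))
  · refine UDef.forall_finite fun i => UDef.forall_tuple (UDef.not ?_)
    exact UDef.table_var _ _
  · exact UDef.forall_finite fun i => UDef.ex (UDef.all (UDef.iff
      (UDef.mem_unary a G _ _ fun _ _ _ => one _ _) (UDef.mem_bit a G _ _)))
  · refine UDef.forall_finite fun j => UDef.forall_tuple (UDef.ex (UDef.all (UDef.iff ?_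
      (UDef.eq _ _))))
    refine UDef.table_mem (r := (Sym.arity a : Sym σ k l K → ℕ)) (.fn j)
      (Fin.cons (α := fun _ => ((Fin 0 ⊕ Fin (a j)) ⊕ Unit) ⊕ Unit) (.inr ())
        fun i => .inl (.inl (.inr i))) fun I v i => ?_
    refine Fin.cases ?_ (fun i => ?_) i <;> rfl
  · exact UDef.forall_finite fun i => UDef.ex (UDef.all (UDef.iff
      (UDef.mem_unary a G _ _ fun _ _ _ => one _ _) (UDef.eq _ _)))

end

/-! ### Translation of formulas with function variables -/

/-- A structure with functions, elements, and auxiliary unary relations. -/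
structure Assignment (σ : Vocabulary) (a : Fin k → ℕ) (l K : ℕ) where
  A : Struc σ
  F : ∀ j, (Fin (a j) → Fin A.n) → Fin A.n
  c : Fin l → Fin A.n
  X : Fin K → Set (Fin 1 → Fin A.n)

/-- The tables of an assignment. -/
@[reducible] def Assignment.tables {a : Fin k → ℕ} (I : Assignment σ a l K) :
    Tables (Sym.arity a : Sym σ k l K → ℕ) I.A.n := render I.A I.F I.c I.X

/-- The family of tables of assignments. -/
@[reducible] def assignmentFamily (σ : Vocabulary) (a : Fin k → ℕ) (l K : ℕ) :
    Family (JLang (Sym.arity a : Sym σ k l K → ℕ)) :=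
  tableFamily (Assignment σ a l K) (fun I => I.A.n) Assignment.tables

/-- The target language has no function symbols, so the graph of a term is defined instead of its
value. For a compound term the values of the arguments are named by existentially quantified
variables (`UDef.subst`); a constant is recognised as the element with the right bits. -/
theorem udef_funLang_term {a : Fin k → ℕ} {m : ℕ} (t : (FunLang σ a).Term (Fin l ⊕ Fin m)) :
    UDef (assignmentFamily σ a l K) fun I (v : (Fin 0 ⊕ Fin m) ⊕ Unit → _) =>
      @FirstOrder.Language.Term.realize _ _ (funInterp I.A I.F) _
        (Sum.elim I.c fun i => v (.inl (.inr i))) t = v (.inr ()) := by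
  induction t with
  | var x =>
    cases x with
    | inl i =>
      exact UDef.mem_unary a Assignment.tables (.ind i)
        (u := fun I (v : (Fin 0 ⊕ Fin m) ⊕ Unit → _) _ => v (.inr ())) (.inr ()) fun _ _ _ => rfl
    | inr i => exact UDef.eq _ _
  | func f ts ih =>
    cases f with
    | const i =>
      have h : UDef (assignmentFamily σ a l K) fun I (v : (Fin 0 ⊕ Fin m) ⊕ Unit → Fin I.A.n) =>
          ∀ j : Fin I.A.n, (fun _ => j) ∈ I.tables (.cst i) ↔ ![j, v (.inr ())] ∈ I.tables .bit :=
        UDef.all (UDef.iff (UDef.mem_unary a Assignment.tables _ _ fun _ _ _ => rfl)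
          (UDef.mem_bit a Assignment.tables _ _))
      refine h.congr fun I v => ?_
      change (∀ j : Fin I.A.n, (I.A.const i : ℕ).testBit j = true ↔
        (v (.inr ()) : ℕ).testBit j = true) ↔ I.A.const i = v (.inr ())
      refine ⟨fun h => Fin.ext (Nat.eq_of_testBit_eq fun j => ?_), fun h j => by rw [h]⟩
      by_cases hj : j < I.A.n
      · exact Bool.eq_iff_iff.2 (h ⟨j, hj⟩)
      -- Bits at positions outside the universe vanish, since `x < n ≤ j < 2 ^ j`; comparing the
      -- bits inside it is enough.
      · have hb : ∀ x : Fin I.A.n, (x : ℕ).testBit j = false := fun x =>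
          Nat.testBit_eq_false_of_lt ((x.2.trans_le (not_lt.1 hj)).trans Nat.lt_two_pow_self)
        rw [hb, hb]
    | min =>
      have h : UDef (assignmentFamily σ a l K) fun I (v : (Fin 0 ⊕ Fin m) ⊕ Unit → Fin I.A.n) =>
          ∀ j : Fin I.A.n, v (.inr ()) ≤ j := UDef.all (UDef.table_le _ _)
      refine h.congr fun I v => ?_
      change _ ↔ (⟨0, I.A.n_pos⟩ : Fin I.A.n) = v (.inr ())
      constructor
      · intro h
        exact Fin.ext (Nat.le_zero.1 (h ⟨0, I.A.n_pos⟩)).symm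
      · intro h j
        rw [← h]
        exact Nat.zero_le _
    | var j =>
      refine UDef.subst (K := assignmentFamily σ a l K)
        (T := fun I (v : (Fin 0 ⊕ Fin m) ⊕ Unit → _) i =>
          @FirstOrder.Language.Term.realize _ _ (funInterp I.A I.F) _
            (Sum.elim I.c fun i => v (.inl (.inr i))) (ts i))
        (Q := fun I (v : (Fin 0 ⊕ Fin m) ⊕ Unit → _) x => I.F j x = v (.inr ())) (fun i => ?_) ?_
      · exact (ih i).comp (Sum.elim (fun x => Sum.inl (Sum.inl x)) Sum.inr)
      · refine (UDef.table_mem (G := Assignment.tables) (.fn j)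
          (Fin.cons (α := fun _ => ((Fin 0 ⊕ Fin m) ⊕ Unit) ⊕ Fin (a j)) (.inl (.inr ()))
            fun i => .inr i) (u := fun I v => Fin.cons (α := fun _ => Fin I.A.n)
              (v (.inl (.inr ()))) fun i => v (.inr i)) fun I v i => ?_).congr fun I v => ?_
        · refine Fin.cases ?_ (fun i => ?_) i <;> rfl
        · exact Iff.rfl

theorem udef_funLang {a : Fin k → ℕ} {m : ℕ} (φ : (FunLang σ a).BoundedFormula (Fin l) m) :
    UDef (assignmentFamily σ a l K) fun I (v : Fin 0 ⊕ Fin m → _) =>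
      @FirstOrder.Language.BoundedFormula.Realize _ _ (funInterp I.A I.F) _ _ φ I.c
        fun i => v (.inr i) := by
  induction φ with
  | falsum => exact UDef.false
  | equal t₁ t₂ =>
    exact UDef.ex (K := assignmentFamily σ a l K) (P := fun I v x => _ = x ∧ _ = x)
      ((udef_funLang_term t₁).and (udef_funLang_term t₂)) |>.congr fun I v =>
        ⟨fun ⟨x, h₁, h₂⟩ => h₁.trans h₂.symm, fun h => ⟨_, h, rfl⟩⟩
  | @rel m p R ts =>
    have hsub : ∀ Q : ∀ I : Assignment σ a l K, (Fin p → Fin I.A.n) → Prop,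
        UDef (assignmentFamily σ a l K) (fun I (x : Fin p → _) => Q I x) →
        UDef (assignmentFamily σ a l K) fun I (v : Fin 0 ⊕ Fin m → _) => Q I fun i =>
          @FirstOrder.Language.Term.realize _ _ (funInterp I.A I.F) _
            (Sum.elim I.c fun i => v (.inr i)) (ts i) := fun Q hQ =>
      UDef.subst (K := assignmentFamily σ a l K) (T := fun I (v : Fin 0 ⊕ Fin m → _) i =>
        @FirstOrder.Language.Term.realize _ _ (funInterp I.A I.F) _
          (Sum.elim I.c fun i => v (.inr i)) (ts i)) (Q := fun I v x => Q I x)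
        (fun i => udef_funLang_term (ts i)) (hQ.comp Sum.inr)
    cases R with
    | input i =>
      exact hsub (fun I x => x ∈ I.A.rel i)
        (UDef.table_var (G := Assignment.tables) (.rel i) id)
    | le => exact hsub (fun I x => x 0 ≤ x 1) (UDef.table_le _ _)
    | bit =>
      exact hsub (fun I x => (x 1 : ℕ).testBit (x 0 : ℕ) = true)
        (UDef.table_var (G := Assignment.tables) .bit id)
  | imp φ ψ hφ hψ => exact hφ.imp hψ
  | all φ hφ => exact UDef.all_snoc (K := assignmentFamily σ a l K) (P := fun I v xs =>
      @FirstOrder.Language.BoundedFormula.Realize _ _ (funInterp I.A I.F) _ _ φ I.c xs) hφ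

end

/-! ### From function variables to machines -/

section

variable {σ : Vocabulary} {k l K : ℕ}

theorem maskOK_render {a : Fin k → ℕ} (A : Struc σ) (F : ∀ j, (Fin (a j) → Fin A.n) → Fin A.n)
    (c : Fin l → Fin A.n) (X : Fin K → Set (Fin 1 → Fin A.n)) (s : Sym σ k l K) :
    MaskOK Sym.kind (render A F c X) s := by
  have hread : ∀ (m : Option Bool), m ≠ some false → ∀ (N : ℕ) (L : List Bool), L.length = N →
      List.Forall₂ (fun m b => m = some false → b = false) (List.replicate N m) L := by
    rintro m hm N L rfl
    induction L with
    | nil => exact List.Forall₂.nil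
    | cons b L ih => exact List.Forall₂.cons (fun h => absurd h hm) ih
  have hmask : ∀ i, List.Forall₂ (fun m b => m = some false → b = false)
      ((encRel (bitPos A.n)).reverse.map some) (encRel (bitSet (A.const i))).reverse := by
    intro i
    rw [List.forall₂_map_left_iff, List.forall₂_iff_get]
    refine ⟨by simp [encRel_length], fun p h1 h2 => ?_⟩
    simp only [List.get_eq_getElem, List.getElem_reverse, encRel, List.getElem_ofFn,
      List.length_ofFn, Option.some.injEq, decide_eq_false_iff_not]
    exact fun h h' => h (bitSet_subset_bitPos _ h')
  cases s <;> first | exact hread _ (by simp) _ _ (encRel_length _) | exact hmask _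

/-- The structure with one element and with the given nonempty relations. -/
def unitStruc (σ : Vocabulary) (b : Fin σ.numRel → Bool) : Struc σ :=
  ⟨1, one_pos, fun i => {_u | b i = true}, fun _ => 0⟩

/-- Over a single element a relation is either empty or full, so there are only finitely many
structures, indexed by `b`. -/
theorem Struc.eq_unitStruc (A : Struc σ) (h : A.n = 1) {b : Fin σ.numRel → Bool}
    (hb : ∀ i, (∃ u, u ∈ A.rel i) ↔ b i = true) : A = unitStruc σ b := by
  obtain ⟨n, hn, R, e⟩ := A
  dsimp only at h
  subst h
  rw [unitStruc]
  congr 1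
  · funext i
    ext u
    refine Iff.trans ⟨fun hu => ⟨u, hu⟩, ?_⟩ (hb i)
    rintro ⟨u', hu'⟩
    rwa [Subsingleton.elim u u']
  · funext i
    exact Subsingleton.elim _ _

/-- The tables of a structure with one element, and one out of `f w` choices, where `w` is the
encoding of the structure. -/
def UnitChoice (f : List Bool → ℕ) {a : Fin k → ℕ} {n : ℕ}
    (G : Tables (Sym.arity a : Sym σ k l K → ℕ) n) : Prop :=
  (∀ x y : Fin n, x = y) ∧ ∃ b : Fin σ.numRel → Bool, (∀ i, (∃ u, u ∈ G (.rel i)) ↔ b i = true) ∧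
    ∃ i : Fin K, (i : ℕ) < f (enc (unitStruc σ b)) ∧ ∀ i', (∃ u, u ∈ G (.aux i')) ↔ i' = i

/-- The tables of a structure with more than one element, the auxiliary ones being empty. -/
def Proper {a : Fin k → ℕ} {n : ℕ} (G : Tables (Sym.arity a : Sym σ k l K → ℕ) n) : Prop :=
  (∃ x y : Fin n, x ≠ y) ∧ ∀ i u, u ∉ G (.aux i)

/-- The function `f` is arbitrary, but for fixed `b` and `i` the comparison with its value is a
constant, true or false. A finite disjunction over `b` and `i` gives the formula. -/
theorem UDef.unitChoice (f : List Bool → ℕ) (a : Fin k → ℕ) {Inst : Type} {n : Inst → ℕ}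
    (G : ∀ I, Tables (Sym.arity a : Sym σ k l K → ℕ) (n I)) :
    UDef (tableFamily Inst n G) fun I (_ : Fin 0 → _) => UnitChoice f (G I) :=
  UDef.and (UDef.all (UDef.all (UDef.eq _ _))) (UDef.exists_finite fun _ => UDef.and
    (UDef.forall_finite fun _ => UDef.iff (UDef.exists_tuple (UDef.table_var _ _)) (UDef.const _))
      (UDef.exists_finite fun _ => UDef.and (UDef.const _) (UDef.forall_finite fun _ =>
        UDef.iff (UDef.exists_tuple (UDef.table_var _ _)) (UDef.const _))))

theorem UDef.proper (a : Fin k → ℕ) {Inst : Type} {n : Inst → ℕ}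
    (G : ∀ I, Tables (Sym.arity a : Sym σ k l K → ℕ) (n I)) :
    UDef (tableFamily Inst n G) fun I (_ : Fin 0 → _) => Proper (G I) :=
  UDef.and (UDef.ex (UDef.ex (UDef.not (UDef.eq _ _)))) (UDef.forall_finite fun _ =>
    UDef.forall_tuple (UDef.not (UDef.table_var _ _)))

/-- The translation of `φ` is correct only for tables that come from an assignment. The conjunct
`Shape` discards all other tables, so nothing has to be known about the translation there. -/
theorem exists_tables_formula (f : List Bool → ℕ) (K : ℕ) {a : Fin k → ℕ}
    (φ : (FunLang σ a).Formula (Fin l)) :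
    ∃ χ : (JLang (Sym.arity a : Sym σ k l K → ℕ)).Formula (Fin 0),
      (∀ (n : ℕ) (G : Tables (Sym.arity a : Sym σ k l K → ℕ) n), JRealize G χ default default →
        Shape G) ∧
      ∀ I : Assignment σ a l K, JRealize I.tables χ default default ↔
        (UnitChoice f I.tables ∨ Proper I.tables ∧
          @FirstOrder.Language.Formula.Realize _ _ (funInterp I.A I.F) _ φ I.c) := by
  obtain ⟨φ', hφ'⟩ := (udef_funLang (K := K) φ).comp (Sum.elim id Fin.elim0)
  let K0 := tableFamily (Σ n, Tables (Sym.arity a : Sym σ k l K → ℕ) n) Sigma.fst Sigma.snd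
  have h0 : UDef K0 fun I (v : Fin 0 → _) => JRealize I.2 φ' v default := ⟨φ', fun _ _ => Iff.rfl⟩
  obtain ⟨χ, hχ⟩ := (UDef.shape a Sigma.snd).and ((UDef.unitChoice f a Sigma.snd).or
    ((UDef.proper a Sigma.snd).and h0))
  refine ⟨χ, fun n G h => ((hχ ⟨n, G⟩ default).1 h).1, fun I => ?_⟩
  refine (hχ ⟨I.A.n, I.tables⟩ default).trans ?_
  refine (and_iff_right (shape_render _ _ _ _)).trans ?_
  refine or_congr Iff.rfl (and_congr Iff.rfl ((hφ' I default).trans ?_))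
  exact iff_of_eq (congrArg _ (Subsingleton.elim _ _))

/-- Functions and elements are recovered from their graphs, constants from their sets of bits. -/
theorem Assignment.tables_injective {a : Fin k → ℕ} : Function.Injective
    fun I : Assignment σ a l K => (⟨I.A.n, I.tables⟩ : Σ n, Tables (Sym.arity a : Sym σ k l K → ℕ) n) := by
  rintro ⟨⟨n, hn, R, e⟩, F, c, X⟩ ⟨⟨n', hn', R', e'⟩, F', c', X'⟩ h
  obtain ⟨h1, h2⟩ := Sigma.mk.inj_iff.1 h
  dsimp only at h1
  subst h1
  have h3 := eq_of_heq h2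
  have hR : R = R' := funext fun i => congrFun h3 (.rel i)
  have hX : X = X' := funext fun i => congrFun h3 (.aux i)
  have hF : F = F' := by
    funext j x
    have := Set.ext_iff.1 (congrFun h3 (.fn j)) (Fin.cons (F j x) x)
    exact (this.1 rfl).symm
  have hc : c = c' := by
    funext i
    have := Set.ext_iff.1 (congrFun h3 (.ind i)) (fun _ => c i)
    exact (this.1 rfl).symm
  have he : e = e' := by
    funext i
    have h4 : bitSet (e i) = bitSet (e' i) := congrFun h3 (.cst i)
    apply testBit_eq_of_encConst_eq
    rw [← readPart_bitSet, ← readPart_bitSet, h4]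
  subst hR hX hF hc he
  rfl

theorem sharpFO_subset_sharpP : SharpFO ⊆ SharpP := by
  rintro f ⟨σ, k, l, a, φ, hf, hv⟩
  -- There are finitely many structures with one element, so finitely many auxiliary relations
  -- suffice for all of them.
  obtain ⟨K, hK⟩ : ∃ K, ∀ b, f (enc (unitStruc σ b)) ≤ K := by
    obtain ⟨K, hK⟩ := (Set.finite_range fun b => f (enc (unitStruc σ b))).bddAbove
    exact ⟨K, fun b => hK ⟨b, rfl⟩⟩
  obtain ⟨χ, hχ1, hχ2⟩ := exists_tables_formula f K φ
  obtain ⟨M, hM, hM0, hM1⟩ := exists_NTM_count_tables Sym.kind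
    (r := (Sym.arity a : Sym σ k l K → ℕ)) (by
      intro j j' h
      cases j <;> simp [Sym.kind] at h
      subst h
      rfl) (by intro j; cases j <;> simp [Sym.kind])
    (Sym.order σ k l K) Sym.nodup_order Sym.mem_order Sym.pairwise_order χ (f [])
  refine ⟨M, hM, fun w => ?_⟩
  by_cases hw : w = []
  · rw [hw, hM0]
  rw [hM1 w hw]
  have hset : {q : Σ n, Tables (Sym.arity a : Sym σ k l K → ℕ) n | 1 ≤ q.1 ∧ q.1 ≤ w.length ∧
      w = (Sym.order σ k l K).flatMap (tableInput Sym.kind q.2) ∧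
      (∀ j, MaskOK Sym.kind q.2 j) ∧ JRealize q.2 χ default default} =
      (fun I : Assignment σ a l K => ⟨I.A.n, I.tables⟩) '' {I | enc I.A = w ∧
        (UnitChoice f I.tables ∨ Proper I.tables ∧
          @FirstOrder.Language.Formula.Realize _ _ (funInterp I.A I.F) _ φ I.c)} := by
    ext ⟨n, G⟩
    simp only [Set.mem_ofPred_eq, Set.mem_image]
    constructor
    · rintro ⟨h1, h2, h3, h4, h5⟩
      obtain ⟨e, F, c, hG⟩ := (hχ1 n G h5).exists_render h1
      refine ⟨⟨⟨n, h1, fun i => G (.rel i), e⟩, F, c, fun i => G (.aux i)⟩, ⟨?_, ?_⟩, ?_⟩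
      · rw [h3, hG]
        exact (flatMap_tableInput_render _ _ _ _).symm
      · refine (hχ2 _).1 ?_
        have : JRealize G χ default default := h5
        rwa [hG] at this
      · exact congrArg (Sigma.mk n) hG.symm
    · rintro ⟨I, ⟨h1, h2⟩, h3⟩
      obtain ⟨rfl, h4⟩ := Sigma.mk.inj_iff.1 h3
      obtain rfl := eq_of_heq h4
      refine ⟨I.A.n_pos, ?_, ?_, maskOK_render _ _ _ _, (hχ2 I).2 h2⟩
      · rw [← h1]
        exact le_enc_length _
      · rw [← h1]
        exact (flatMap_tableInput_render _ _ _ _).symm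
  rw [hset, Assignment.tables_injective.injOn.encard_image]
  by_cases hA : ∃ A : Struc σ, enc A = w
  · obtain ⟨A, hA⟩ := hA
    by_cases hn : 2 ≤ A.n
    · have hset2 : {I : Assignment σ a l K | enc I.A = w ∧ (UnitChoice f I.tables ∨
          Proper I.tables ∧
            @FirstOrder.Language.Formula.Realize _ _ (funInterp I.A I.F) _ φ I.c)} =
          (fun p : (∀ j, (Fin (a j) → Fin A.n) → Fin A.n) × (Fin l → Fin A.n) =>
            (⟨A, p.1, p.2, fun _ => ∅⟩ : Assignment σ a l K)) ''
          {p | @FirstOrder.Language.Formula.Realize _ _ (funInterp A p.1) _ φ p.2} := by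
        ext I
        simp only [Set.mem_ofPred_eq, Set.mem_image]
        have hne : (⟨0, by omega⟩ : Fin A.n) ≠ ⟨1, hn⟩ := by simp
        constructor
        · rintro ⟨h1, h2⟩
          obtain ⟨A', F, c, X⟩ := I
          obtain rfl := enc_injective σ (hA.trans h1.symm)
          rcases h2 with h2 | ⟨h2, h3⟩
          · exact absurd (h2.1 _ _) hne
          · refine ⟨(F, c), h3, ?_⟩
            congr 1
            funext i
            exact (Set.eq_empty_of_forall_notMem (h2.2 i)).symm
        · rintro ⟨p, h, rfl⟩
          exact ⟨hA, Or.inr ⟨⟨⟨_, _, hne⟩, fun i u h => h⟩, h⟩⟩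
      rw [hset2, Set.InjOn.encard_image, ← Set.Finite.cast_ncard_eq (Set.toFinite _), ← hA,
        hf A hn, funCount]
      rintro ⟨F, c⟩ - ⟨F', c'⟩ - h
      simpa using h
    · have hn1 : A.n = 1 := by have := A.n_pos; omega
      have hb : ∀ i, (∃ u, u ∈ A.rel i) ↔ decide (∃ u, u ∈ A.rel i) = true := by simp
      have hAb := A.eq_unitStruc hn1 hb
      set b := fun i => decide (∃ u, u ∈ A.rel i)
      rw [hAb] at hA
      have hwK : f w ≤ K := (congrArg f hA).symm.trans_le (hK b)
      -- With one element there is just one choice of functions and individuals; the `f w`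
      -- assignments differ only in which auxiliary relation is full.
      have hset2 : {I : Assignment σ a l K | enc I.A = w ∧ (UnitChoice f I.tables ∨
          Proper I.tables ∧
            @FirstOrder.Language.Formula.Realize _ _ (funInterp I.A I.F) _ φ I.c)} =
          (fun p : Fin (f w) => (⟨unitStruc σ b, fun _ _ => (0 : Fin 1), fun _ => (0 : Fin 1),
            fun i => {_u | i = Fin.castLE hwK p}⟩ : Assignment σ a l K)) '' Set.univ := by
        ext I
        simp only [Set.mem_ofPred_eq, Set.mem_image, Set.mem_univ, true_and]
        constructor
        · rintro ⟨h1, h2⟩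
          obtain ⟨A', F, c, X⟩ := I
          obtain rfl := enc_injective σ (hA.trans h1.symm)
          rcases h2 with ⟨-, b', hb', i, hi, h3⟩ | ⟨⟨⟨x, y, h2⟩, -⟩, -⟩
          · have := Struc.eq_unitStruc (unitStruc σ b) rfl hb'
            rw [← this, hA] at hi
            refine ⟨⟨i, hi⟩, ?_⟩
            congr 1
            · funext j x
              exact Subsingleton.elim (α := Fin 1) _ _
            · funext j
              exact Subsingleton.elim (α := Fin 1) _ _
            · funext i'
              ext u
              refine Iff.trans (Iff.trans ?_ (h3 i').symm) ⟨?_, fun hu => ⟨u, hu⟩⟩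
              · exact Iff.rfl
              · rintro ⟨u', hu'⟩
                have : u = u' := Subsingleton.elim (α := Fin 1 → Fin 1) _ _
                rwa [this]
          · exact absurd (Subsingleton.elim (α := Fin 1) x y) h2
        · rintro ⟨p, rfl⟩
          refine ⟨hA, Or.inl ⟨Subsingleton.elim (α := Fin 1), b, fun i => ?_, Fin.castLE hwK p,
            ?_, fun i' => ?_⟩⟩
          · exact ⟨fun ⟨u, hu⟩ => hu, fun h => ⟨fun _ => (0 : Fin 1), h⟩⟩
          · exact p.2.trans_eq (congrArg f hA.symm)
          · exact ⟨fun ⟨u, hu⟩ => hu, fun h => ⟨fun _ => (0 : Fin 1), h⟩⟩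
      rw [hset2, Set.InjOn.encard_image]
      · simp
      · intro p _ p' _ h
        have h1 : (fun i => {_u : Fin 1 → Fin 1 | i = Fin.castLE hwK p}) =
            fun i => {_u : Fin 1 → Fin 1 | i = Fin.castLE hwK p'} := by
          exact eq_of_heq (Assignment.mk.inj h).2.2.2
        have h2 := Set.ext_iff.1 (congrFun h1 (Fin.castLE hwK p)) fun _ => 0
        simpa using h2
  -- The word encodes no structure: there is no accepting path, and `f` vanishes by assumption.
  · have : {I : Assignment σ a l K | enc I.A = w ∧ (UnitChoice f I.tables ∨ Proper I.tables ∧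
          @FirstOrder.Language.Formula.Realize _ _ (funInterp I.A I.F) _ φ I.c)} = ∅ :=
      Set.eq_empty_of_forall_notMem fun I hI => hA ⟨I.A, hI.1⟩
    rw [this, hv w hw fun A h => hA ⟨A, h⟩]
    simp

end

/-! ### Tableaux of computations -/

instance : Finite Move := by
  refine Finite.of_injective (β := Fin 3) (fun m => match m with
    | .left => 0
    | .stay => 1
    | .right => 2) ?_
  intro m m' h
  cases m <;> cases m' <;> simp at h <;> rfl

namespace NTM

variable (M : NTM)

instance : Finite M.Q := M.finQ
instance : Finite M.Γ := M.finΓ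

/-- The information about one position: the state, and for each tape the symbol at that position
and whether the head is there. -/
abbrev Label : Type := M.Q × (Fin (M.k + 1) → M.Γ × Bool)

variable {M}

/-- The label of a position in a configuration. -/
noncomputable def Cfg.label (c : M.Cfg) (z : ℤ) : M.Label :=
  (c.state, fun i => (c.tape i z, decide (c.head i = z)))

variable {P : Type} {N : ℕ} (val : P ≃ Fin N) (C : ℕ) (S : M.Label → P → P → Prop)

/-- The slice of a tableau at some time describes the given configuration, or is empty. -/
def SliceIs (t : P) (o : Option M.Cfg) : Prop :=
  ∀ x l, S l t x ↔ ∃ c, o = some c ∧ l = c.label ((val x : ℤ) - C)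

/-- The slice of a tableau at some time is empty. -/
def SliceEmpty (t : P) : Prop := ∀ l x, ¬ S l t x

/-- In a slice of a tableau, the state is `q` and the symbols under the heads are `s`. -/
def SliceScan (t : P) (q : M.Q) (s : Fin (M.k + 1) → M.Γ) : Prop :=
  ∀ i, ∃ x y, S (q, y) t x ∧ y i = (s i, true)

/-- The slice at time `t'` results from that at time `t` by the action `a` in state `q`. -/
def SliceAfter (t t' : P) (q : M.Q)
    (a : M.Q × (Fin (M.k + 1) → M.Γ) × (Fin (M.k + 1) → Move)) : Prop :=
  ∀ l x, S l t' x ↔ ∃ y, S (q, y) t x ∧ l.1 = a.1 ∧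
    ∀ i, (l.2 i).1 = (if (y i).2 = true then a.2.1 i else (y i).1) ∧
      ((l.2 i).2 = true ↔ ∃ x' y', (val x : ℤ) = val x' + (a.2.2 i).shift ∧
        S (q, y') t x' ∧ (y' i).2 = true)

/-- The slice at time `t'` results from that at time `t` by a computation step. -/
def SliceStep (t t' : P) : Prop :=
  ∃ q s a, a ∈ M.δ q s ∧ SliceScan S t q s ∧ SliceAfter val S t t' q a

/-- The slice at time `t` describes a configuration that is halted and accepting. -/
def SliceAccept (t : P) : Prop :=
  ∃ q s, q ∈ M.accept ∧ M.δ q s = ∅ ∧ SliceScan S t q s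

/-- The tableau of an accepting computation path on input `w`. -/
def IsTableau (w : List Bool) : Prop :=
  (∀ t, (val t : ℕ) = 0 → SliceIs val C S t (some (M.init w))) ∧
  (∀ t t', (val t' : ℕ) = val t + 1 →
    SliceStep val S t t' ∨ SliceEmpty S t' ∧ (SliceEmpty S t ∨ SliceAccept S t)) ∧
  ∀ t, (∀ t', val t' ≤ val t) → SliceEmpty S t

variable {val C S}

theorem sliceIs_none {t : P} : SliceIs val C S t none ↔ SliceEmpty S t :=
  ⟨fun h l x hl => by simpa using (h x l).1 hl, fun h x l => by simp [h l x]⟩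

/-- All heads are within the part of the tape that a tableau describes. -/
def Cfg.Inside (c : M.Cfg) (C N : ℕ) : Prop :=
  ∀ i, -(C : ℤ) ≤ c.head i ∧ c.head i < (N : ℤ) - C

theorem exists_val_eq (val : P ≃ Fin N) {z : ℤ} (h1 : -(C : ℤ) ≤ z) (h2 : z < (N : ℤ) - C) :
    ∃ x, (val x : ℤ) - C = z := by
  refine ⟨val.symm ⟨(z + C).toNat, by omega⟩, ?_⟩
  rw [Equiv.apply_symm_apply]
  simp only
  omega

theorem SliceIs.apply {t : P} {c : M.Cfg} (h : SliceIs val C S t (some c)) (l : M.Label) (x : P) :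
    S l t x ↔ l = c.label ((val x : ℤ) - C) :=
  (h x l).trans ⟨fun ⟨_, h1, h2⟩ => by cases h1; exact h2, fun h => ⟨c, rfl, h⟩⟩

/-- A symbol whose label carries the head flag is the one being read. `Inside` ensures that each
head is visible in the slice. -/
theorem sliceScan_iff {t : P} {c : M.Cfg} (h : SliceIs val C S t (some c)) (hc : c.Inside C N)
    (q : M.Q) (s : Fin (M.k + 1) → M.Γ) :
    SliceScan S t q s ↔ q = c.state ∧ s = fun i => c.tape i (c.head i) := by
  simp only [SliceScan, h.apply]
  constructor
  · intro h'
    constructor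
    · obtain ⟨x, y, hy, -⟩ := h' 0
      exact congrArg Prod.fst hy
    · funext i
      obtain ⟨x, y, hy, hi⟩ := h' i
      have h2 : y = (c.label ((val x : ℤ) - C)).2 := congrArg Prod.snd hy
      rw [h2] at hi
      simp only [Cfg.label, Prod.mk.injEq, decide_eq_true_eq] at hi
      rw [← hi.1, ← hi.2]
  · rintro ⟨rfl, rfl⟩ i
    obtain ⟨x, hx⟩ := exists_val_eq val (hc i).1 (hc i).2
    exact ⟨x, _, rfl, by simp [hx]⟩

/-- Locality of computation steps: the new symbol at a position depends on the old label there, and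
a head is at a position if and only if it was one movement away. Since all old heads are inside the
described window, none is overlooked; the new ones may leave it. -/
theorem sliceAfter_iff {t t' : P} {c : M.Cfg} (h : SliceIs val C S t (some c))
    (hc : c.Inside C N) (a : M.Q × (Fin (M.k + 1) → M.Γ) × (Fin (M.k + 1) → Move)) :
    SliceAfter val S t t' c.state a ↔ SliceIs val C S t' (some (c.after a)) := by
  have key : ∀ (l : M.Label) (x : P), (∃ y, S (c.state, y) t x ∧ l.1 = a.1 ∧
      ∀ i, (l.2 i).1 = (if (y i).2 = true then a.2.1 i else (y i).1) ∧
        ((l.2 i).2 = true ↔ ∃ x' y', (val x : ℤ) = val x' + (a.2.2 i).shift ∧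
          S (c.state, y') t x' ∧ (y' i).2 = true)) ↔
      l = (c.after a).label ((val x : ℤ) - C) := by
    rintro ⟨q, l⟩ x
    simp only [h.apply]
    have hh : ∀ i, (∃ x' y', (val x : ℤ) = val x' + (a.2.2 i).shift ∧
        (c.state, y') = c.label ((val x' : ℤ) - C) ∧ (y' i).2 = true) ↔
        c.head i + (a.2.2 i).shift = (val x : ℤ) - C := by
      intro i
      constructor
      · rintro ⟨x', y', h1, h2, h3⟩
        have h4 : y' = (c.label ((val x' : ℤ) - C)).2 := congrArg Prod.snd h2
        rw [h4] at h3
        simp only [Cfg.label, decide_eq_true_eq] at h3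
        omega
      · intro h1
        obtain ⟨x', hx'⟩ := exists_val_eq val (hc i).1 (hc i).2
        exact ⟨x', _, by omega, rfl, by simp [hx']⟩
    have hw : ∀ i, ((c.after a).tape i ((val x : ℤ) - C)) =
        if ((c.label ((val x : ℤ) - C)).2 i).2 = true then a.2.1 i
        else ((c.label ((val x : ℤ) - C)).2 i).1 := by
      intro i
      by_cases hz : c.head i = (val x : ℤ) - C
      · simp [Cfg.label, Cfg.after, hz]
      · simp [Cfg.label, Cfg.after, hz, Function.update_of_ne (Ne.symm hz)]
    simp only [hh]
    constructor
    · rintro ⟨y, h1, h2, h3⟩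
      have h4 : y = (c.label ((val x : ℤ) - C)).2 := congrArg Prod.snd h1
      refine Prod.ext h2 (funext fun i => Prod.ext ?_ ?_)
      · change (l i).1 = _
        rw [(h3 i).1, h4]
        exact (hw i).symm
      · change (l i).2 = decide _
        rw [Bool.eq_iff_iff, decide_eq_true_iff]
        exact (h3 i).2
    · intro h1
      obtain ⟨rfl, rfl⟩ := Prod.mk.inj h1
      refine ⟨_, rfl, rfl, fun i => ⟨?_, ?_⟩⟩
      · exact hw i
      · exact decide_eq_true_iff
  constructor
  · intro h' x l
    rw [h' l x, key]
    exact ⟨fun h => ⟨_, rfl, h⟩, fun ⟨_, h1, h2⟩ => by cases h1; exact h2⟩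
  · intro h' l x
    rw [key, h'.apply]

theorem sliceStep_iff {t t' : P} {c : M.Cfg} (h : SliceIs val C S t (some c))
    (hc : c.Inside C N) :
    SliceStep val S t t' ↔ ∃ d, M.Step c d ∧ SliceIs val C S t' (some d) := by
  constructor
  · rintro ⟨q, s, a, ha, h1, h2⟩
    obtain ⟨rfl, rfl⟩ := (sliceScan_iff h hc q s).1 h1
    exact ⟨_, ⟨a, ha, rfl⟩, (sliceAfter_iff h hc a).1 h2⟩
  · rintro ⟨_, ⟨a, ha, rfl⟩, h'⟩
    exact ⟨_, _, a, ha, (sliceScan_iff h hc _ _).2 ⟨rfl, rfl⟩, (sliceAfter_iff h hc a).2 h'⟩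

theorem sliceAccept_iff {t : P} {c : M.Cfg} (h : SliceIs val C S t (some c))
    (hc : c.Inside C N) :
    SliceAccept S t ↔ (∀ d, ¬ M.Step c d) ∧ c.state ∈ M.accept := by
  constructor
  · rintro ⟨q, s, h1, h2, h3⟩
    obtain ⟨rfl, rfl⟩ := (sliceScan_iff h hc q s).1 h3
    refine ⟨?_, h1⟩
    rintro d ⟨a, ha, -⟩
    rw [h2] at ha
    exact ha
  · rintro ⟨h1, h2⟩
    exact ⟨_, _, h2, Set.eq_empty_of_forall_notMem fun a ha => h1 _ ⟨a, ha, rfl⟩,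
      (sliceScan_iff h hc _ _).2 ⟨rfl, rfl⟩⟩

theorem SliceEmpty.not_scan {t : P} (h : SliceEmpty S t) (q : M.Q) (s : Fin (M.k + 1) → M.Γ) :
    ¬ SliceScan S t q s := fun h' => by
  obtain ⟨x, y, hy, -⟩ := h' 0
  exact h _ _ hy

/-- Labels show only a window of the tapes. Two successors of the same configuration can differ only
in the state, in the cells under the old heads and in the new head positions, and all of these are
visible in the window. -/
theorem after_eq_of_label_eq (val : P ≃ Fin N) {c : M.Cfg}
    {a a' : M.Q × (Fin (M.k + 1) → M.Γ) × (Fin (M.k + 1) → Move)}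
    (hc : c.Inside C N) (hd : (c.after a).Inside C N)
    (h : ∀ x, (c.after a).label ((val x : ℤ) - C) = (c.after a').label ((val x : ℤ) - C)) :
    c.after a = c.after a' := by
  ext1
  · obtain ⟨x, -⟩ := exists_val_eq val (hc 0).1 (hc 0).2
    have h1 := congrArg Prod.fst (h x)
    exact h1
  · funext i
    obtain ⟨x, hx⟩ := exists_val_eq val (hd i).1 (hd i).2
    have h1 := congrArg Prod.snd (congrFun (congrArg Prod.snd (h x)) i)
    simp only [Cfg.label, hx, decide_true] at h1
    exact (of_decide_eq_true h1.symm).symm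
  · funext i
    obtain ⟨x, hx⟩ := exists_val_eq val (hc i).1 (hc i).2
    have h1 := congrArg Prod.fst (congrFun (congrArg Prod.snd (h x)) i)
    simp only [Cfg.label, hx, Cfg.after, Function.update_self] at h1
    simp only [Cfg.after, h1]

theorem head_le_of_isComputation {w : List Bool} {p : List M.Cfg} (hp : M.IsComputation w p)
    (j : ℕ) (c : M.Cfg) (hj : (M.init w :: p)[j]? = some c) (i : Fin (M.k + 1)) :
    -(j : ℤ) ≤ c.head i ∧ c.head i ≤ j := by
  induction j generalizing c with
  | zero =>
    obtain rfl : M.init w = c := by simpa using hj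
    simp [init]
  | succ j ih =>
    obtain ⟨hlt, rfl⟩ := List.getElem?_eq_some_iff.1 hj
    obtain ⟨a, -, h⟩ := List.IsChain.getElem hp j hlt
    have h1 := ih (M.init w :: p)[j] (List.getElem?_eq_getElem _)
    rw [h]
    have h2 : (Cfg.after (M.init w :: p)[j] a).head i =
        (M.init w :: p)[j].head i + (a.2.2 i).shift := rfl
    have h3 : -1 ≤ (a.2.2 i).shift ∧ (a.2.2 i).shift ≤ 1 := by
      cases a.2.2 i <;> simp [Move.shift]
    rw [h2]
    push_cast
    omega

theorem inside_of_isComputation {w : List Bool}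
    (hC : ∀ p : List M.Cfg, M.IsComputation w p → p.length < C) (hN : 2 * C ≤ N)
    {p : List M.Cfg} (hp : M.IsComputation w p) {j : ℕ} {c : M.Cfg}
    (hj : (M.init w :: p)[j]? = some c) : c.Inside C N := by
  intro i
  have h1 := head_le_of_isComputation hp j c hj i
  have h2 := (List.getElem?_eq_some_iff.1 hj).1
  have h3 := hC p hp
  rw [List.length_cons] at h2
  omega

/-- The tableau of a computation. -/
def tableau (val : P ≃ Fin N) (C : ℕ) (w : List Bool) (p : List M.Cfg) :
    M.Label → P → P → Prop :=
  fun l t x => ∃ c, (M.init w :: p)[(val t : ℕ)]? = some c ∧ l = c.label ((val x : ℤ) - C)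

theorem sliceIs_tableau (val : P ≃ Fin N) (C : ℕ) (w : List Bool) (p : List M.Cfg) (t : P) :
    SliceIs val C (tableau val C w p) t (M.init w :: p)[(val t : ℕ)]? := fun _ _ => Iff.rfl

theorem last_eq_getElem (w : List Bool) (p : List M.Cfg) :
    (M.init w :: p)[p.length]? = some (M.last w p) := by
  rw [last, List.getLast_eq_getElem]
  simp

theorem isTableau_tableau {w : List Bool}
    (hC : ∀ p : List M.Cfg, M.IsComputation w p → p.length < C) (hN : 2 * C ≤ N)
    {p : List M.Cfg} (hp : M.IsAcceptingPath w p) : IsTableau val C (tableau val C w p) w := by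
  have hlen := hC p hp.1
  refine ⟨fun t ht => ?_, fun t t' htt => ?_, fun t ht => ?_⟩
  · have := sliceIs_tableau val C w p t
    rwa [ht] at this
  · have h1 := sliceIs_tableau val C w p t
    have h2 := sliceIs_tableau val C w p t'
    rw [htt] at h2
    rcases lt_trichotomy (val t : ℕ) p.length with hlt | heq | hlt
    · left
      have g1 : (val t : ℕ) < (M.init w :: p).length := by simp; omega
      have g2 : (val t : ℕ) + 1 < (M.init w :: p).length := by simp; omega
      have e1 := List.getElem?_eq_getElem g1
      have e2 := List.getElem?_eq_getElem g2
      have hin := inside_of_isComputation hC hN hp.1 e1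
      rw [e1] at h1
      rw [e2] at h2
      exact (sliceStep_iff h1 hin).2 ⟨_, List.IsChain.getElem hp.1 _ g2, h2⟩
    · right
      rw [heq, List.getElem?_eq_none (by simp)] at h2
      rw [heq, last_eq_getElem] at h1
      have hin := inside_of_isComputation hC hN hp.1 (last_eq_getElem w p)
      exact ⟨sliceIs_none.1 h2, Or.inr ((sliceAccept_iff h1 hin).2 hp.2)⟩
    · right
      rw [List.getElem?_eq_none (by simp; omega)] at h1 h2
      exact ⟨sliceIs_none.1 h2, Or.inl (sliceIs_none.1 h1)⟩
  -- The last time is `N - 1 ≥ C > p.length`, when the computation is over.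
  · have h1 := sliceIs_tableau val C w p t
    have h2 := ht (val.symm ⟨N - 1, by omega⟩)
    rw [Equiv.apply_symm_apply, Fin.le_def] at h2
    dsimp only at h2
    rw [List.getElem?_eq_none (by simp; omega)] at h1
    exact sliceIs_none.1 h1

/-- Induction on the time `T`: the slices up to `T` are those of a computation with at most `T`
steps, which has accepted if it has fewer. A nonempty slice either is continued by a step or has to
be accepting; an empty slice permits only empty ones after it. -/
theorem exists_path_of_isTableau {w : List Bool}
    (hC : ∀ p : List M.Cfg, M.IsComputation w p → p.length < C) (hN : 2 * C ≤ N)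
    (hS : IsTableau val C S w) : ∃ p, M.IsAcceptingPath w p ∧ tableau val C w p = S := by
  obtain ⟨h0, h1, h2⟩ := hS
  have hpos : 0 < C := Nat.zero_lt_of_lt (hC [] (List.isChain_singleton _))
  have key : ∀ T, T < N → ∃ p, M.IsComputation w p ∧ p.length ≤ T ∧
      (∀ t, (val t : ℕ) ≤ T → SliceIs val C S t (M.init w :: p)[(val t : ℕ)]?) ∧
      (p.length < T → M.IsAcceptingPath w p) := by
    intro T
    induction T with
    | zero =>
      intro _
      refine ⟨[], List.isChain_singleton _, le_rfl, fun t ht => ?_, fun h => absurd h (by simp)⟩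
      have ht : (val t : ℕ) = 0 := by omega
      rw [ht]
      exact h0 t ht
    | succ T ih =>
      intro hT
      obtain ⟨p, hp1, hp2, hp3, hp4⟩ := ih (by omega)
      obtain ⟨t, ht⟩ : ∃ t, (val t : ℕ) = T := ⟨val.symm ⟨T, by omega⟩, by simp⟩
      obtain ⟨t', ht'⟩ : ∃ t, (val t : ℕ) = T + 1 := ⟨val.symm ⟨T + 1, hT⟩, by simp⟩
      have hlast : ∀ u, (val u : ℕ) ≤ T + 1 → (val u : ℕ) ≤ T ∨ u = t' := by
        intro u hu
        by_cases h : (val u : ℕ) ≤ T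
        · exact Or.inl h
        · exact Or.inr (val.injective (Fin.ext (by omega)))
      have hst := hp3 t ht.le
      have hstep := h1 t t' (by omega)
      rw [ht] at hst
      rcases hp2.lt_or_eq with hlt | heq
      · rw [List.getElem?_eq_none (by simp; omega), sliceIs_none] at hst
        have hemp : SliceEmpty S t' := by
          rcases hstep with ⟨q, s, a, -, hs, -⟩ | ⟨h, -⟩
          · exact absurd hs (hst.not_scan q s)
          · exact h
        refine ⟨p, hp1, by omega, fun u hu => ?_, fun _ => hp4 hlt⟩
        rcases hlast u hu with hu | rfl
        · exact hp3 u hu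
        · rw [ht', List.getElem?_eq_none (by simp; omega)]
          exact sliceIs_none.2 hemp
      · have hin := inside_of_isComputation hC hN hp1 (last_eq_getElem w p)
        rw [← heq, last_eq_getElem] at hst
        rcases hstep with hstep | ⟨hemp, hacc⟩
        · obtain ⟨d, hd1, hd2⟩ := (sliceStep_iff hst hin).1 hstep
          refine ⟨p ++ [d], ?_, by simp [heq], fun u hu => ?_, fun h => absurd h (by simp [heq])⟩
          · rw [IsComputation, ← List.cons_append, List.isChain_append]
            refine ⟨hp1, List.isChain_singleton _, ?_⟩
            intro x hx y hy
            obtain rfl : d = y := by simpa using hy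
            rw [List.getLast?_eq_some_getLast (List.cons_ne_nil _ _)] at hx
            obtain rfl : M.last w p = x := by simpa [last] using hx
            exact hd1
          · rw [← List.cons_append]
            rcases hlast u hu with hu | rfl
            · rw [List.getElem?_append_left (by simp; omega)]
              exact hp3 u hu
            · rw [ht', List.getElem?_append_right (by simp; omega)]
              simpa [heq] using hd2
        · refine ⟨p, hp1, by omega, fun u hu => ?_, fun _ => ⟨hp1, ?_⟩⟩
          · rcases hlast u hu with hu | rfl
            · exact hp3 u hu
            · rw [ht', List.getElem?_eq_none (by simp; omega)]
              exact sliceIs_none.2 hemp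
          · rcases hacc with hacc | hacc
            · exfalso
              obtain ⟨x, -⟩ := exists_val_eq val (hin 0).1 (hin 0).2
              exact hacc _ x ((hst.apply _ x).2 rfl)
            · exact (sliceAccept_iff hst hin).1 hacc
  -- Computations have fewer than `C ≤ N - 1` steps, so at time `N - 1` the computation has already
  -- accepted.
  obtain ⟨p, hp1, hp2, hp3, hp4⟩ := key (N - 1) (by omega)
  have hlen := hC p hp1
  refine ⟨p, hp4 (by omega), ?_⟩
  funext l t x
  exact propext (hp3 t (by have := (val t).2; omega) x l).symm

/-- Induction on time. A configuration exists at a given time if and only if the slice is nonempty,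
and the next configurations agree by `after_eq_of_label_eq` as the present ones do. -/
theorem tableau_injOn {w : List Bool}
    (hC : ∀ p : List M.Cfg, M.IsComputation w p → p.length < C) (hN : 2 * C ≤ N) :
    Set.InjOn (tableau val C w) {p : List M.Cfg | M.IsComputation w p} := by
  intro p hp p' hp' h
  have hpos : 0 < C := Nat.zero_lt_of_lt (hC [] (List.isChain_singleton _))
  have hl := hC p hp
  have hl' := hC p' hp'
  have key : ∀ j : ℕ, (M.init w :: p)[j]? = (M.init w :: p')[j]? := by
    intro j
    induction j with
    | zero => rfl
    | succ j ih =>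
      by_cases hj : j + 1 < N
      · have h1 := sliceIs_tableau val C w p (val.symm ⟨j + 1, hj⟩)
        have h2 := sliceIs_tableau val C w p' (val.symm ⟨j + 1, hj⟩)
        rw [h] at h1
        simp only [Equiv.apply_symm_apply] at h1 h2
        have x0 : P := val.symm ⟨0, by omega⟩
        rcases e1 : (M.init w :: p)[j + 1]? with _ | d <;>
          rcases e2 : (M.init w :: p')[j + 1]? with _ | d' <;> rw [e1] at h1 <;> rw [e2] at h2
        · exact absurd ((h2.apply _ x0).2 rfl) (sliceIs_none.1 h1 _ _)
        · exact absurd ((h1.apply _ x0).2 rfl) (sliceIs_none.1 h2 _ _)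
        · have hin := inside_of_isComputation hC hN hp e1
          obtain ⟨g1, rfl⟩ := List.getElem?_eq_some_iff.1 e1
          obtain ⟨g2, rfl⟩ := List.getElem?_eq_some_iff.1 e2
          obtain ⟨a, -, ha⟩ := List.IsChain.getElem hp j g1
          obtain ⟨a', -, ha'⟩ := List.IsChain.getElem hp' j g2
          rw [List.getElem?_eq_getElem (by omega), List.getElem?_eq_getElem (by omega)] at ih
          have ih := Option.some.inj ih
          have hin0 := inside_of_isComputation hC hN hp
            (List.getElem?_eq_getElem (show j < (M.init w :: p).length by omega))
          rw [ha] at hin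
          rw [ha, ha', ← ih]
          refine congrArg some (after_eq_of_label_eq val hin0 hin fun x => ?_)
          rw [← ha, ih, ← ha']
          exact (h2.apply _ x).1 ((h1.apply _ x).2 rfl)
      · rw [List.getElem?_eq_none (by simp; omega), List.getElem?_eq_none (by simp; omega)]
  exact (List.cons.inj (List.ext_getElem? key)).2

theorem encard_isTableau (val : P ≃ Fin N) {w : List Bool}
    (hC : ∀ p : List M.Cfg, M.IsComputation w p → p.length < C) (hN : 2 * C ≤ N) :
    {S : M.Label → P → P → Prop | IsTableau val C S w}.encard =
      {p | M.IsAcceptingPath w p}.encard := by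
  have : {S : M.Label → P → P → Prop | IsTableau val C S w} =
      tableau val C w '' {p | M.IsAcceptingPath w p} := by
    ext S
    constructor
    · exact exists_path_of_isTableau hC hN
    · rintro ⟨p, hp, rfl⟩
      exact isTableau_tableau hC hN hp
  rw [this, Set.InjOn.encard_image]
  exact (tableau_injOn hC hN).mono fun p hp => hp.1

end NTM

/-! ### Numbers with several digits -/

section Digits

variable {n : ℕ}

/-- The number with the given digits, the last one being the most significant. -/
def digitVal {D : ℕ} (u : Fin D → Fin n) : ℕ := finFunctionFinEquiv u

theorem digitVal_eq_sum {D : ℕ} (u : Fin D → Fin n) :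
    digitVal u = ∑ i, (u i : ℕ) * n ^ (i : ℕ) := finFunctionFinEquiv_apply u

theorem digitVal_injective {D : ℕ} : Function.Injective (digitVal : (Fin D → Fin n) → ℕ) :=
  fun _ _ h => finFunctionFinEquiv.injective (Fin.ext h)

/-- Comparison of numbers at the most significant digit where they differ. -/
def DigitLT {D : ℕ} (u v : Fin D → Fin n) : Prop := ∃ i, u i < v i ∧ ∀ j, i < j → u j = v j

theorem digitVal_succ {D : ℕ} (u : Fin (D + 1) → Fin n) :
    digitVal u = u 0 + n * digitVal fun i => u i.succ := by
  rw [digitVal_eq_sum, digitVal_eq_sum, Fin.sum_univ_succ, Finset.mul_sum]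
  simp only [Fin.val_zero, pow_zero, mul_one, Fin.val_succ, pow_succ]
  congr 1
  exact Finset.sum_congr rfl fun i _ => by ring

theorem digitVal_lt_of_digitLT {D : ℕ} {u v : Fin D → Fin n} (h : DigitLT u v) :
    digitVal u < digitVal v := by
  induction D with
  | zero => exact h.elim fun i => i.elim0
  | succ D ih =>
    obtain ⟨i, hi, h⟩ := h
    rw [digitVal_succ, digitVal_succ]
    cases i using Fin.cases with
    | zero =>
      have : (fun i : Fin D => u i.succ) = fun i => v i.succ :=
        funext fun i => h _ (Fin.succ_pos i)
      rw [this]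
      have : (u 0 : ℕ) < v 0 := hi
      omega
    | succ i =>
      have h1 := ih (u := fun i => u i.succ) (v := fun i => v i.succ)
        ⟨i, hi, fun j hj => h _ (Fin.succ_lt_succ_iff.2 hj)⟩
      have h2 : n * ((digitVal fun i => u i.succ) + 1) ≤ n * digitVal fun i => v i.succ :=
        Nat.mul_le_mul le_rfl h1
      have h3 := (u 0).2
      rw [mul_add, mul_one] at h2
      omega

theorem digitLT_trichotomy {D : ℕ} (u v : Fin D → Fin n) : DigitLT u v ∨ u = v ∨ DigitLT v u := by
  by_cases h : u = v
  · exact Or.inr (Or.inl h)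
  · have hne : (Finset.univ.filter fun i => u i ≠ v i).Nonempty := by
      obtain ⟨i, hi⟩ := Function.ne_iff.1 h
      exact ⟨i, by simpa using hi⟩
    have h1 := Finset.max'_mem _ hne
    have h2 : ∀ j, (Finset.univ.filter fun i => u i ≠ v i).max' hne < j → u j = v j := by
      intro j hj
      by_contra hj'
      exact absurd (Finset.le_max' _ j (by simpa using hj')) (not_le.2 hj)
    rcases lt_or_gt_of_ne (Finset.mem_filter.1 h1).2 with h3 | h3
    · exact Or.inl ⟨_, h3, h2⟩
    · exact Or.inr (Or.inr ⟨_, h3, fun j hj => (h2 j hj).symm⟩)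

theorem digitLT_iff {D : ℕ} {u v : Fin D → Fin n} : DigitLT u v ↔ digitVal u < digitVal v := by
  refine ⟨digitVal_lt_of_digitLT, fun h => ?_⟩
  rcases digitLT_trichotomy u v with h1 | rfl | h1
  · exact h1
  · exact absurd h (lt_irrefl _)
  · exact absurd h (digitVal_lt_of_digitLT h1).not_gt

theorem exists_digitVal_eq {D : ℕ} {m : ℕ} (hm : m < n ^ D) : ∃ u : Fin D → Fin n, digitVal u = m :=
  ⟨finFunctionFinEquiv.symm ⟨m, hm⟩, by simp [digitVal]⟩

theorem digitVal_lt {D : ℕ} (u : Fin D → Fin n) : digitVal u < n ^ D := Fin.is_lt _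

/-- Every number below `n ^ D` is written by some digits, so a gap would be filled by some `w`. Thus
successors are definable from the order. -/
theorem digitVal_eq_add_one_iff {D : ℕ} (u v : Fin D → Fin n) :
    digitVal v = digitVal u + 1 ↔ DigitLT u v ∧ ∀ w, ¬ (DigitLT u w ∧ DigitLT w v) := by
  simp only [digitLT_iff]
  constructor
  · intro h
    exact ⟨by omega, fun w => by omega⟩
  · rintro ⟨h1, h2⟩
    by_contra h3
    obtain ⟨w, hw⟩ := exists_digitVal_eq (n := n) (D := D) (m := digitVal u + 1)
      (by have := digitVal_lt v; omega)
    exact h2 w (by omega)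

theorem digitVal_eq_zero_iff {D : ℕ} (u : Fin D → Fin n) : digitVal u = 0 ↔ ∀ w, ¬ DigitLT w u := by
  simp only [digitLT_iff]
  constructor
  · intro h w
    omega
  · intro h
    by_contra h'
    obtain ⟨w, hw⟩ := exists_digitVal_eq (n := n) (D := D) (m := 0)
      (by have := digitVal_lt u; omega)
    exact h w (by omega)

/-- The element is the least one. -/
def IsZero (x : Fin n) : Prop := ∀ y, x ≤ y

/-- The element is the second one. -/
def IsOne (x : Fin n) : Prop := ¬ IsZero x ∧ ∀ y, IsZero y ∨ x ≤ y

theorem isZero_iff (x : Fin n) : IsZero x ↔ (x : ℕ) = 0 :=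
  ⟨fun h => Nat.le_zero.1 (h ⟨0, x.pos⟩), fun h y => by simp [Fin.le_def, h]⟩

theorem isOne_iff (hn : 2 ≤ n) (x : Fin n) : IsOne x ↔ (x : ℕ) = 1 := by
  simp only [IsOne, isZero_iff, Fin.le_def]
  constructor
  · rintro ⟨h1, h2⟩
    have := h2 ⟨1, hn⟩
    simp only at this
    omega
  · intro h
    exact ⟨by omega, fun y => by omega⟩

/-- The leading digit is `1`, the last one is `y`, and the other ones are `0`. -/
def LeadingOne {E : ℕ} (u : Fin (E + 2) → Fin n) (y : Fin n) : Prop :=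
  u 0 = y ∧ (∀ i : Fin E, IsZero (u i.castSucc.succ)) ∧ IsOne (u (Fin.last (E + 1)))

/-- The number `n ^ (E + 1)` plays the part of the origin of the tapes, leaving room for negative
cells below it. So the input cell `y` is recognised by its digits, without arithmetic. -/
theorem leadingOne_iff (hn : 2 ≤ n) {E : ℕ} (u : Fin (E + 2) → Fin n) (y : Fin n) :
    LeadingOne u y ↔ digitVal u = n ^ (E + 1) + y := by
  have key : ∀ u : Fin (E + 2) → Fin n, LeadingOne u y → digitVal u = n ^ (E + 1) + y := by
    rintro u ⟨h1, h2, h3⟩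
    rw [digitVal_eq_sum, Fin.sum_univ_succ, Fin.sum_univ_castSucc]
    have h4 : ∀ i : Fin E, (u i.castSucc.succ : ℕ) = 0 := fun i => (isZero_iff _).1 (h2 i)
    have h5 : (u (Fin.last (E + 1)) : ℕ) = 1 := (isOne_iff hn _).1 h3
    simp [h1, h4, h5]
    ring
  refine ⟨key u, fun h => ?_⟩
  let g : Fin (E + 2) → Fin n := Fin.cons y (Fin.snoc (fun _ => ⟨0, by omega⟩) ⟨1, hn⟩)
  have hg : LeadingOne g y := by
    refine ⟨rfl, fun i => ?_, ?_⟩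
    · rw [isZero_iff]
      simp [g, Fin.cons_succ, Fin.snoc_castSucc]
    · rw [isOne_iff hn, ← Fin.succ_last]
      simp [g]
  rw [digitVal_injective (h.trans (key g hg).symm)]
  exact hg

end Digits

/-! ### Definability of tableaux -/

/-- The vocabulary with one unary relation symbol. -/
@[reducible] def wordVocabulary : Vocabulary := ⟨1, fun _ => 1, fun _ => one_pos, 0⟩

/-- The language for words with relation variables of arity `m`. -/
abbrev WordLang (k m : ℕ) : Language := RelLang wordVocabulary fun _ : Fin k => m

/-- The interpretations of the language for words. -/
@[reducible] def wordFamily (k m : ℕ) : Family (WordLang k m) :=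
  ⟨Σ A : Struc wordVocabulary, Fin k → Set (Fin m → Fin A.n), fun I => Fin I.1.n,
    fun I => relInterp I.1 I.2⟩

/-- The tableau given by relation variables. -/
@[reducible] def wordTableau {M : NTM} {k : ℕ} (e : M.Label → Fin k) {D : ℕ}
    (I : (wordFamily k (D + D)).Inst) : M.Label → (Fin D → Fin I.1.n) → (Fin D → Fin I.1.n) → Prop :=
  fun l t x => Fin.append t x ∈ I.2 (e l)

namespace UDef

section Atoms

variable {k m : ℕ} {α : Type}

theorem word_le (a b : α) : UDef (wordFamily k m) fun _ v => v a ≤ v b :=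
  UDef.rel (K := wordFamily k m) (RelLangRel.le : (WordLang k m).Relations 2) ![a, b]

theorem word_lt (a b : α) : UDef (wordFamily k m) fun _ v => v a < v b :=
  (word_le b a).not.congr fun _ _ => not_le

theorem word_input (a : α) : UDef (wordFamily k m) fun I v => (fun _ => v a) ∈ I.1.rel 0 :=
  (UDef.rel (K := wordFamily k m) (RelLangRel.input (σ := wordVocabulary) 0) fun _ => a).congr
    fun _ _ => Iff.rfl

theorem word_var (j : Fin k) (x : Fin m → α) :
    UDef (wordFamily k m) fun I v => (fun i => v (x i)) ∈ I.2 j :=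
  UDef.rel (K := wordFamily k m) (RelLangRel.var j : (WordLang k m).Relations m) x

theorem word_isZero (a : α) : UDef (wordFamily k m) fun _ v => IsZero (v a) :=
  UDef.all (word_le _ _)

theorem word_isOne (a : α) : UDef (wordFamily k m) fun _ v => IsOne (v a) :=
  UDef.and (word_isZero a).not (UDef.all (UDef.or (word_isZero _) (word_le _ _)))

theorem word_digitLT {D : ℕ} (u v : Fin D → α) :
    UDef (wordFamily k m) fun _ w => DigitLT (fun i => w (u i)) fun i => w (v i) :=
  UDef.exists_finite fun _ => UDef.and (word_lt _ _) (UDef.forall_finite fun _ =>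
    UDef.imp (UDef.const _) (UDef.eq _ _))

theorem word_digitVal_eq_add_one {D : ℕ} (u v : Fin D → α) : UDef (wordFamily k m) fun _ w =>
    digitVal (fun i => w (v i)) = digitVal (fun i => w (u i)) + 1 := by
  have h : UDef (wordFamily k m) fun I w => DigitLT (fun i => w (u i)) (fun i => w (v i)) ∧
      ∀ x : Fin D → Fin I.1.n, ¬ (DigitLT (fun i => w (u i)) x ∧ DigitLT x fun i => w (v i)) :=
    UDef.and (word_digitLT _ _) (UDef.forall_tuple (UDef.not
      (UDef.and (word_digitLT _ _) (word_digitLT _ _))))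
  exact h.congr fun I w => (digitVal_eq_add_one_iff _ _).symm

theorem word_digitVal_eq_zero {D : ℕ} (u : Fin D → α) : UDef (wordFamily k m) fun _ w =>
    digitVal (fun i => w (u i)) = 0 := by
  have h : UDef (wordFamily k m) fun I w =>
      ∀ x : Fin D → Fin I.1.n, ¬ DigitLT x fun i => w (u i) :=
    UDef.forall_tuple (UDef.not (word_digitLT _ _))
  exact h.congr fun I w => (digitVal_eq_zero_iff _).symm

theorem word_digitVal_shift {D : ℕ} (mv : Move) (u v : Fin D → α) : UDef (wordFamily k m) fun _ w =>
    (digitVal (fun i => w (v i)) : ℤ) = digitVal (fun i => w (u i)) + mv.shift := by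
  cases mv with
  | left =>
    refine (word_digitVal_eq_add_one v u).congr fun I w => ?_
    simp only [Move.shift]
    omega
  | stay =>
    have h : UDef (wordFamily k m) fun I w => ∀ i, w (v i) = w (u i) :=
      UDef.forall_finite fun _ => UDef.eq _ _
    refine h.congr fun I w => ?_
    simp only [Move.shift, add_zero, Nat.cast_inj]
    exact ⟨fun h => congrArg _ (funext h), fun h => congrFun (digitVal_injective h)⟩
  | right =>
    refine (word_digitVal_eq_add_one u v).congr fun I w => ?_
    simp only [Move.shift]
    omega

theorem word_leadingOne {E : ℕ} (u : Fin (E + 2) → α) (a : α) :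
    UDef (wordFamily k m) fun _ w => LeadingOne (fun i => w (u i)) (w a) :=
  UDef.and (UDef.eq _ _) (UDef.and (UDef.forall_finite fun _ => word_isZero _) (word_isOne _))

theorem word_append {D : ℕ} (j : Fin k) (u v : Fin D → α) : UDef (wordFamily k (D + D)) fun I w =>
    Fin.append (fun i => w (u i)) (fun i => w (v i)) ∈ I.2 j := by
  refine (word_var j (Fin.append u v)).congr fun I w => ?_
  rw [show (fun i => w (Fin.append u v i)) = Fin.append (fun i => w (u i)) fun i => w (v i) from
    funext fun i => by
      refine Fin.addCases (fun i => ?_) (fun i => ?_) i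
      · rw [Fin.append_left, Fin.append_left]
      · rw [Fin.append_right, Fin.append_right] ]

end Atoms

section Tableau

variable {M : NTM} {k E : ℕ} {α : Type} (e : M.Label → Fin k)

theorem word_sliceEmpty {D : ℕ} (t : Fin D → α) : UDef (wordFamily k (D + D)) fun I w =>
    NTM.SliceEmpty (wordTableau e I) fun i => w (t i) :=
  UDef.forall_finite fun _ => UDef.forall_tuple (UDef.not (word_append _ _ _))

theorem word_sliceScan {D : ℕ} (t : Fin D → α) (q : M.Q) (s : Fin (M.k + 1) → M.Γ) :
    UDef (wordFamily k (D + D)) fun I w =>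
      NTM.SliceScan (wordTableau e I) (fun i => w (t i)) q s :=
  UDef.forall_finite fun _ => UDef.exists_tuple (UDef.exists_finite fun _ =>
    UDef.and (word_append _ _ _) (UDef.const _))

theorem word_sliceAfter {D : ℕ} (t t' : Fin D → α) (q : M.Q)
    (a : M.Q × (Fin (M.k + 1) → M.Γ) × (Fin (M.k + 1) → Move)) :
    UDef (wordFamily k (D + D)) fun I w =>
      NTM.SliceAfter finFunctionFinEquiv (wordTableau e I) (fun i => w (t i)) (fun i => w (t' i))
        q a :=
  UDef.forall_finite fun _ => UDef.forall_tuple (UDef.iff (word_append _ _ _)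
    (UDef.exists_finite fun _ => UDef.and (word_append _ _ _) (UDef.and (UDef.const _)
      (UDef.forall_finite fun _ => UDef.and (UDef.const _) (UDef.iff (UDef.const _)
        (UDef.exists_tuple (UDef.exists_finite fun _ => UDef.and (word_digitVal_shift _ _ _)
          (UDef.and (word_append _ _ _) (UDef.const _)))))))))

theorem word_sliceStep {D : ℕ} (t t' : Fin D → α) : UDef (wordFamily k (D + D)) fun I w =>
    NTM.SliceStep finFunctionFinEquiv (wordTableau e I) (fun i => w (t i)) fun i => w (t' i) :=
  UDef.exists_finite fun _ => UDef.exists_finite fun _ => UDef.exists_finite fun _ =>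
    UDef.and (UDef.const _) (UDef.and (word_sliceScan e _ _ _) (word_sliceAfter e _ _ _ _))

theorem word_sliceAccept {D : ℕ} (t : Fin D → α) : UDef (wordFamily k (D + D)) fun I w =>
    NTM.SliceAccept (wordTableau e I) fun i => w (t i) :=
  UDef.exists_finite fun _ => UDef.exists_finite fun _ =>
    UDef.and (UDef.const _) (UDef.and (UDef.const _) (word_sliceScan e _ _ _))

end Tableau

end UDef

/-- For `n ≥ 2` coefficients can be absorbed into exponents: `a ≤ 2 ^ a ≤ n ^ a`, and a sum of two
powers is at most the next power. -/
theorem exists_eval_lt_pow (p : Polynomial ℕ) : ∃ E, ∀ n, 2 ≤ n → p.eval n < n ^ (E + 1) := by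
  induction p using Polynomial.induction_on' with
  | add p q hp hq =>
    obtain ⟨E₁, h₁⟩ := hp
    obtain ⟨E₂, h₂⟩ := hq
    refine ⟨max E₁ E₂ + 1, fun n hn => ?_⟩
    have g₁ : n ^ (E₁ + 1) ≤ n ^ (max E₁ E₂ + 1) := Nat.pow_le_pow_right (by omega) (by omega)
    have g₂ : n ^ (E₂ + 1) ≤ n ^ (max E₁ E₂ + 1) := Nat.pow_le_pow_right (by omega) (by omega)
    have g₃ : n ^ (max E₁ E₂ + 1) * 2 ≤ n ^ (max E₁ E₂ + 1 + 1) := by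
      rw [pow_succ n (max E₁ E₂ + 1)]
      exact Nat.mul_le_mul le_rfl hn
    rw [Polynomial.eval_add]
    have := h₁ n hn
    have := h₂ n hn
    omega
  | monomial k a =>
    refine ⟨a + k, fun n hn => ?_⟩
    rw [Polynomial.eval_monomial]
    calc a * n ^ k ≤ 2 ^ a * n ^ k := Nat.mul_le_mul Nat.lt_two_pow_self.le le_rfl
      _ ≤ n ^ a * n ^ k := Nat.mul_le_mul (Nat.pow_le_pow_left hn a) le_rfl
      _ = n ^ (a + k) := (pow_add _ _ _).symm
      _ < n ^ (a + k + 1) := Nat.pow_lt_pow_right (by omega) (by omega)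

/-! ### Initial slices and accepting tableaux as first-order conditions -/

section

variable {M : NTM} {n E : ℕ}

/-- The slice describes the initial configuration on the word given by a unary relation. -/
def SliceInit (R : Set (Fin 1 → Fin n))
    (S : M.Label → (Fin (E + 2) → Fin n) → (Fin (E + 2) → Fin n) → Prop)
    (t : Fin (E + 2) → Fin n) : Prop :=
  ∀ l x, S l t x ↔ l.1 = M.start ∧ ∀ i, ((l.2 i).2 = true ↔ ∃ y, IsZero y ∧ LeadingOne x y) ∧
    ((i = 0 ∧ ∃ y, LeadingOne x y ∧ ((fun _ => y) ∈ R ∧ (l.2 i).1 = M.bit true ∨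
        (fun _ => y) ∉ R ∧ (l.2 i).1 = M.bit false)) ∨
      ¬ (i = 0 ∧ ∃ y, LeadingOne x y) ∧ (l.2 i).1 = M.blank)

/-- Position `x` stands for the cell `z = digitVal x - n ^ (E + 1)`, so `LeadingOne x y` says that
`z = y`: the cell holds the input bit that tells whether `y` is in `R`. Any other cell is blank, and
so are all cells of the other tapes. -/
theorem sliceInit_iff (hn : 2 ≤ n) (R : Set (Fin 1 → Fin n))
    (S : M.Label → (Fin (E + 2) → Fin n) → (Fin (E + 2) → Fin n) → Prop)
    (t : Fin (E + 2) → Fin n) :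
    SliceInit R S t ↔ NTM.SliceIs finFunctionFinEquiv (n ^ (E + 1)) S t
      (some (M.init (encRel R))) := by
  have key : ∀ (l : M.Label) (x : Fin (E + 2) → Fin n), (l.1 = M.start ∧ ∀ i,
      ((l.2 i).2 = true ↔ ∃ y, IsZero y ∧ LeadingOne x y) ∧
      ((i = 0 ∧ ∃ y, LeadingOne x y ∧ ((fun _ => y) ∈ R ∧ (l.2 i).1 = M.bit true ∨
          (fun _ => y) ∉ R ∧ (l.2 i).1 = M.bit false)) ∨
        ¬ (i = 0 ∧ ∃ y, LeadingOne x y) ∧ (l.2 i).1 = M.blank)) ↔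
      l = (M.init (encRel R)).label ((digitVal x : ℤ) - (n ^ (E + 1) : ℕ)) := by
    rintro ⟨q, l⟩ x
    obtain ⟨z, hz⟩ : ∃ z, z = (digitVal x : ℤ) - (n ^ (E + 1) : ℕ) := ⟨_, rfl⟩
    have hlead : ∀ y : Fin n, LeadingOne x y ↔ z = (y : ℕ) := by
      intro y
      rw [leadingOne_iff hn]
      omega
    rw [← hz]
    simp only [hlead, NTM.Cfg.label, NTM.init, Prod.ext_iff, funext_iff]
    refine and_congr Iff.rfl (forall_congr' fun i => ?_)
    rw [and_comm]
    refine and_congr ?_ ?_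
    · by_cases hi : i = 0 ∧ ∃ y : Fin n, z = (y : ℕ)
      · obtain ⟨hi0, y, hy⟩ := hi
        have hy' : ∀ y' : Fin n, z = (y' : ℕ) ↔ y' = y := fun y' => by
          rw [Fin.ext_iff]
          omega
        have hb : (encRel R)[z.toNat]? = some (decide ((fun _ => y) ∈ R)) := by
          rw [hy, Int.toNat_natCast]
          exact encRel_getElem_one R y y.2
        have hz0 : 0 ≤ z := by omega
        simp only [hi0, hy', hz0, hb, true_and, exists_eq, exists_eq_left, not_true_eq_false,
          false_and, or_false, and_self, if_true, Option.map_some, Option.getD_some]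
        by_cases hR : (fun _ => y) ∈ R <;> simp [hR]
      · have h1 : ¬ (i = 0 ∧ ∃ y : Fin n, z = (y : ℕ) ∧ ((fun _ => y) ∈ R ∧ (l i).1 = M.bit true ∨
            (fun _ => y) ∉ R ∧ (l i).1 = M.bit false)) :=
          fun ⟨h, y, hy, _⟩ => hi ⟨h, y, hy⟩
        rw [or_iff_right h1, and_iff_right hi]
        refine iff_of_eq (congrArg _ ?_)
        split_ifs with h
        · have hlen : (encRel R).length ≤ z.toNat := by
            rw [encRel_length, pow_one]
            by_contra hlt
            exact hi ⟨h.1, ⟨z.toNat, by omega⟩, by simp [h.2]⟩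
          rw [List.getElem?_eq_none hlen]
          rfl
        · rfl
    · refine Iff.trans (iff_congr Iff.rfl ?_) (Bool.eq_iff_iff.symm.trans Iff.rfl)
      refine Iff.trans ?_ decide_eq_true_iff.symm
      constructor
      · rintro ⟨y, hy0, hy⟩
        rw [hy, (isZero_iff y).1 hy0]
        rfl
      · intro h
        exact ⟨⟨0, by omega⟩, (isZero_iff _).2 rfl, h.symm⟩
  constructor
  · intro h x l
    rw [h l x, key]
    exact ⟨fun h => ⟨_, rfl, h⟩, fun ⟨_, h1, h2⟩ => by cases h1; exact h2⟩
  · intro h l x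
    rw [key]
    exact h.apply l x

variable {k : ℕ} (e : M.Label → Fin k)

theorem UDef.word_sliceInit {α : Type} (t : Fin (E + 2) → α) :
    UDef (wordFamily k ((E + 2) + (E + 2))) fun I w =>
      SliceInit (I.1.rel 0) (wordTableau e I) fun i => w (t i) := by
  refine UDef.forall_finite fun _ => UDef.forall_tuple (UDef.iff (word_append _ _ _)
    (UDef.and (UDef.const _) (UDef.forall_finite fun _ => UDef.and (UDef.iff (UDef.const _)
      (UDef.ex (UDef.and (word_isZero _) (word_leadingOne _ _)))) (UDef.or
        (UDef.and (UDef.const _) (UDef.ex (UDef.and (word_leadingOne _ _) (UDef.or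
          (UDef.and (word_input _) (UDef.const _)) (UDef.and (UDef.not (word_input _))
            (UDef.const _))))))
        (UDef.and (UDef.not (UDef.and (UDef.const _) (UDef.ex (word_leadingOne _ _))))
          (UDef.const _))))))

/-- The relation variables describe the tableau of an accepting path. -/
def WordAccept (I : (wordFamily k ((E + 2) + (E + 2))).Inst) : Prop :=
  (∀ t : Fin (E + 2) → Fin I.1.n, digitVal t = 0 → SliceInit (I.1.rel 0) (wordTableau e I) t) ∧
  (∀ t t' : Fin (E + 2) → Fin I.1.n, digitVal t' = digitVal t + 1 →
    NTM.SliceStep finFunctionFinEquiv (wordTableau e I) t t' ∨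
      NTM.SliceEmpty (wordTableau e I) t' ∧ (NTM.SliceEmpty (wordTableau e I) t ∨
        NTM.SliceAccept (wordTableau e I) t)) ∧
  ∀ t : Fin (E + 2) → Fin I.1.n, (∀ t', ¬ DigitLT t t') → NTM.SliceEmpty (wordTableau e I) t

theorem UDef.word_accept : UDef (wordFamily k ((E + 2) + (E + 2))) fun I (_ : Fin 0 → _) =>
    WordAccept e I :=
  UDef.and (UDef.forall_tuple (UDef.imp (word_digitVal_eq_zero _) (word_sliceInit e _)))
    (UDef.and (UDef.forall_tuple (UDef.forall_tuple (UDef.imp (word_digitVal_eq_add_one _ _)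
      (UDef.or (word_sliceStep e _ _) (UDef.and (word_sliceEmpty e _)
        (UDef.or (word_sliceEmpty e _) (word_sliceAccept e _)))))))
    (UDef.forall_tuple (UDef.imp (UDef.forall_tuple (UDef.not (word_digitLT _ _)))
      (word_sliceEmpty e _))))

theorem wordAccept_iff (I : (wordFamily k ((E + 2) + (E + 2))).Inst) (hn : 2 ≤ I.1.n) :
    WordAccept e I ↔ NTM.IsTableau finFunctionFinEquiv (I.1.n ^ (E + 1)) (wordTableau e I)
      (encRel (I.1.rel 0)) := by
  refine and_congr (forall_congr' fun t => forall_congr' fun _ => sliceInit_iff hn _ _ _)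
    (and_congr Iff.rfl (forall_congr' fun t => ?_))
  simp only [digitLT_iff, not_lt]
  exact Iff.rfl

end

/-! ### From machines to relation variables -/

theorem enc_wordVocabulary (A : Struc wordVocabulary) : enc A = encRel (A.rel 0) := by
  simp [enc, List.finRange_succ]

section

variable {Λ : Type} {K k D : ℕ} (e : Λ ⊕ Fin K ≃ Fin k)

/-- Relation variables that describe a tableau and auxiliary relations that are empty or full. -/
def assemble {n : ℕ} (S : Λ → (Fin D → Fin n) → (Fin D → Fin n) → Prop) (X : Fin K → Prop) :
    Fin k → Set (Fin (D + D) → Fin n) := fun j =>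
  Sum.elim (fun l => {u | S l (fun i => u (Fin.castAdd D i)) fun i => u (Fin.natAdd D i)})
    (fun i => {_u | X i}) (e.symm j)

theorem mem_assemble_inl {n : ℕ} (S : Λ → (Fin D → Fin n) → (Fin D → Fin n) → Prop)
    (X : Fin K → Prop) (l : Λ) (u : Fin (D + D) → Fin n) : u ∈ assemble e S X (e (.inl l)) ↔
      S l (fun i => u (Fin.castAdd D i)) fun i => u (Fin.natAdd D i) := by
  rw [assemble, Equiv.symm_apply_apply]
  exact Iff.rfl

theorem mem_assemble_inr {n : ℕ} (S : Λ → (Fin D → Fin n) → (Fin D → Fin n) → Prop)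
    (X : Fin K → Prop) (i : Fin K) (u : Fin (D + D) → Fin n) :
    u ∈ assemble e S X (e (.inr i)) ↔ X i := by
  rw [assemble, Equiv.symm_apply_apply]
  exact Iff.rfl

theorem assemble_append {n : ℕ} (S : Λ → (Fin D → Fin n) → (Fin D → Fin n) → Prop)
    (X : Fin K → Prop) :
    (fun l t x => Fin.append t x ∈ assemble e S X (e (.inl l))) = S := by
  funext l t x
  rw [mem_assemble_inl]
  simp only [Fin.append_left, Fin.append_right]

theorem eq_assemble {n : ℕ} (T : Fin k → Set (Fin (D + D) → Fin n)) (X : Fin K → Prop)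
    (hX : ∀ i u, u ∈ T (e (.inr i)) ↔ X i) :
    T = assemble e (fun l t x => Fin.append t x ∈ T (e (.inl l))) X := by
  funext j
  obtain ⟨j, rfl⟩ := e.surjective j
  ext u
  rcases j with l | i
  · rw [mem_assemble_inl]
    have : Fin.append (fun i => u (Fin.castAdd D i)) (fun i => u (Fin.natAdd D i)) = u := by
      funext i
      refine Fin.addCases (fun i => ?_) (fun i => ?_) i
      · rw [Fin.append_left]
      · rw [Fin.append_right]
    rw [this]
  · rw [mem_assemble_inr, hX]

theorem assemble_injective {n : ℕ} (X : Fin K → Prop) :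
    Function.Injective fun S : Λ → (Fin D → Fin n) → (Fin D → Fin n) → Prop => assemble e S X := by
  intro S S' h
  rw [← assemble_append e S X, ← assemble_append e S' X]
  dsimp only at h
  rw [h]

end

/-- The relation variables describe one of the `f [b]` choices for the word with the only bit
`b`. -/
def BitChoice (f : List Bool → ℕ) {Λ : Type} {K k m : ℕ} (e : Λ ⊕ Fin K ≃ Fin k)
    (I : (wordFamily k m).Inst) : Prop :=
  (∀ x y : Fin I.1.n, x = y) ∧ (∀ l u, u ∉ I.2 (e (.inl l))) ∧
    ∃ b : Bool, ((∃ x, (fun _ => x) ∈ I.1.rel 0) ↔ b = true) ∧ ∃ i : Fin K, (i : ℕ) < f [b] ∧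
      ∀ i', (∃ u, u ∈ I.2 (e (.inr i'))) ↔ i' = i

/-- The relation variables describe the tableau of an accepting path on a word with several
bits. -/
def ProperAccept {M : NTM} {K k E : ℕ} (e : M.Label ⊕ Fin K ≃ Fin k)
    (I : (wordFamily k ((E + 2) + (E + 2))).Inst) : Prop :=
  (∃ x y : Fin I.1.n, x ≠ y) ∧ (∀ i u, u ∉ I.2 (e (.inr i))) ∧ WordAccept (fun l => e (.inl l)) I

theorem UDef.bitChoice (f : List Bool → ℕ) {Λ : Type} [Finite Λ] {K k m : ℕ}
    (e : Λ ⊕ Fin K ≃ Fin k) :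
    UDef (wordFamily k m) fun I (_ : Fin 0 → _) => BitChoice f e I :=
  UDef.and (UDef.all (UDef.all (UDef.eq _ _))) (UDef.and (UDef.forall_finite fun _ =>
    UDef.forall_tuple (UDef.not (word_var _ _))) (UDef.exists_finite fun _ => UDef.and
      (UDef.iff (UDef.ex (word_input _)) (UDef.const _)) (UDef.exists_finite fun _ => UDef.and
        (UDef.const _) (UDef.forall_finite fun _ => UDef.iff
          (UDef.exists_tuple (word_var _ _)) (UDef.const _)))))

theorem UDef.properAccept {M : NTM} {K k E : ℕ} (e : M.Label ⊕ Fin K ≃ Fin k) :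
    UDef (wordFamily k ((E + 2) + (E + 2))) fun I (_ : Fin 0 → _) => ProperAccept e I :=
  UDef.and (UDef.ex (UDef.ex (UDef.not (UDef.eq _ _)))) (UDef.and (UDef.forall_finite fun _ =>
    UDef.forall_tuple (UDef.not (word_var _ _))) (UDef.word_accept _))

theorem encard_properAccept {M : NTM} {K k E : ℕ} (e : M.Label ⊕ Fin K ≃ Fin k)
    (A : Struc wordVocabulary) (hA : 2 ≤ A.n)
    (hM : ∀ p : List M.Cfg, M.IsComputation (enc A) p → p.length < A.n ^ (E + 1)) :
    {T | ProperAccept (E := E) e ⟨A, T⟩}.encard = {p | M.IsAcceptingPath (enc A) p}.encard := by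
  -- With origin `C = n ^ (E + 1)` there must be `C` cells on either side; the additional digit
  -- provides them because `n ≥ 2`.
  have hN : 2 * A.n ^ (E + 1) ≤ A.n ^ (E + 2) := by
    rw [pow_succ _ (E + 1), mul_comm]
    exact Nat.mul_le_mul le_rfl hA
  rw [← NTM.encard_isTableau (finFunctionFinEquiv : (Fin (E + 2) → Fin A.n) ≃ _) hM hN,
    ← (assemble_injective e (fun _ => False)).injOn.encard_image]
  congr 1
  ext T
  constructor
  · rintro ⟨-, h1, h2⟩
    have hT := eq_assemble e T (fun _ => False) fun i u => iff_false_intro (h1 i u)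
    refine ⟨_, ?_, hT.symm⟩
    rw [enc_wordVocabulary]
    exact (wordAccept_iff _ ⟨A, T⟩ hA).1 h2
  · rintro ⟨S, hS, rfl⟩
    refine ⟨⟨⟨0, A.n_pos⟩, ⟨1, hA⟩, by simp⟩, fun i u => ?_, (wordAccept_iff _ ⟨A, _⟩ hA).2 ?_⟩
    · rw [mem_assemble_inr]
      exact not_false
    · have h : wordTableau (fun l => e (.inl l)) ⟨A, assemble e S fun _ => False⟩ = S :=
        assemble_append e S _
      rw [Set.mem_ofPred_eq, enc_wordVocabulary] at hS
      rwa [h]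

/-- Over one element all relations are empty or full. The tableau relations are empty and exactly
one auxiliary relation, with index below `f [b]`, is full, so the index is the only choice. -/
theorem encard_bitChoice (f : List Bool → ℕ) {Λ : Type} {K k D : ℕ} (e : Λ ⊕ Fin K ≃ Fin k)
    (hK : ∀ b, f [b] ≤ K) (A : Struc wordVocabulary) (hA : A.n = 1) :
    {T | BitChoice (m := D + D) f e ⟨A, T⟩}.encard = f (enc A) := by
  obtain ⟨n, hn, R, c⟩ := A
  dsimp only at hA
  subst hA
  have hw : enc (⟨1, hn, R, c⟩ : Struc wordVocabulary) =
      [decide (∃ x, (fun _ => x) ∈ R 0)] := by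
    rw [enc_wordVocabulary]
    refine List.ext_getElem? fun i => ?_
    rcases i with _ | i
    · rw [encRel_getElem_one _ 0 one_pos]
      simp
    · rw [List.getElem?_eq_none (by rw [encRel_length]; simp), List.getElem?_eq_none (by simp)]
  rw [hw]
  set b := decide (∃ x, (fun _ => x) ∈ R 0) with hb
  have hset : {T | BitChoice (m := D + D) f e ⟨⟨1, hn, R, c⟩, T⟩} =
      (fun p : Fin (f [b]) => assemble e (fun _ _ _ => False) fun i => i = Fin.castLE (hK b) p) ''
        Set.univ := by
    ext T
    constructor
    · rintro ⟨-, h1, b', hb', i, hi, h2⟩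
      obtain rfl : b' = b := by
        rw [Bool.eq_iff_iff, ← hb', hb, decide_eq_true_iff]
      refine ⟨⟨i, hi⟩, Set.mem_univ _, ?_⟩
      have hT := eq_assemble e T (fun i' => i' = i) fun i' u => by
        rw [← h2 i']
        refine ⟨fun h => ⟨u, h⟩, ?_⟩
        rintro ⟨u', hu'⟩
        have : u = u' := Subsingleton.elim (α := Fin (D + D) → Fin 1) _ _
        rwa [this]
      rw [hT]
      refine congrArg (fun S => assemble e S fun i' => i' = i) ?_
      funext l t x
      exact (eq_false (h1 _ _)).symm
    · rintro ⟨p, -, rfl⟩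
      refine ⟨Subsingleton.elim (α := Fin 1), fun l u => ?_, b, ?_, Fin.castLE (hK b) p, p.2,
        fun i' => ?_⟩
      · rw [mem_assemble_inl]
        exact not_false
      · exact (decide_eq_true_iff (p := ∃ x, (fun _ => x) ∈ R 0)).symm
      · simp only [mem_assemble_inr]
        exact ⟨fun ⟨_, h⟩ => h, fun h => ⟨fun _ => (0 : Fin 1), h⟩⟩
  rw [hset, Set.InjOn.encard_image]
  · simp
  · intro p _ p' _ h
    have h1 := Set.ext_iff.1 (congrFun h (e (.inr (Fin.castLE (hK b) p)))) fun _ => 0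
    simp only [mem_assemble_inr] at h1
    simpa using h1

theorem sharpP_subset_sharpFORel : SharpP ⊆ SharpFORel := by
  rintro f ⟨M, ⟨p, hp⟩, hf⟩
  obtain ⟨E, hE⟩ := exists_eval_lt_pow p
  obtain ⟨K, hK⟩ : ∃ K, ∀ b, f [b] ≤ K := by
    obtain ⟨K, hK⟩ := (Set.finite_range fun b => f [b]).bddAbove
    exact ⟨K, fun b => hK ⟨b, rfl⟩⟩
  obtain ⟨k, ⟨e⟩⟩ := Finite.exists_equiv_fin (M.Label ⊕ Fin K)
  obtain ⟨φ, hφ⟩ := (UDef.properAccept (E := E) e).or (UDef.bitChoice f e)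
  refine ⟨wordVocabulary, k, 0, fun _ => (E + 2) + (E + 2), φ, fun A => ?_, fun w hw h => ?_⟩
  · have hset : {q : (Fin k → Set (Fin ((E + 2) + (E + 2)) → Fin A.n)) × (Fin 0 → Fin A.n) |
        @FirstOrder.Language.Formula.Realize (WordLang k _) (Fin A.n) (relInterp A q.1) (Fin 0) φ
          q.2} = (fun T => (T, default)) '' {T : Fin k → Set (Fin ((E + 2) + (E + 2)) → Fin A.n) |
          ProperAccept e ⟨A, T⟩ ∨ BitChoice f e ⟨A, T⟩} := by
      ext ⟨T, c⟩
      constructor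
      · intro h
        exact ⟨T, (hφ ⟨A, T⟩ c).1 h, Prod.ext rfl (Subsingleton.elim _ _)⟩
      · rintro ⟨T', h, h'⟩
        cases h'
        exact (hφ ⟨A, T⟩ _).2 h
    have hcount : ((relCount φ A : ℕ) : ℕ∞) =
        {T : Fin k → Set (Fin ((E + 2) + (E + 2)) → Fin A.n) |
          ProperAccept e ⟨A, T⟩ ∨ BitChoice f e ⟨A, T⟩}.encard := by
      rw [relCount, hset, Set.Finite.cast_ncard_eq (Set.toFinite _), Set.InjOn.encard_image]
      exact fun T _ T' _ h => congrArg Prod.fst h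
    refine Nat.cast_injective (R := ℕ∞) ?_
    rw [hcount]
    by_cases hA : 2 ≤ A.n
    · have h0 : ∀ T, ¬ BitChoice (m := (E + 2) + (E + 2)) f e ⟨A, T⟩ := fun T h => by
        simpa using h.1 ⟨0, A.n_pos⟩ ⟨1, hA⟩
      simp only [h0, or_false]
      rw [← hf, encard_properAccept e A hA]
      intro q hq
      refine (hp _ q hq).trans_lt ?_
      have hlen : (enc A).length = A.n := by rw [enc_wordVocabulary, encRel_length, pow_one]
      rw [hlen]
      exact hE _ hA
    · have hA1 : A.n = 1 := by
        have := A.n_pos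
        omega
      have h0 : ∀ T, ¬ ProperAccept (E := E) e ⟨A, T⟩ := by
        rintro T ⟨⟨x, y, hxy⟩, -⟩
        refine hxy (Fin.ext ?_)
        have hx : (x : ℕ) < A.n := x.2
        have hy : (y : ℕ) < A.n := y.2
        omega
      simp only [h0, false_or]
      exact (encard_bitChoice f e hK A hA1).symm
  -- Every nonempty word is the truth table of a unary relation on its positions, so there is no
  -- word to be excluded.
  · exfalso
    obtain ⟨R, hR⟩ := exists_encRel_eq (n := w.length) (a := 1) w (by simp)
    refine h ⟨w.length, List.length_pos_iff.2 hw, fun _ => R, Fin.elim0⟩ ?_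
    rw [enc_wordVocabulary]
    exact hR

end CountFO

theorem mainTheorem2 :
    CountFO.SharpFORel = CountFO.SharpFO ∧ CountFO.SharpFO = CountFO.SharpP := by
  have h1 := CountFO.sharpFORel_subset_sharpFO
  have h2 := CountFO.sharpFO_subset_sharpP
  have h3 := CountFO.sharpP_subset_sharpFORel
  exact ⟨h1.antisymm (h2.trans h3), h2.antisymm (h3.trans h1)⟩
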